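/- Let $L>0$, $\nu,\alpha>0$, $\ell\in\{0,1\}$, $N\ge 1$, and put $\lambda_j=(j\pi/L)^2$, $e_j(x)=\sqrt{2/L}\,\sin(j\pi x/L)$, $(f,g)_2=\int_0^L fg\,dx$, $P_Nf=\sum_{j=1}^N(f,e_j)_2\,e_j$. For $\mu>0$ let \[ k(x,y)=-\frac{\mu y}{2\nu}\sum_{m=0}^\infty\Big(-\frac{\mu}{4\nu}\Big)^m\frac{(x^2-y^2)^m}{m!\,(m+1)!},\qquad (\Upsilon_kf)(x)=\int_0^x k(x,y)f(y)\,dy . \] Define $\Phi_0=0$ and, for $1\le j\le N$, \[ \Phi_jf=(I-\Phi_{j-1})\Upsilon_kP_jf-\frac{\big((I-\Phi_{j-1})\Upsilon_kP_jf,e_j\big)_2}{1+\big((I-\Phi_{j-1})\Upsilon_ke_j,e_j\big)_2}\,(I-\Phi_{j-1})\Upsilon_ke_j . \] Assume that $(\mu,N)$ is admissible, i.e. $\big((I-\Phi_{j-1})\Upsilon_ke_j,e_j\big)_2\ne-1$ for $1\le j\le N$, and consider the feedback \[ g(P_Nf)=\int_0^L k(L,y)\,\big[(I-P_N\Phi_N)P_Nf\big](y)\,dy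 , \] which uses only the first $N$ sine modes of $f$. Suppose that $\lambda_N<\alpha/\nu<\lambda_{N+1}$ (that is, $N$ is exactly the number of unstable modes) and \[ 2(\alpha-\nu\lambda_1)\Big(1-\frac1{(N+1)^2}\Big)^{-1}<\mu<2\nu\lambda_{N+1}, \] and put $\rho=\nu\lambda_1-\alpha+\frac{\mu}{2}\big(1-\frac1{(N+1)^2}\big)$. Then $\rho>0$. Moreover, let $u_0\in H^\ell(0,L)$ and, if $\ell=1$, assume the compatibility conditions $u_0(0)=0$ and $u_0(L)=g(P_Nu_0)$. Then the closed-loop linear plant \[ u_t-\nu u_{xx}-\alpha u=0\ \text{ on }(0,L)\times(0,\infty),\qquad u(0,t)=0,\quad u(L,t)=g(P_Nu(t)),\quad u(x,0)=u_0(x) \] has exactly one weak solution $u\in\bigcap_{T>0}L^2(0,T;H^1(0,L))$. It belongs to $X_T^\ell=L^\infty(0,T;H^\ell(0,L))\cap L^2(0,T;H^{\ell+1}(0,L))$ for every $T>0$ and satisfies \[ \|u(t)\|_{H^\ell(0,L)}\le c_k\,e^{-\rho t}\,\|u_0\|_{H^\ell(0,L)}\qquad\text{for a.e. }t\ge0,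 \] where $c_k\ge0$ depends only on the kernel $k$ and on $L$, $N$, $\ell$ (in particular not on $u_0$). Here a weak solution is a measurable $u$ in the above class with boundary traces $u(0,t)=0$, $u(L,t)=g(P_Nu(t))$ for a.e. $t>0$ and \[ \int_0^\infty\!\!\int_0^L\big(-u\,\eta_t+\nu u_x\eta_x-\alpha u\,\eta\big)\,dx\,dt=\int_0^L u_0(x)\,\eta(x,0)\,dx \] for all smooth $\eta$ that vanish at $x=0$, at $x=L$ and for all large $t$. -/

import Mathlib

open MeasureTheory Set Real
open scoped ContDiff Nat ENNReal

noncomputable section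

namespace Backstepping

/-! ## Sobolev spaces on the interval `(0, L)` -/

/-- Lebesgue measure on the interval `(0, L)`. -/
def vol (L : ℝ) : Measure ℝ := volume.restrict (Ioo 0 L)

/-- `g` is the weak derivative of order `i` of `f` on `(0, L)`
(to be used for `f`, `g` in `L²(0, L)`). -/
def HasWeakDeriv (L : ℝ) (i : ℕ) (f g : ℝ → ℝ) : Prop :=
  ∀ η : ℝ → ℝ, ContDiff ℝ ∞ η → HasCompactSupport η → tsupport η ⊆ Ioo 0 L →
    ∫ x in (0 : ℝ)..L, f x * iteratedDeriv i η x = (-1) ^ i * ∫ x in (0 : ℝ)..L, g x * η x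

/-- `f ∈ H^m(0, L)`: `f` and its weak derivatives up to order `m` are in `L²(0, L)`. -/
def MemSobolev (m : ℕ) (L : ℝ) (f : ℝ → ℝ) : Prop :=
  MemLp f 2 (vol L) ∧ ∀ i ≤ m, ∃ g : ℝ → ℝ, MemLp g 2 (vol L) ∧ HasWeakDeriv L i f g

open Classical in
/-- A representative of the weak derivative of order `i` of `f` in `L²(0, L)`
(zero if there is none). It is unique up to equality almost everywhere on `(0, L)`. -/
def weakDeriv (L : ℝ) (i : ℕ) (f : ℝ → ℝ) : ℝ → ℝ :=
  if h : ∃ g : ℝ → ℝ, MemLp g 2 (vol L) ∧ HasWeakDeriv L i f g then h.choose else 0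

open Classical in
/-- The `H^m(0, L)` norm, with value `∞` outside `H^m(0, L)`. -/
def sobolevNorm (m : ℕ) (L : ℝ) (f : ℝ → ℝ) : ℝ≥0∞ :=
  if MemSobolev m L f then
    (∑ i ∈ Finset.range (m + 1), eLpNorm (weakDeriv L i f) 2 (vol L) ^ 2) ^ (1 / 2 : ℝ)
  else ⊤

/-- The boundary values (traces) of `f` at `0` and at `L` are `a` and `b`:
they are the boundary values of the continuous representative of `f` on `[0, L]`. -/
def HasTraces (L : ℝ) (f : ℝ → ℝ) (a b : ℝ) : Prop :=
  ∃ F : ℝ → ℝ, ContinuousOn F (Icc 0 L) ∧ f =ᵐ[vol L] F ∧ F 0 = a ∧ F L = b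

/-- `u ∈ X_T^ℓ = L^∞(0, T; H^ℓ(0, L)) ∩ L²(0, T; H^{ℓ+1}(0, L))`, for a function `u t x`
of time `t` and position `x`. -/
def MemX (ℓ : ℕ) (L T : ℝ) (u : ℝ → ℝ → ℝ) : Prop :=
  AEStronglyMeasurable (fun p : ℝ × ℝ => u p.1 p.2)
      (volume.restrict (Ioo (0 : ℝ) T ×ˢ Ioo 0 L)) ∧
    essSup (fun t => sobolevNorm ℓ L (u t) ^ 2) (volume.restrict (Ioo 0 T)) +
      ∫⁻ t in Ioo 0 T, sobolevNorm (ℓ + 1) L (u t) ^ 2 < ⊤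

/-! ## Fourier sine modes, backstepping kernel and feedback -/

/-- The `j`-th Dirichlet eigenvalue of `-d²/dx²` on `(0, L)`. -/
def eigenvalue (L : ℝ) (j : ℕ) : ℝ := (j * π / L) ^ 2

/-- The `j`-th normalized Dirichlet eigenfunction on `(0, L)`. -/
def e (L : ℝ) (j : ℕ) (x : ℝ) : ℝ := √(2 / L) * sin (j * π * x / L)

/-- The inner product of `L²(0, L)`. -/
def innerL2 (L : ℝ) (f g : ℝ → ℝ) : ℝ := ∫ x in (0 : ℝ)..L, f x * g x

/-- The projection `P_N` onto the first `N` Fourier sine modes. -/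
def proj (L : ℝ) (N : ℕ) (f : ℝ → ℝ) (x : ℝ) : ℝ :=
  ∑ j ∈ Finset.Icc 1 N, innerL2 L (e L j) f * e L j x

/-- The backstepping kernel `k(x, y)`. -/
def kernel (ν μ : ℝ) (x y : ℝ) : ℝ :=
  -(μ * y / (2 * ν)) *
    ∑' m : ℕ, (-(μ / (4 * ν))) ^ m * (x ^ 2 - y ^ 2) ^ m / ((m ! : ℝ) * ((m + 1) ! : ℝ))

/-- The Volterra operator `(Υ_k f)(x) = ∫_0^x k(x, y) f(y) dy`. -/
def volterra (k : ℝ → ℝ → ℝ) (f : ℝ → ℝ) (x : ℝ) : ℝ := ∫ y in (0 : ℝ)..x, k x y * f y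

/-- The operators `Φ_j`, with `Φ_0 = 0` and, writing `R = I - Φ_j` and `i = j + 1`,
`Φ_i f = R Υ_k P_i f - (R Υ_k P_i f, e_i) / (1 + (R Υ_k e_i, e_i)) • R Υ_k e_i`. -/
def Phi (L : ℝ) (k : ℝ → ℝ → ℝ) : ℕ → (ℝ → ℝ) → ℝ → ℝ
  | 0, _ => 0
  | j + 1, f =>
    let a := volterra k (proj L (j + 1) f) - Phi L k j (volterra k (proj L (j + 1) f))
    let b := volterra k (e L (j + 1)) - Phi L k j (volterra k (e L (j + 1)))
    a - (innerL2 L a (e L (j + 1)) / (1 + innerL2 L b (e L (j + 1)))) • b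

/-- Admissibility of the decay rate-mode pair, in terms of the kernel `k` and of `N`:
`((I - Φ_{j-1}) Υ_k e_j, e_j) ≠ -1` for `1 ≤ j ≤ N`. -/
def IsAdmissible (L : ℝ) (k : ℝ → ℝ → ℝ) (N : ℕ) : Prop :=
  ∀ j : ℕ, 1 ≤ j → j ≤ N →
    innerL2 L (volterra k (e L j) - Phi L k (j - 1) (volterra k (e L j))) (e L j) ≠ -1

/-- The feedback `g(P_N f) = ∫_0^L k(L, y) (Γ P_N f)(y) dy`, where `Γ = I - P_N Φ_N`. -/
def feedback (L : ℝ) (k : ℝ → ℝ → ℝ) (N : ℕ) (f : ℝ → ℝ) : ℝ :=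
  ∫ y in (0 : ℝ)..L, k L y * (proj L N f y - proj L N (Phi L k N (proj L N f)) y)

/-! ## Weak solutions of the linear plant -/

/-- `u` is a weak solution on `(0, L) × (0, ∞)` of `u_t - ν u_xx - α u = 0` with
`u(0, t) = 0`, `u(L, t) = g(u(t))` and `u(x, 0) = u₀(x)`; here `u t x` is the value at
time `t` and position `x`. -/
structure IsWeakSolution (L ν α : ℝ) (g : (ℝ → ℝ) → ℝ) (u₀ : ℝ → ℝ) (u : ℝ → ℝ → ℝ) :
    Prop where
  measurable : AEStronglyMeasurable (fun p : ℝ × ℝ => u p.1 p.2)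
    (volume.restrict (Ioi (0 : ℝ) ×ˢ Ioo 0 L))
  memSobolev : ∀ᵐ t ∂volume.restrict (Ioi 0), MemSobolev 1 L (u t)
  sq_integrable : ∀ T > 0, ∫⁻ t in Ioo 0 T, sobolevNorm 1 L (u t) ^ 2 < ⊤
  boundary : ∀ᵐ t ∂volume.restrict (Ioi 0), HasTraces L (u t) 0 (g (u t))
  weak_form : ∀ η : ℝ → ℝ → ℝ, ContDiff ℝ ∞ (fun p : ℝ × ℝ => η p.1 p.2) →
    (∀ t, η t 0 = 0) → (∀ t, η t L = 0) → (∃ T, ∀ t ≥ T, ∀ x, η t x = 0) →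
    ∫ t in Ioi 0, (∫ x in (0 : ℝ)..L,
        (-(u t x * deriv (fun s => η s x) t) + ν * (weakDeriv L 1 (u t) x * deriv (η t) x)
          - α * (u t x * η t x))) =
      ∫ x in (0 : ℝ)..L, u₀ x * η 0 x

end Backstepping

end

open Backstepping

namespace Backstepping

/-! Put κ = μ/ν. The kernel is built so that I + Υ_k turns sin(wx) into (w/r) sin(rx) with r² = w² +
κ (`volterra_kernel_sin`): it shifts a Dirichlet eigenvalue by κ and keeps the zero at x = 0. Let
Q_n = e_n + Υ_k e_n for n ≤ N and Q_n = e_n for n > N. Then -Q_n'' = θ_n Q_n and Q_n(0) = 0, where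
θ_n is λ_n + κ in the first case and λ_n in the second. In the code modes count from zero, so
`loopMode` at n belongs to e_{n+1}.

The recursion for Φ_j is a chain of rank-one updates of an inverse, with denominators that are
nonzero by admissibility; hence I - Φ_N inverts I + Υ_k P_N (`exists_inverse_eq_sub_Phi`). It
follows that g(f) = Σ_{j ≤ N} c_j Q_j(L), where c solves the linear system Σ_j (e_i, Q_j) c_j =
(e_i, f), i ≤ N (`exists_feedback_eq`, `feedback_kernel`). So g(Q_n) = Q_n(L) for every n: the Q_n
are eigenfunctions of the closed loop, with decay rates νθ_n - α. The bounds on μ make all these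
rates at least ρ > 0 (`le_rate_of_lt`).

Only N of the Q_n differ from the sine basis, so norms of expansions in Q_n are controlled by
Bessel's inequality and a finite-rank correction (`exists_loopCoeff_bound`, `innerL2_tsum_le`). In
H¹ the same is done with cosines, and the compatibility condition removes the boundary terms
(`innerL2_cosMode_sub`).

Uniqueness: testing the weak form with p(t) e_m(x) gives scalar equations forced through the
boundary value. Green's formula (`loopMode_boundary`) rewrites the forcing, the inverse of the
matrix (e_i, Q_j) decouples the first N equations, and the others follow by subtraction; a weak
solution must then be Σ a_n exp(-(νθ_n - α)t) Q_n (`IsWeakSolution.ae_eq_loopSeries`). Existence: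
this series satisfies the weak form term by term (`weak_form_loopSolution`). The estimates are read
off from the series. -/

/-! ### The backstepping transform of a sine. -/

/-- A Beta integral with half-integer parameter, in factorials. Splitting off one factor x² - y²
lowers m and raises n, hence the induction over m for all n. -/
theorem integral_sq_sub_sq_pow_mul (x : ℝ) (m n : ℕ) :
    ∫ y in (0 : ℝ)..x, (x ^ 2 - y ^ 2) ^ m * y ^ (2 * n) =
      x ^ (2 * (m + n) + 1) *
        ((m ! * 4 ^ m * (2 * n)! * (m + n)! : ℝ) / (n ! * (2 * (m + n) + 1)!)) := by
  induction m generalizing n with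
  | zero =>
    have : ((2 * n + 1)! : ℝ) = (2 * n + 1) * (2 * n)! := by
      rw [Nat.factorial_succ]; push_cast; ring
    simp only [pow_zero, one_mul, integral_pow, Nat.factorial_zero, zero_add, this]
    have h1 : (n ! : ℝ) ≠ 0 := by positivity
    have h2 : ((2 * n)! : ℝ) ≠ 0 := by positivity
    field_simp
    push_cast
    simp
  | succ m ih =>
    have h : ∀ y : ℝ, (x ^ 2 - y ^ 2) ^ (m + 1) * y ^ (2 * n) =
        x ^ 2 * ((x ^ 2 - y ^ 2) ^ m * y ^ (2 * n))
          - (x ^ 2 - y ^ 2) ^ m * y ^ (2 * (n + 1)) := fun y => by ring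
    simp_rw [h]
    rw [intervalIntegral.integral_sub (by apply Continuous.intervalIntegrable; fun_prop)
      (by apply Continuous.intervalIntegrable; fun_prop), intervalIntegral.integral_const_mul,
      ih, ih]
    have e1 : ((2 * (m + 1 + n) + 1)! : ℝ)
        = (2 * (m + n) + 3) * (2 * (m + n) + 2) * (2 * (m + n) + 1)! := by
      rw [show 2 * (m + 1 + n) + 1 = 2 * (m + n) + 1 + 1 + 1 by ring, Nat.factorial_succ,
        Nat.factorial_succ]; push_cast; ring
    have e2 : ((m + 1 + n)! : ℝ) = (m + n + 1) * (m + n)! := by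
      rw [show m + 1 + n = m + n + 1 by ring, Nat.factorial_succ]; push_cast; ring
    have e3 : ((2 * (n + 1))! : ℝ) = (2 * n + 2) * (2 * n + 1) * (2 * n)! := by
      rw [show 2 * (n + 1) = 2 * n + 1 + 1 by ring, Nat.factorial_succ,
        Nat.factorial_succ]; push_cast; ring
    have e4 : ((m + 1)! : ℝ) = (m + 1) * m ! := by
      rw [Nat.factorial_succ]; push_cast; ring
    have e5 : ((n + 1)! : ℝ) = (n + 1) * n ! := by
      rw [Nat.factorial_succ]; push_cast; ring
    rw [show m + (n + 1) = m + 1 + n by ring, e1, e2, e3, e4, e5]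
    have h1 : (n ! : ℝ) ≠ 0 := by positivity
    have h2 : ((2 * (m + n) + 1)! : ℝ) ≠ 0 := by positivity
    have h3 : (m + n + 1 : ℝ) ≠ 0 := by positivity
    have h4 : (2 * (m + n) + 3 : ℝ) ≠ 0 := by positivity
    field_simp
    ring

/-- The `(m, n)` term of the double power series of `k(x, y) sin(w y)`. -/
theorem hasSum_kernel_mul_sin (ν μ w x y : ℝ) :
    HasSum (fun p : ℕ × ℕ =>
      (-(μ / ν / 2) * ((-(μ / ν / 4)) ^ p.1 / ((p.1 ! : ℝ) * ((p.1 + 1)! : ℝ))) *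
        ((-1) ^ p.2 * w ^ (2 * p.2 + 1) / (2 * p.2 + 1)!)) *
        ((x ^ 2 - y ^ 2) ^ p.1 * y ^ (2 * (p.2 + 1)))) (kernel ν μ x y * sin (w * y)) := by
  have hs := Real.hasSum_sin (w * y)
  have hk : Summable fun m : ℕ => (-(μ / (4 * ν))) ^ m * (x ^ 2 - y ^ 2) ^ m /
      ((m ! : ℝ) * ((m + 1) ! : ℝ)) := by
    refine Summable.of_norm_bounded (g := fun m : ℕ =>
      (|μ / (4 * ν) * (x ^ 2 - y ^ 2)|) ^ m / m !) (Real.summable_pow_div_factorial _) ?_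
    intro m
    rw [← mul_pow, norm_div, norm_pow, neg_mul, norm_neg, Real.norm_eq_abs]
    refine div_le_div_of_nonneg_left (by positivity) (by positivity) ?_
    rw [Real.norm_of_nonneg (by positivity)]
    have : (1 : ℝ) ≤ (m + 1)! := by exact_mod_cast Nat.succ_le_of_lt (Nat.factorial_pos _)
    have h0 : (0 : ℝ) ≤ (m ! : ℝ) := by positivity
    nlinarith
  have hks := hk.hasSum.mul_left (-(μ * y / (2 * ν)))
  have hn : Summable fun m : ℕ => ‖-(μ * y / (2 * ν)) * ((-(μ / (4 * ν))) ^ m *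
      (x ^ 2 - y ^ 2) ^ m / ((m ! : ℝ) * ((m + 1) ! : ℝ)))‖ := hks.summable.norm
  have hp := summable_mul_of_summable_norm hn hs.summable.norm
  have := hks.mul hs hp
  refine this.congr_fun ?_
  intro p
  have a1 : μ * y / (2 * ν) = μ / ν / 2 * y := by ring
  have a2 : μ / (4 * ν) = μ / ν / 4 := by ring
  rw [a1, a2]
  ring

/-- The backstepping transform maps sines to sines. -/
theorem volterra_kernel_sin (ν μ w r : ℝ) (hr : r ≠ 0) (h : r ^ 2 = w ^ 2 + μ / ν) (x : ℝ) :
    ∫ y in (0 : ℝ)..x, kernel ν μ x y * sin (w * y) = w / r * sin (r * x) - sin (w * x) := by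
  set κ := μ / ν with hκ
  have h1 : HasSum (fun p : ℕ × ℕ => ∫ y in (0 : ℝ)..x,
      (-(κ / 2) * ((-(κ / 4)) ^ p.1 / ((p.1 ! : ℝ) * ((p.1 + 1)! : ℝ))) *
        ((-1) ^ p.2 * w ^ (2 * p.2 + 1) / (2 * p.2 + 1)!)) *
        ((x ^ 2 - y ^ 2) ^ p.1 * y ^ (2 * (p.2 + 1))))
      (∫ y in (0 : ℝ)..x, kernel ν μ x y * sin (w * y)) := by
    -- The majorant replaces x² - y² by x² and y by |x|. Written as (√2|x|)² - |x|², it is the same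
    -- double series at the point (√2|x|, |x|), so its summability is already known.
    refine intervalIntegral.hasSum_integral_of_dominated_convergence (fun p _ =>
      ‖(-(κ / 2) * ((-(κ / 4)) ^ p.1 / ((p.1 ! : ℝ) * ((p.1 + 1)! : ℝ))) *
        ((-1) ^ p.2 * w ^ (2 * p.2 + 1) / (2 * p.2 + 1)!)) *
        (((√2 * |x|) ^ 2 - |x| ^ 2) ^ p.1 * |x| ^ (2 * (p.2 + 1)))‖) ?_ ?_ ?_ ?_ ?_
    · intro p
      exact Continuous.aestronglyMeasurable (by fun_prop)
    · intro p
      refine Filter.Eventually.of_forall fun y hy => ?_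
      have hyx : |y| ≤ |x| := by
        have := uIoc_subset_uIcc hy
        have h2 := abs_sub_left_of_mem_uIcc this
        simpa using h2
      have hyx2 : y ^ 2 ≤ x ^ 2 := sq_le_sq.2 hyx
      have e1 : (√2 * |x|) ^ 2 - |x| ^ 2 = x ^ 2 := by
        rw [mul_pow, Real.sq_sqrt (by norm_num), sq_abs]; ring
      rw [e1, norm_mul, norm_mul _ ((x ^ 2) ^ p.1 * _), norm_mul ((x ^ 2 - y ^ 2) ^ p.1),
        norm_mul ((x ^ 2) ^ p.1), norm_pow _ p.1, norm_pow _ p.1,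
        norm_pow y, norm_pow |x|]
      simp only [Real.norm_eq_abs _, abs_abs]
      have e2 : |x ^ 2 - y ^ 2| ≤ |x ^ 2| := by
        rw [abs_of_nonneg (by linarith), abs_of_nonneg (by positivity)]
        nlinarith [sq_nonneg y]
      gcongr
    · exact Filter.Eventually.of_forall fun y _ =>
        (hasSum_kernel_mul_sin ν μ w (√2 * |x|) |x|).summable.norm
    · exact intervalIntegrable_const
    · exact Filter.Eventually.of_forall fun y _ => hasSum_kernel_mul_sin ν μ w x y
  simp_rw [intervalIntegral.integral_const_mul, integral_sq_sub_sq_pow_mul] at h1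
  -- The double series is summed along the antidiagonals m + n = k, each of which carries the single
  -- power x^(2k+3).
  have h2 := ((Finset.HasAntidiagonal.sigmaAntidiagonalEquivProd (A := ℕ)).hasSum_iff.2 h1).sigma
    (fun k => hasSum_fintype _)
  have h3 := ((Real.hasSum_sin (r * x)).mul_left (w / r)).sub (Real.hasSum_sin (w * x))
  -- The linear terms of the two sines cancel, so both series start with x³.
  rw [← hasSum_nat_add_iff' 1] at h3
  simp only [Finset.range_one, Finset.sum_singleton] at h3
  have e0 : w / r * ((-1) ^ 0 * (r * x) ^ (2 * 0 + 1) / ((2 * 0 + 1)! : ℝ)) -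
      (-1) ^ 0 * (w * x) ^ (2 * 0 + 1) / ((2 * 0 + 1)! : ℝ) = 0 := by
    simp; field_simp; ring
  rw [e0, sub_zero] at h3
  refine h2.unique (h3.congr_fun fun k => ?_)
  have e3 : ∀ p ∈ Finset.HasAntidiagonal.antidiagonal k,
      (-(κ / 2) * ((-(κ / 4)) ^ p.1 / ((p.1 ! : ℝ) * ((p.1 + 1)! : ℝ))) *
        ((-1) ^ p.2 * w ^ (2 * p.2 + 1) / (2 * p.2 + 1)!)) *
      (x ^ (2 * (p.1 + (p.2 + 1)) + 1) *
        ((p.1 ! * 4 ^ p.1 * (2 * (p.2 + 1))! * (p.1 + (p.2 + 1))! : ℝ) / ((p.2 + 1)! *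
          (2 * (p.1 + (p.2 + 1)) + 1)!))) =
      (-1) ^ (k + 1) * w * x ^ (2 * k + 3) / (2 * k + 3)! *
        ((k + 1).choose (p.1 + 1) • (κ ^ (p.1 + 1) * (w ^ 2) ^ p.2)) := by
    rintro ⟨m, n⟩ hmn
    obtain rfl : m + n = k := by simpa using hmn
    simp only
    have f1 : ((m + n + 1).choose (m + 1) : ℝ) = (m + n + 1)! / ((m + 1)! * n !) := by
      rw [eq_div_iff (by positivity), ← mul_assoc]
      have := Nat.add_choose_mul_factorial_mul_factorial (m + 1) n
      rw [show m + 1 + n = m + n + 1 by ring,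
        Nat.choose_symm_of_eq_add (show m + n + 1 = n + (m + 1) by ring)] at this
      exact_mod_cast this
    have f2 : ((2 * (n + 1))! : ℝ) = 2 * (n + 1) * (2 * n + 1)! := by
      rw [show 2 * (n + 1) = 2 * n + 1 + 1 by ring, Nat.factorial_succ]; push_cast; ring
    have f3 : ((n + 1)! : ℝ) = (n + 1) * n ! := by
      rw [Nat.factorial_succ]; push_cast; ring
    rw [nsmul_eq_mul, f1, f2, f3, show m + (n + 1) = m + n + 1 by ring,
      show 2 * (m + n + 1) + 1 = 2 * (m + n) + 3 by ring, neg_eq_neg_one_mul (κ / 4), mul_pow]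
    have g1 : (n ! : ℝ) ≠ 0 := by positivity
    have g2 : ((2 * (m + n) + 3)! : ℝ) ≠ 0 := by positivity
    have g3 : (m ! : ℝ) ≠ 0 := by positivity
    have g4 : ((m + 1)! : ℝ) ≠ 0 := by positivity
    have g5 : ((2 * n + 1)! : ℝ) ≠ 0 := by positivity
    have g6 : (n + 1 : ℝ) ≠ 0 := by positivity
    rw [div_pow]
    field_simp
    ring
  -- The antidiagonal holds the binomial terms of (κ + w²)^(k+1) with at least one factor κ, so it
  -- sums to (r²)^(k+1) - (w²)^(k+1).
  have hb := Commute.add_pow' (Commute.all κ (w ^ 2)) (k + 1)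
  rw [Finset.Nat.antidiagonal_succ, Finset.sum_cons, Finset.sum_map] at hb
  simp only [Nat.choose_zero_right, pow_zero, one_mul, one_smul, Function.Embedding.prodMap,
    Function.Embedding.coeFn_mk, Prod.map, Nat.succ_eq_add_one, Function.Embedding.refl_apply] at hb
  rw [Finset.univ_eq_attach]
  refine (Finset.sum_attach (Finset.HasAntidiagonal.antidiagonal k) (fun p =>
      (-(κ / 2) * ((-(κ / 4)) ^ p.1 / ((p.1 ! : ℝ) * ((p.1 + 1)! : ℝ))) *
        ((-1) ^ p.2 * w ^ (2 * p.2 + 1) / (2 * p.2 + 1)!)) *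
      (x ^ (2 * (p.1 + (p.2 + 1)) + 1) *
        ((p.1 ! * 4 ^ p.1 * (2 * (p.2 + 1))! * (p.1 + (p.2 + 1))! : ℝ) / ((p.2 + 1)! *
          (2 * (p.1 + (p.2 + 1)) + 1)!))))).trans ?_
  rw [Finset.sum_congr rfl e3, ← Finset.mul_sum, eq_sub_of_add_eq' hb.symm, add_comm κ, ← h]
  have g7 : (r * x) ^ (2 * (k + 1) + 1) = r * (r ^ 2) ^ (k + 1) * x ^ (2 * k + 3) := by ring
  have g8 : (w * x) ^ (2 * (k + 1) + 1) = w * (w ^ 2) ^ (k + 1) * x ^ (2 * k + 3) := by ring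
  rw [g7, g8, show 2 * (k + 1) + 1 = 2 * k + 3 by ring]
  field_simp

/-! ### Sine and cosine modes: orthonormality and completeness. -/

/-- The square root of the `j`-th Dirichlet eigenvalue. -/
noncomputable def freq (L : ℝ) (j : ℕ) : ℝ := j * π / L

/-- The `j`-th normalized Neumann eigenfunction. -/
noncomputable def cosMode (L : ℝ) (j : ℕ) (x : ℝ) : ℝ := √(2 / L) * cos (freq L j * x)

theorem e_eq (L : ℝ) (j : ℕ) (x : ℝ) : e L j x = √(2 / L) * sin (freq L j * x) := by
  unfold e freq; congr 2; ring

theorem continuous_e (L : ℝ) (j : ℕ) : Continuous (e L j) := by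
  unfold e; fun_prop

theorem continuous_cosMode (L : ℝ) (j : ℕ) : Continuous (cosMode L j) := by
  unfold cosMode; fun_prop

theorem abs_e_le (L : ℝ) (j : ℕ) (x : ℝ) : |e L j x| ≤ √(2 / L) := by
  rw [e_eq, abs_mul, abs_of_nonneg (Real.sqrt_nonneg _)]
  exact mul_le_of_le_one_right (Real.sqrt_nonneg _) (abs_sin_le_one _)

theorem abs_cosMode_le (L : ℝ) (j : ℕ) (x : ℝ) : |cosMode L j x| ≤ √(2 / L) := by
  rw [cosMode, abs_mul, abs_of_nonneg (Real.sqrt_nonneg _)]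
  exact mul_le_of_le_one_right (Real.sqrt_nonneg _) (abs_cos_le_one _)

theorem e_zero_right (L : ℝ) (j : ℕ) : e L j 0 = 0 := by simp [e]

theorem e_length {L : ℝ} (hL : 0 < L) (j : ℕ) : e L j L = 0 := by
  unfold e
  rw [mul_div_assoc, div_self hL.ne', mul_one, sin_nat_mul_pi, mul_zero]

theorem integral_cos_int {L : ℝ} (hL : 0 < L) (k : ℤ) :
    ∫ x in (0 : ℝ)..L, cos (k * π / L * x) = if k = 0 then L else 0 := by
  split_ifs with h
  · simp [h]
  · have h1 : (k : ℝ) * π / L ≠ 0 := by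
      have : (k : ℝ) ≠ 0 := by exact_mod_cast h
      positivity
    rw [intervalIntegral.integral_comp_mul_left (fun x => cos x) h1, integral_cos,
      div_mul_cancel₀ _ hL.ne', sin_int_mul_pi]
    simp

theorem innerL2_e {L : ℝ} (hL : 0 < L) (i j : ℕ) :
    innerL2 L (e L (i + 1)) (e L (j + 1)) = if i = j then 1 else 0 := by
  have h : ∀ x, e L (i + 1) x * e L (j + 1) x = (1 / L) * (cos (((i : ℤ) - j : ℤ) * π / L * x)
      - cos (((i : ℤ) + j + 2 : ℤ) * π / L * x)) := by
    intro x
    rw [e_eq, e_eq, mul_mul_mul_comm, Real.mul_self_sqrt (by positivity)]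
    have h1 : (((i : ℤ) - j : ℤ) : ℝ) * π / L * x = freq L (i + 1) * x - freq L (j + 1) * x := by
      unfold freq; push_cast; ring
    have h2 : (((i : ℤ) + j + 2 : ℤ) : ℝ) * π / L * x
        = freq L (i + 1) * x + freq L (j + 1) * x := by
      unfold freq; push_cast; ring
    rw [h1, h2, cos_sub, cos_add]; ring
  unfold innerL2
  simp_rw [h]
  rw [intervalIntegral.integral_const_mul, intervalIntegral.integral_sub
    (by apply Continuous.intervalIntegrable; fun_prop)
    (by apply Continuous.intervalIntegrable; fun_prop), integral_cos_int hL, integral_cos_int hL,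
    if_neg (show ¬ ((i : ℤ) + j + 2 = 0) by omega)]
  simp only [sub_eq_zero, Nat.cast_inj]
  split_ifs
  · field_simp; ring
  · simp

theorem innerL2_cosMode {L : ℝ} (hL : 0 < L) (i j : ℕ) :
    innerL2 L (cosMode L (i + 1)) (cosMode L (j + 1)) = if i = j then 1 else 0 := by
  have h : ∀ x, cosMode L (i + 1) x * cosMode L (j + 1) x =
      (1 / L) * (cos (((i : ℤ) - j : ℤ) * π / L * x)
      + cos (((i : ℤ) + j + 2 : ℤ) * π / L * x)) := by
    intro x
    rw [cosMode, cosMode, mul_mul_mul_comm, Real.mul_self_sqrt (by positivity)]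
    have h1 : (((i : ℤ) - j : ℤ) : ℝ) * π / L * x = freq L (i + 1) * x - freq L (j + 1) * x := by
      unfold freq; push_cast; ring
    have h2 : (((i : ℤ) + j + 2 : ℤ) : ℝ) * π / L * x
        = freq L (i + 1) * x + freq L (j + 1) * x := by
      unfold freq; push_cast; ring
    rw [h1, h2, cos_sub, cos_add]; ring
  unfold innerL2
  simp_rw [h]
  rw [intervalIntegral.integral_const_mul, intervalIntegral.integral_add
    (by apply Continuous.intervalIntegrable; fun_prop)
    (by apply Continuous.intervalIntegrable; fun_prop), integral_cos_int hL, integral_cos_int hL,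
    if_neg (show ¬ ((i : ℤ) + j + 2 = 0) by omega)]
  simp only [sub_eq_zero, Nat.cast_inj]
  split_ifs
  · field_simp; ring
  · simp

theorem intervalIntegral_eq_vol {L : ℝ} (hL : 0 < L) (f : ℝ → ℝ) :
    ∫ x in (0 : ℝ)..L, f x = ∫ x, f x ∂vol L := by
  rw [intervalIntegral.integral_of_le hL.le, integral_Ioc_eq_integral_Ioo, vol]

theorem ae_vol_mem (L : ℝ) : ∀ᵐ x ∂vol L, x ∈ Ioo 0 L :=
  ae_restrict_mem measurableSet_Ioo

instance (L : ℝ) : IsFiniteMeasure (vol L) := by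
  unfold vol; infer_instance

theorem integrable_vol_iff {L : ℝ} (hL : 0 < L) (f : ℝ → ℝ) :
    Integrable f (vol L) ↔ IntervalIntegrable f volume 0 L := by
  rw [intervalIntegrable_iff_integrableOn_Ioo_of_le hL.le, vol, IntegrableOn]

theorem memLp_vol_of_continuous {L : ℝ} {f : ℝ → ℝ} (hf : Continuous f) (p : ℝ≥0∞) :
    MemLp f p (vol L) := by
  obtain ⟨C, hC⟩ := (isCompact_Icc (a := (0 : ℝ)) (b := L)).exists_bound_of_continuousOn
    hf.continuousOn
  refine MemLp.of_bound hf.aestronglyMeasurable C ?_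
  filter_upwards [ae_vol_mem L] with x hx
  exact hC x (Ioo_subset_Icc_self hx)

/-- A function that is continuous up to the boundary of `(0, L)` times an integrable one. -/
theorem integrable_mul_continuous {L : ℝ} {f g : ℝ → ℝ} (hf : Integrable f (vol L))
    (hg : Continuous g) : Integrable (fun x => f x * g x) (vol L) := by
  obtain ⟨C, hC⟩ := (isCompact_Icc (a := (0 : ℝ)) (b := L)).exists_bound_of_continuousOn
    hg.continuousOn
  refine hf.mul_bdd (c := C) hg.aestronglyMeasurable ?_
  filter_upwards [ae_vol_mem L] with x hx
  exact hC x (Ioo_subset_Icc_self hx)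

/-- The fundamental lemma of the calculus of variations on `(0, L)`. -/
theorem ae_eq_zero_of_integral_mul_test {L : ℝ} (hL : 0 < L) {f : ℝ → ℝ}
    (hf : Integrable f (vol L)) (h : ∀ η : ℝ → ℝ, ContDiff ℝ ∞ η → HasCompactSupport η →
      tsupport η ⊆ Ioo 0 L → ∫ x in (0 : ℝ)..L, f x * η x = 0) : f =ᵐ[vol L] 0 := by
  have h0 : ∀ᵐ x, x ∈ Ioo 0 L → f x = 0 := by
    refine isOpen_Ioo.ae_eq_zero_of_integral_contDiff_smul_eq_zero ?_ ?_
    · exact (show IntegrableOn _ _ _ from hf).locallyIntegrableOn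
    · intro g hg hgc hgs
      have := h g hg hgc hgs
      rw [intervalIntegral_eq_vol hL, vol, ← integral_indicator measurableSet_Ioo] at this
      rw [← this]
      congr 1; ext x
      by_cases hx : x ∈ Ioo 0 L
      · rw [indicator_of_mem hx, smul_eq_mul, mul_comm]
      · rw [indicator_of_notMem hx,
          image_eq_zero_of_notMem_tsupport (fun h => hx (hgs h)), zero_smul]
  rw [vol, Filter.EventuallyEq, ae_restrict_iff' measurableSet_Ioo]
  exact h0

/-- By 2 cos a sin(ka) = sin((k+1)a) + sin((k-1)a), multiplication by a cosine stays inside the span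
of the sines, which f annihilates. With k = 1 this yields sin(πx/L) times every polynomial in
cos(πx/L). -/
theorem integral_mul_cos_pow_mul_sin_eq_zero {L : ℝ} (hL : 0 < L) {f : ℝ → ℝ}
    (hf : Integrable f (vol L)) (h : ∀ j, innerL2 L f (e L (j + 1)) = 0) (n : ℕ) (k : ℕ) :
    ∫ x, f x * (cos (π / L * x) ^ n * sin (k * (π / L * x))) ∂vol L = 0 := by
  induction n generalizing k with
  | zero =>
    rcases k with _ | k
    · simp
    · have h1 := h k
      have h2 : √(2 / L) ≠ 0 := by positivity
      unfold innerL2 e at h1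
      rw [intervalIntegral_eq_vol hL] at h1
      rw [← mul_right_inj' h2, mul_zero, ← h1, ← integral_const_mul]
      congr 1; ext x
      rw [show ((k + 1 : ℕ) : ℝ) * (π / L * x) = ((k + 1 : ℕ) : ℝ) * π * x / L by ring]
      ring
  | succ n ih =>
    rcases k with _ | k
    · simp
    · have h1 : ∀ x, f x * (cos (π / L * x) ^ (n + 1) * sin (((k + 1 : ℕ) : ℝ) * (π / L * x))) =
          (1 / 2) * (f x * (cos (π / L * x) ^ n * sin (((k + 2 : ℕ) : ℝ) * (π / L * x)))) +
          (1 / 2) * (f x * (cos (π / L * x) ^ n * sin ((k : ℝ) * (π / L * x)))) := by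
        intro x
        have a1 : ((k + 2 : ℕ) : ℝ) * (π / L * x)
            = ((k + 1 : ℕ) : ℝ) * (π / L * x) + π / L * x := by push_cast; ring
        have a2 : (k : ℝ) * (π / L * x)
            = ((k + 1 : ℕ) : ℝ) * (π / L * x) - π / L * x := by push_cast; ring
        rw [a1, a2, sin_add, sin_sub]; ring
      simp_rw [h1]
      rw [integral_add, integral_const_mul, integral_const_mul, ih, ih]
      · simp
      · exact (integrable_mul_continuous hf (by fun_prop)).const_mul _
      · exact (integrable_mul_continuous hf (by fun_prop)).const_mul _

/-- The sines are complete in `L¹(0, L)`. -/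
theorem ae_eq_zero_of_innerL2_e {L : ℝ} (hL : 0 < L) {f : ℝ → ℝ}
    (hf : Integrable f (vol L)) (h : ∀ j, innerL2 L f (e L (j + 1)) = 0) :
    f =ᵐ[vol L] 0 := by
  have hpoly : ∀ p : Polynomial ℝ,
      ∫ x, f x * sin (π / L * x) * p.eval (cos (π / L * x)) ∂vol L = 0 := by
    intro p
    simp_rw [Polynomial.eval_eq_sum_range, Finset.mul_sum]
    rw [integral_finsetSum]
    · refine Finset.sum_eq_zero fun n _ => ?_
      have := integral_mul_cos_pow_mul_sin_eq_zero hL hf h n 1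
      rw [← mul_zero (p.coeff n), ← this, ← integral_const_mul]
      congr 1; ext x; push_cast; rw [one_mul]; ring
    · intro n _
      have := (integrable_mul_continuous hf (g := fun x => sin (π / L * x) *
        (p.coeff n * cos (π / L * x) ^ n)) (by fun_prop))
      exact this.congr (Filter.Eventually.of_forall fun x => by simp only; ring)
  have hfs : Integrable (fun x => f x * sin (π / L * x)) (vol L) :=
    integrable_mul_continuous hf (by fun_prop)
  have hcont : ∀ g : ℝ → ℝ, Continuous g →
      ∫ x, f x * sin (π / L * x) * g x ∂vol L = 0 := by
    intro g hg
    by_contra hne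
    set A := ∫ x, |f x * sin (π / L * x)| ∂vol L with hA
    have hA0 : 0 ≤ A := integral_nonneg fun x => abs_nonneg _
    obtain ⟨I, hIdef⟩ : ∃ I, I = |∫ x, f x * sin (π / L * x) * g x ∂vol L| := ⟨_, rfl⟩
    have hI : 0 < I := hIdef ▸ abs_pos.2 hne
    -- Since x ↦ cos(πx/L) is injective on [0, L], every continuous g is a continuous function of
    -- it, and Weierstrass applies. The denominator A + 1 avoids division by zero when A = 0.
    obtain ⟨p, hp⟩ := exists_polynomial_near_of_continuousOn (-1) 1
      (fun y => g (L / π * arccos y)) (by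
        apply Continuous.continuousOn
        exact hg.comp (continuous_const.mul Real.continuous_arccos)) (I / (A + 1)) (by positivity)
    have h1 : ∫ x, f x * sin (π / L * x) * g x ∂vol L =
        ∫ x, f x * sin (π / L * x) * (g x - p.eval (cos (π / L * x))) ∂vol L := by
      simp_rw [mul_sub]
      rw [integral_sub, hpoly, sub_zero]
      · exact integrable_mul_continuous hfs hg
      · exact integrable_mul_continuous hfs (by fun_prop)
    have h2 : I ≤ ∫ x, |f x * sin (π / L * x)| * (I / (A + 1)) ∂vol L := by
      refine hIdef.trans_le ?_
      rw [h1]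
      refine (abs_integral_le_integral_abs).trans ?_
      refine integral_mono_ae ?_ ?_ ?_
      · exact (integrable_mul_continuous hfs (by fun_prop)).abs
      · exact hfs.abs.mul_const _
      · filter_upwards [ae_vol_mem L] with x hx
        rw [abs_mul]
        refine mul_le_mul_of_nonneg_left ?_ (abs_nonneg _)
        have h3 := hp (cos (π / L * x)) ⟨neg_one_le_cos _, cos_le_one _⟩
        have h4 : L / π * arccos (cos (π / L * x)) = x := by
          rw [Real.arccos_cos]
          · field_simp
          · have := hx.1; positivity
          · have := hx.2
            rw [div_mul_eq_mul_div, div_le_iff₀ hL]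
            nlinarith [Real.pi_pos]
        simp only [h4] at h3
        rw [abs_sub_comm]
        exact h3.le
    rw [integral_mul_const, ← hA] at h2
    have h3 : A * (I / (A + 1)) < I := by
      rw [← mul_div_assoc, div_lt_iff₀ (by positivity)]; nlinarith
    linarith
  have h0 := ae_eq_zero_of_integral_mul_test hL hfs fun g hg _ _ => by
    rw [intervalIntegral_eq_vol hL]; exact hcont g hg.continuous
  filter_upwards [h0, ae_vol_mem L] with x hx hx0
  have : sin (π / L * x) ≠ 0 := by
    refine (Real.sin_pos_of_pos_of_lt_pi ?_ ?_).ne'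
    · have := hx0.1; positivity
    · rw [div_mul_eq_mul_div, div_lt_iff₀ hL]
      nlinarith [Real.pi_pos, hx0.2]
  simpa [this] using hx

/-! ### The inner product of L², Bessel's inequality and Parseval's identity. -/

theorem innerL2_comm (L : ℝ) (f g : ℝ → ℝ) : innerL2 L f g = innerL2 L g f := by
  simp [innerL2, mul_comm]

theorem innerL2_eq_inner {L : ℝ} (hL : 0 < L) {f g : ℝ → ℝ} (hf : MemLp f 2 (vol L))
    (hg : MemLp g 2 (vol L)) : innerL2 L f g = inner ℝ (hf.toLp f) (hg.toLp g) := by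
  rw [L2.inner_def, innerL2, intervalIntegral_eq_vol hL]
  refine integral_congr_ae ?_
  filter_upwards [hf.coeFn_toLp, hg.coeFn_toLp] with x h1 h2
  rw [h1, h2]; simp [mul_comm]

theorem integrable_mul_of_memLp {L : ℝ} {f g : ℝ → ℝ} (hf : MemLp f 2 (vol L))
    (hg : MemLp g 2 (vol L)) : Integrable (fun x => f x * g x) (vol L) :=
  hf.integrable_mul hg

theorem innerL2_add_left {L : ℝ} (hL : 0 < L) {f g h : ℝ → ℝ} (hf : MemLp f 2 (vol L))
    (hg : MemLp g 2 (vol L)) (hh : MemLp h 2 (vol L)) :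
    innerL2 L (fun x => f x + g x) h = innerL2 L f h + innerL2 L g h := by
  simp only [innerL2, intervalIntegral_eq_vol hL, add_mul]
  exact integral_add (integrable_mul_of_memLp hf hh) (integrable_mul_of_memLp hg hh)

theorem innerL2_sub_left {L : ℝ} (hL : 0 < L) {f g h : ℝ → ℝ} (hf : MemLp f 2 (vol L))
    (hg : MemLp g 2 (vol L)) (hh : MemLp h 2 (vol L)) :
    innerL2 L (fun x => f x - g x) h = innerL2 L f h - innerL2 L g h := by
  simp only [innerL2, intervalIntegral_eq_vol hL, sub_mul]
  exact integral_sub (integrable_mul_of_memLp hf hh) (integrable_mul_of_memLp hg hh)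

theorem innerL2_const_mul_left (L : ℝ) (c : ℝ) (f h : ℝ → ℝ) :
    innerL2 L (fun x => c * f x) h = c * innerL2 L f h := by
  simp only [innerL2, mul_assoc, intervalIntegral.integral_const_mul]

theorem innerL2_sum_left {ι : Type*} (s : Finset ι) {L : ℝ} (hL : 0 < L) {f : ι → ℝ → ℝ}
    {h : ℝ → ℝ} (hf : ∀ i ∈ s, MemLp (f i) 2 (vol L)) (hh : MemLp h 2 (vol L)) :
    innerL2 L (fun x => ∑ i ∈ s, f i x) h = ∑ i ∈ s, innerL2 L (f i) h := by
  simp only [innerL2, intervalIntegral_eq_vol hL, Finset.sum_mul]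
  exact integral_finsetSum _ fun i hi => integrable_mul_of_memLp (hf i hi) hh

theorem innerL2_self_nonneg {L : ℝ} (hL : 0 < L) (f : ℝ → ℝ) : 0 ≤ innerL2 L f f :=
  intervalIntegral.integral_nonneg hL.le fun _ _ => mul_self_nonneg _

theorem abs_innerL2_le {L : ℝ} (hL : 0 < L) {f g : ℝ → ℝ} (hf : MemLp f 2 (vol L))
    (hg : MemLp g 2 (vol L)) :
    |innerL2 L f g| ≤ √(innerL2 L f f) * √(innerL2 L g g) := by
  rw [innerL2_eq_inner hL hf hg, innerL2_eq_inner hL hf hf, innerL2_eq_inner hL hg hg,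
    real_inner_self_eq_norm_sq, real_inner_self_eq_norm_sq, Real.sqrt_sq (norm_nonneg _),
    Real.sqrt_sq (norm_nonneg _)]
  exact abs_real_inner_le_norm _ _

theorem orthonormal_toLp {L : ℝ} (hL : 0 < L) {b : ℕ → ℝ → ℝ} (hb : ∀ n, MemLp (b n) 2 (vol L))
    (h : ∀ i j, innerL2 L (b i) (b j) = if i = j then 1 else 0) :
    Orthonormal ℝ fun n => (hb n).toLp (b n) := by
  rw [orthonormal_iff_ite]
  intro i j
  rw [← innerL2_eq_inner hL, h]

/-- Bessel's inequality. -/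
theorem bessel {L : ℝ} (hL : 0 < L) {b : ℕ → ℝ → ℝ} (hb : ∀ n, MemLp (b n) 2 (vol L))
    (h : ∀ i j, innerL2 L (b i) (b j) = if i = j then 1 else 0) {f : ℝ → ℝ}
    (hf : MemLp f 2 (vol L)) :
    Summable (fun n => innerL2 L (b n) f ^ 2) ∧
      ∑' n, innerL2 L (b n) f ^ 2 ≤ innerL2 L f f := by
  have ho := orthonormal_toLp hL hb h
  have h1 := ho.inner_products_summable (x := hf.toLp f)
  have h2 := ho.tsum_inner_products_le (x := hf.toLp f)
  simp only [← innerL2_eq_inner hL, Real.norm_eq_abs, sq_abs] at h1 h2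
  rw [← real_inner_self_eq_norm_sq, ← innerL2_eq_inner hL hf hf] at h2
  exact ⟨h1, h2⟩

/-- Parseval's identity for the sine basis. -/
theorem hasSum_innerL2_e_mul {L : ℝ} (hL : 0 < L) {f g : ℝ → ℝ} (hf : MemLp f 2 (vol L))
    (hg : MemLp g 2 (vol L)) :
    HasSum (fun n => innerL2 L (e L (n + 1)) f * innerL2 L (e L (n + 1)) g) (innerL2 L f g) := by
  have hb : ∀ n, MemLp (e L (n + 1)) 2 (vol L) := fun n =>
    memLp_vol_of_continuous (continuous_e L _) _
  have ho := orthonormal_toLp hL hb (innerL2_e hL)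
  have hsp : (Submodule.span ℝ (Set.range fun n => (hb n).toLp (e L (n + 1))))ᗮ = ⊥ := by
    rw [Submodule.eq_bot_iff]
    intro v hv
    rw [Lp.eq_zero_iff_ae_eq_zero]
    have hvm := Lp.memLp v
    refine ae_eq_zero_of_innerL2_e hL (hvm.integrable (by norm_num)) fun n => ?_
    rw [innerL2_eq_inner hL hvm (hb n), Lp.toLp_coeFn]
    exact Submodule.inner_left_of_mem_orthogonal
      (Submodule.subset_span (mem_range_self n)) hv
  have hs := (HilbertBasis.mkOfOrthogonalEqBot ho hsp).hasSum_inner_mul_inner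
    (hf.toLp f) (hg.toLp g)
  rw [HilbertBasis.coe_mkOfOrthogonalEqBot, ← innerL2_eq_inner hL hf hg] at hs
  refine hs.congr_fun fun n => ?_
  rw [← innerL2_eq_inner hL hf (hb n), ← innerL2_eq_inner hL (hb n) hg, innerL2_comm L f]

theorem integrable_of_memLp_two {L : ℝ} {f : ℝ → ℝ} (hf : MemLp f 2 (vol L)) :
    Integrable f (vol L) := hf.integrable (by norm_num)

theorem intervalIntegral_congr_vol {L : ℝ} (hL : 0 < L) {f g : ℝ → ℝ} (h : f =ᵐ[vol L] g) :
    ∫ x in (0 : ℝ)..L, f x = ∫ x in (0 : ℝ)..L, g x := by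
  rw [intervalIntegral_eq_vol hL, intervalIntegral_eq_vol hL]
  exact integral_congr_ae h

theorem innerL2_congr {L : ℝ} (hL : 0 < L) {f g f' g' : ℝ → ℝ} (hf : f =ᵐ[vol L] f')
    (hg : g =ᵐ[vol L] g') : innerL2 L f g = innerL2 L f' g' := by
  refine intervalIntegral_congr_vol hL ?_
  filter_upwards [hf, hg] with x h1 h2
  rw [h1, h2]

/-! ### Weak derivatives, Sobolev norms and boundary traces. -/

theorem HasWeakDeriv.ae_eq {L : ℝ} (hL : 0 < L) {i : ℕ} {f g g' : ℝ → ℝ}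
    (hg : Integrable g (vol L)) (hg' : Integrable g' (vol L)) (h : HasWeakDeriv L i f g)
    (h' : HasWeakDeriv L i f g') : g =ᵐ[vol L] g' := by
  have := ae_eq_zero_of_integral_mul_test hL (hg.sub hg') fun η h1 h2 h3 => by
    have e1 := (h η h1 h2 h3).symm.trans (h' η h1 h2 h3)
    have e2 : (-1 : ℝ) ^ i ≠ 0 := by simp
    simp only [Pi.sub_apply, sub_mul]
    rw [intervalIntegral.integral_sub, sub_eq_zero]
    · exact mul_left_cancel₀ e2 e1
    · exact (integrable_vol_iff hL _).1 (integrable_mul_continuous hg h1.continuous)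
    · exact (integrable_vol_iff hL _).1 (integrable_mul_continuous hg' h1.continuous)
  filter_upwards [this] with x hx
  simpa [sub_eq_zero] using hx

theorem weakDeriv_ae_eq {L : ℝ} (hL : 0 < L) {i : ℕ} {f g : ℝ → ℝ}
    (hg : MemLp g 2 (vol L)) (h : HasWeakDeriv L i f g) : weakDeriv L i f =ᵐ[vol L] g := by
  have hex : ∃ g : ℝ → ℝ, MemLp g 2 (vol L) ∧ HasWeakDeriv L i f g := ⟨g, hg, h⟩
  rw [weakDeriv, dif_pos hex]
  exact hex.choose_spec.2.ae_eq hL (integrable_of_memLp_two hex.choose_spec.1)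
    (integrable_of_memLp_two hg) h

theorem hasWeakDeriv_zero (L : ℝ) (f : ℝ → ℝ) : HasWeakDeriv L 0 f f := by
  intro η _ _ _
  simp [iteratedDeriv_zero]

theorem MemSobolev.memLp_weakDeriv {m : ℕ} {L : ℝ} {f : ℝ → ℝ}
    (h : MemSobolev m L f) {i : ℕ} (hi : i ≤ m) : MemLp (weakDeriv L i f) 2 (vol L) := by
  rw [weakDeriv, dif_pos (h.2 i hi)]
  exact (h.2 i hi).choose_spec.1

theorem MemSobolev.hasWeakDeriv {m : ℕ} {L : ℝ} {f : ℝ → ℝ}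
    (h : MemSobolev m L f) {i : ℕ} (hi : i ≤ m) : HasWeakDeriv L i f (weakDeriv L i f) := by
  rw [weakDeriv, dif_pos (h.2 i hi)]
  exact (h.2 i hi).choose_spec.2

theorem hasWeakDeriv_congr {L : ℝ} (hL : 0 < L) {f f' : ℝ → ℝ} (h : f =ᵐ[vol L] f') :
    (fun i => HasWeakDeriv L i f) = fun i => HasWeakDeriv L i f' := by
  funext i g
  refine forall_congr fun η => forall_congr fun _ => forall_congr fun _ => forall_congr fun _ => ?_
  rw [intervalIntegral_congr_vol hL (f := fun x => f x * iteratedDeriv i η x)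
    (g := fun x => f' x * iteratedDeriv i η x)]
  filter_upwards [h] with x hx
  rw [hx]

/-- Equality holds everywhere, not just almost everywhere: both functions satisfy the same defining
predicate, so the same representative is chosen. -/
theorem weakDeriv_congr {L : ℝ} (hL : 0 < L) {f f' : ℝ → ℝ} (h : f =ᵐ[vol L] f') (i : ℕ) :
    weakDeriv L i f = weakDeriv L i f' := by
  have : HasWeakDeriv L i f = HasWeakDeriv L i f' := congrFun (hasWeakDeriv_congr hL h) i
  unfold weakDeriv
  revert this
  generalize HasWeakDeriv L i f = P
  rintro rfl
  rfl

theorem memSobolev_congr {L : ℝ} (hL : 0 < L) {f f' : ℝ → ℝ} (h : f =ᵐ[vol L] f') (m : ℕ) :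
    MemSobolev m L f ↔ MemSobolev m L f' := by
  have : ∀ i, HasWeakDeriv L i f = HasWeakDeriv L i f' :=
    fun i => congrFun (hasWeakDeriv_congr hL h) i
  unfold MemSobolev
  rw [memLp_congr_ae h]
  simp only [this]

theorem sobolevNorm_congr {L : ℝ} (hL : 0 < L) {f f' : ℝ → ℝ} (h : f =ᵐ[vol L] f') (m : ℕ) :
    sobolevNorm m L f = sobolevNorm m L f' := by
  unfold sobolevNorm
  simp only [weakDeriv_congr hL h]
  by_cases hm : MemSobolev m L f
  · rw [if_pos hm, if_pos ((memSobolev_congr hL h m).1 hm)]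
  · rw [if_neg hm, if_neg (mt (memSobolev_congr hL h m).2 hm)]

theorem eLpNorm_two_sq {L : ℝ} (hL : 0 < L) {f : ℝ → ℝ} (hf : MemLp f 2 (vol L)) :
    eLpNorm f 2 (vol L) ^ 2 = ENNReal.ofReal (innerL2 L f f) := by
  rw [innerL2_eq_inner hL hf hf, real_inner_self_eq_norm_sq, ENNReal.ofReal_pow (norm_nonneg _),
    Lp.norm_toLp, ENNReal.ofReal_toReal hf.2.ne]

theorem sobolevNorm_sq {L : ℝ} (hL : 0 < L) {m : ℕ} {f : ℝ → ℝ} {g : ℕ → ℝ → ℝ}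
    (hf : MemLp f 2 (vol L)) (hg : ∀ i ≤ m, MemLp (g i) 2 (vol L))
    (h : ∀ i ≤ m, HasWeakDeriv L i f (g i)) :
    sobolevNorm m L f ^ 2 =
      ENNReal.ofReal (∑ i ∈ Finset.range (m + 1), innerL2 L (g i) (g i)) := by
  rw [sobolevNorm, if_pos ⟨hf, fun i hi => ⟨g i, hg i hi, h i hi⟩⟩, ← ENNReal.rpow_natCast,
    ← ENNReal.rpow_mul, ENNReal.ofReal_sum_of_nonneg fun i _ => innerL2_self_nonneg hL _]
  norm_num
  refine Finset.sum_congr rfl fun i hi => ?_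
  have hi' : i ≤ m := Nat.lt_succ_iff.1 (Finset.mem_range.1 hi)
  rw [← eLpNorm_two_sq hL (hg i hi'), eLpNorm_congr_ae (weakDeriv_ae_eq hL (hg i hi') (h i hi'))]

theorem hasWeakDeriv_one {L : ℝ} {f f' : ℝ → ℝ} (h : ∀ x, HasDerivAt f (f' x) x)
    (hf' : Continuous f') : HasWeakDeriv L 1 f f' := by
  intro η h1 _ h3
  have hη : ∀ x, HasDerivAt η (deriv η x) x := fun x =>
    ((h1.differentiable (by simp)) x).hasDerivAt
  have hz : ∀ x, x ∉ Ioo 0 L → η x = 0 := fun x hx =>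
    image_eq_zero_of_notMem_tsupport fun h => hx (h3 h)
  have hc : Continuous (deriv η) := h1.continuous_deriv (by simp)
  rw [iteratedDeriv_one, intervalIntegral.integral_mul_deriv_eq_deriv_mul (fun x _ => h x)
    (fun x _ => hη x) (hf'.intervalIntegrable _ _) (hc.intervalIntegrable _ _),
    hz L (by simp), hz 0 (by simp)]
  simp

theorem HasWeakDeriv.succ {L : ℝ} {f f' f'' : ℝ → ℝ}
    (h : HasWeakDeriv L 1 f f') (h' : HasWeakDeriv L 1 f' f'') : HasWeakDeriv L 2 f f'' := by
  intro η h1 h2 h3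
  have hd : ContDiff ℝ ∞ (deriv η) := h1.deriv'
  have e1 := h (deriv η) hd h2.deriv ((tsupport_deriv_subset).trans h3)
  have e2 := h' η h1 h2 h3
  rw [iteratedDeriv_one] at e1 e2
  rw [iteratedDeriv_succ, iteratedDeriv_one, e1, e2]
  ring

/-- Integration by parts against a merely integrable g: its primitive is absolutely continuous. -/
theorem integral_primitive_mul_deriv {L : ℝ} (hL : 0 < L) {g η : ℝ → ℝ}
    (hg : Integrable g (vol L)) (hη : ContDiff ℝ ∞ η) :
    ∫ x in (0 : ℝ)..L, (∫ y in (0 : ℝ)..x, g y) * deriv η x =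
      (∫ y in (0 : ℝ)..L, g y) * η L - ∫ x in (0 : ℝ)..L, g x * η x := by
  have hgi := (integrable_vol_iff hL _).1 hg
  have h1 := hgi.absolutelyContinuousOnInterval_intervalIntegral (c := 0) (by simp)
  have h2 := (hη.of_le (m := 1) (by simp)).contDiffOn (s := uIcc 0 L)
    |>.absolutelyContinuousOnInterval
  rw [h1.integral_mul_deriv_eq_deriv_mul h2]
  simp only [intervalIntegral.integral_same, zero_mul, sub_zero]
  congr 1
  refine intervalIntegral.integral_congr_ae ?_
  filter_upwards [hgi.ae_hasDerivAt_integral] with x hx hx'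
  rw [(hx (uIoc_subset_uIcc hx') 0 (by simp)).deriv]

/-- The lemma of du Bois-Reymond. -/
theorem ae_eq_const_of_integral_mul_deriv {L : ℝ} (hL : 0 < L) {h : ℝ → ℝ}
    (hh : Integrable h (vol L)) (h0 : ∀ η : ℝ → ℝ, ContDiff ℝ ∞ η → HasCompactSupport η →
      tsupport η ⊆ Ioo 0 L → ∫ x in (0 : ℝ)..L, h x * deriv η x = 0) :
    ∃ C : ℝ, h =ᵐ[vol L] fun _ => C := by
  let b : ContDiffBump (L / 2) := ⟨L / 8, L / 4, by positivity, by linarith⟩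
  set p : ℝ → ℝ := b.normed volume with hp
  have hpc : ContDiff ℝ ∞ p := b.contDiff_normed
  have hps : tsupport p ⊆ Ioo 0 L := by
    rw [hp, b.tsupport_normed_eq, Real.closedBall_eq_Icc]
    intro x hx
    simp only [b, mem_Icc, mem_Ioo] at hx ⊢
    constructor <;> linarith [hx.1, hx.2]
  have hz : ∀ η : ℝ → ℝ, tsupport η ⊆ Ioo 0 L → ∀ x, x ∉ Ioo 0 L → η x = 0 := fun η h3 x hx =>
    image_eq_zero_of_notMem_tsupport fun h => hx (h3 h)
  have hp1 : ∫ x in (0 : ℝ)..L, p x = 1 := by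
    rw [intervalIntegral.integral_eq_integral_of_support_subset, b.integral_normed]
    exact (subset_tsupport _).trans (hps.trans Ioo_subset_Ioc_self)
  refine ⟨∫ x in (0 : ℝ)..L, h x * p x, ?_⟩
  set C := ∫ x in (0 : ℝ)..L, h x * p x with hC
  have := ae_eq_zero_of_integral_mul_test hL (hh.sub (integrable_const C))
    fun η h1 h2 h3 => ?_
  · filter_upwards [this] with x hx
    simpa [sub_eq_zero] using hx
  set I := ∫ x in (0 : ℝ)..L, η x with hI
  -- Subtracting I times a bump of mass one gives q mean zero, so that its primitive P vanishes near
  -- both ends and is an admissible test function.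
  set q : ℝ → ℝ := fun x => η x - I * p x with hq
  have hqc : ContDiff ℝ ∞ q := h1.sub (contDiff_const.mul hpc)
  have hqi : ∀ a b, IntervalIntegrable q volume a b := fun a b =>
    hqc.continuous.intervalIntegrable _ _
  set P : ℝ → ℝ := fun x => ∫ y in (0 : ℝ)..x, q y with hP
  have hPd : ∀ x, HasDerivAt P (q x) x := fun x =>
    intervalIntegral.integral_hasDerivAt_right (hqi _ _)
      (hqc.continuous.stronglyMeasurableAtFilter _ _) hqc.continuous.continuousAt
  have hPd' : deriv P = q := funext fun x => (hPd x).deriv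
  have hPc : ContDiff ℝ ∞ P := by
    rw [contDiff_infty_iff_deriv, hPd']
    exact ⟨fun x => (hPd x).differentiableAt, hqc⟩
  have hK : IsCompact (tsupport η ∪ tsupport p) := h2.isCompact.union b.hasCompactSupport_normed
  obtain ⟨δ, hδ, hδK⟩ := hK.exists_forall_le' (f := fun x => min x (L - x))
    (by fun_prop) (a := 0) (fun x hx => by
      have := union_subset h3 hps hx
      exact lt_min this.1 (by linarith [this.2]))
  have hq0 : ∀ x, x < δ ∨ L - δ < x → q x = 0 := by
    intro x hx
    have hxK : x ∉ tsupport η ∪ tsupport p := fun hxK => by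
      have := hδK x hxK
      rcases hx with hx | hx
      · linarith [this.trans (min_le_left _ _)]
      · linarith [this.trans (min_le_right _ _)]
    simp only [mem_union, not_or] at hxK
    simp only [hq, image_eq_zero_of_notMem_tsupport hxK.1, image_eq_zero_of_notMem_tsupport hxK.2,
      mul_zero, sub_zero]
  have hqL : ∫ x in (0 : ℝ)..L, q x = 0 := by
    simp only [hq]
    rw [intervalIntegral.integral_sub (h1.continuous.intervalIntegrable _ _)
      ((hpc.continuous.const_mul _).intervalIntegrable _ _), intervalIntegral.integral_const_mul,
      hp1, ← hI]
    ring
  have hP0 : Function.support P ⊆ Icc δ (L - δ) := by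
    intro x hx
    by_contra hxn
    refine hx ?_
    rw [mem_Icc, not_and_or, not_le, not_le] at hxn
    rcases hxn with hxn | hxn
    · refine intervalIntegral.integral_zero_ae (Filter.Eventually.of_forall fun y hy => ?_)
      refine hq0 y (Or.inl ?_)
      have := (mem_uIoc.1 hy)
      rcases this with h | h
      · exact h.2.trans_lt hxn
      · exact h.2.trans_lt hδ
    · have e1 : P x = (∫ x in (0 : ℝ)..L, q x) - ∫ y in x..L, q y :=
        eq_sub_of_add_eq (intervalIntegral.integral_add_adjacent_intervals (hqi _ _) (hqi _ _))
      rw [e1, hqL, zero_sub, neg_eq_zero]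
      refine intervalIntegral.integral_zero_ae (Filter.Eventually.of_forall fun y hy => ?_)
      refine hq0 y (Or.inr ?_)
      have := (mem_uIoc.1 hy)
      rcases this with h | h
      · exact hxn.trans h.1
      · linarith [h.1]
  have hPt : tsupport P ⊆ Icc δ (L - δ) := closure_minimal hP0 isClosed_Icc
  have h4 := h0 P hPc (isCompact_Icc.of_isClosed_subset (isClosed_tsupport _) hPt)
    (hPt.trans fun x hx => ⟨hδ.trans_le hx.1, by linarith [hx.2]⟩)
  have hi1 := (integrable_vol_iff hL _).1 (integrable_mul_continuous hh h1.continuous)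
  have hi2 := (integrable_vol_iff hL _).1 (integrable_mul_continuous hh hpc.continuous)
  rw [hPd'] at h4
  simp only [hq, mul_sub, mul_left_comm _ I] at h4
  rw [intervalIntegral.integral_sub hi1 (hi2.const_mul _), intervalIntegral.integral_const_mul,
    ← hC] at h4
  simp only [Pi.sub_apply, sub_mul]
  rw [intervalIntegral.integral_sub hi1 ((h1.continuous.const_mul _).intervalIntegrable _ _),
    intervalIntegral.integral_const_mul, ← hI]
  linarith

/-- Integration by parts for a function with a weak derivative and boundary traces. -/
theorem integral_weakDeriv_mul {L : ℝ} (hL : 0 < L) {f g η : ℝ → ℝ} {a b : ℝ}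
    (hg : Integrable g (vol L)) (h : HasWeakDeriv L 1 f g) (ht : HasTraces L f a b)
    (hη : ContDiff ℝ ∞ η) :
    ∫ x in (0 : ℝ)..L, g x * η x =
      b * η L - a * η 0 - ∫ x in (0 : ℝ)..L, f x * deriv η x := by
  obtain ⟨F, hFc, hFf, hF0, hFL⟩ := ht
  set G : ℝ → ℝ := fun x => ∫ y in (0 : ℝ)..x, g y with hG
  have hgi := (integrable_vol_iff hL _).1 hg
  have hGc : ContinuousOn G (Icc 0 L) := by
    have := (hgi.absolutelyContinuousOnInterval_intervalIntegral (c := 0) (by simp)).continuousOn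
    rwa [uIcc_of_le hL.le] at this
  have hFi : Integrable F (vol L) :=
    (hFc.integrableOn_Icc).mono_set Ioo_subset_Icc_self
  have hGi : Integrable G (vol L) :=
    (hGc.integrableOn_Icc).mono_set Ioo_subset_Icc_self
  have key : ∀ η : ℝ → ℝ, ContDiff ℝ ∞ η → Continuous (deriv η) := fun η h =>
    h.continuous_deriv (by simp)
  have hcF : ∀ η : ℝ → ℝ, ∫ x in (0 : ℝ)..L, f x * deriv η x =
      ∫ x in (0 : ℝ)..L, F x * deriv η x := fun η => by
    refine intervalIntegral_congr_vol hL ?_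
    filter_upwards [hFf] with x hx
    rw [hx]
  have hii : ∀ η : ℝ → ℝ, ContDiff ℝ ∞ η →
      IntervalIntegrable (fun x => F x * deriv η x) volume 0 L := fun η h =>
    (integrable_vol_iff hL _).1 (integrable_mul_continuous hFi (key η h))
  have hii' : ∀ η : ℝ → ℝ, ContDiff ℝ ∞ η →
      IntervalIntegrable (fun x => G x * deriv η x) volume 0 L := fun η h =>
    (integrable_vol_iff hL _).1 (integrable_mul_continuous hGi (key η h))
  -- F minus a primitive of g has zero weak derivative, hence is constant almost everywhere. By
  -- continuity this holds on all of [0, L], which identifies the traces.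
  obtain ⟨C, hC⟩ := ae_eq_const_of_integral_mul_deriv hL (hFi.sub hGi) fun η h1 h2 h3 => by
    have e1 := h η h1 h2 h3
    rw [iteratedDeriv_one, hcF] at e1
    have e2 := integral_primitive_mul_deriv hL hg h1
    rw [image_eq_zero_of_notMem_tsupport (fun h => absurd (h3 h) (by simp))] at e2
    simp only [Pi.sub_apply, sub_mul]
    rw [intervalIntegral.integral_sub (hii η h1) (hii' η h1), e1, e2]
    ring
  have hFG : EqOn F (fun x => G x + C) (Icc 0 L) := by
    refine Measure.eqOn_Icc_of_ae_eq volume hL.ne ?_ hFc (hGc.add continuousOn_const)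
    rw [← restrict_Ioo_eq_restrict_Icc]
    filter_upwards [hC] with x hx
    simp only [Pi.sub_apply] at hx
    linarith
  have ha : a = C := by
    rw [← hF0, hFG ⟨le_rfl, hL.le⟩]; simp [hG]
  have hb : b = G L + C := by rw [← hFL, hFG ⟨hL.le, le_rfl⟩]
  have e3 : ∫ x in (0 : ℝ)..L, F x * deriv η x =
      ∫ x in (0 : ℝ)..L, (G x * deriv η x + C * deriv η x) := by
    refine intervalIntegral.integral_congr fun x hx => ?_
    rw [uIcc_of_le hL.le] at hx
    simp only [hFG hx]; ring
  rw [hcF, e3, intervalIntegral.integral_add (hii' η hη)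
    (((key η hη).const_mul _).intervalIntegrable _ _), intervalIntegral.integral_const_mul,
    integral_primitive_mul_deriv hL hg hη, intervalIntegral.integral_deriv_eq_sub
      (fun x _ => (hη.differentiable (by simp)) x) ((key η hη).intervalIntegrable _ _), hb, ha]
  ring

/-! ### The operators Φ_j as inverses, and the feedback in matrix form. -/

/-- A rank-one update of an inverse (Sherman and Morrison). -/
theorem exists_inverse_rank_one_update {V : Type*} [AddCommGroup V] [Module ℝ V]
    (R K : V →ₗ[ℝ] V) (l : V →ₗ[ℝ] ℝ) (b : V) (h1 : ∀ f, R f + K (R f) = f)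
    (h2 : ∀ f, R (f + K f) = f) (hb : l (R b) ≠ -1) :
    ∃ R' : V →ₗ[ℝ] V, (∀ f, R' f + (K (R' f) + l (R' f) • b) = f) ∧
      (∀ f, R' (f + (K f + l f • b)) = f) ∧
      ∀ f, R' f = R f - (l (R f) / (1 + l (R b))) • R b := by
  have hb' : 1 + l (R b) ≠ 0 := fun h => hb (by linarith)
  have hR : ∀ f, (R - ((1 + l (R b))⁻¹ • (l ∘ₗ R)).smulRight (R b)) f =
      R f - (l (R f) / (1 + l (R b))) • R b := fun f => by
    simp [div_eq_inv_mul]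
  refine ⟨R - ((1 + l (R b))⁻¹ • (l ∘ₗ R)).smulRight (R b), fun f => ?_, fun f => ?_, hR⟩
  · rw [hR]
    set c := l (R f) / (1 + l (R b)) with hc
    -- This says that c is the value of l at the updated vector, so the rank-one term cancels the
    -- defect c b.
    have e1 : l (R f) - c * l (R b) = c := by rw [hc]; field_simp; ring
    have e2 : R f - c • R b + (K (R f - c • R b) + l (R f - c • R b) • b) =
        (R f + K (R f)) - c • (R b + K (R b)) + (l (R f) - c * l (R b)) • b := by
      simp only [map_sub, map_smul, smul_eq_mul, smul_add]; abel
    rw [e2, h1, h1, e1]; abel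
  · rw [hR, show f + (K f + l f • b) = (f + K f) + l f • b by abel, map_add, h2, map_smul, map_add,
      map_smul, smul_eq_mul, show (l f + l f * l (R b)) / (1 + l (R b)) = l f by field_simp]
    abel

/-- `f ↦ (f, e_j)` on continuous functions. -/
noncomputable def modeFunctional (L : ℝ) (j : ℕ) : C(ℝ, ℝ) →ₗ[ℝ] ℝ where
  toFun f := innerL2 L f (e L j)
  map_add' f g := by
    have := (continuous_e L j)
    simp only [innerL2, ContinuousMap.add_apply, add_mul]
    exact intervalIntegral.integral_add (by apply Continuous.intervalIntegrable; fun_prop)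
      (by apply Continuous.intervalIntegrable; fun_prop)
  map_smul' c f := by
    simp only [innerL2, ContinuousMap.smul_apply, smul_eq_mul, mul_assoc,
      intervalIntegral.integral_const_mul, RingHom.id_apply]

theorem modeFunctional_apply (L : ℝ) (j : ℕ) (f : C(ℝ, ℝ)) :
    modeFunctional L j f = innerL2 L f (e L j) := rfl

theorem continuous_proj (L : ℝ) (n : ℕ) (f : ℝ → ℝ) : Continuous (proj L n f) := by
  have := continuous_e L
  unfold proj
  fun_prop

theorem volterra_proj {L : ℝ} {k : ℝ → ℝ → ℝ}
    (hk : ∀ x j, IntervalIntegrable (fun y => k x y * e L j y) volume 0 x) (n : ℕ) (f : ℝ → ℝ)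
    (x : ℝ) : volterra k (proj L n f) x =
      ∑ j ∈ Finset.Icc 1 n, innerL2 L f (e L j) * volterra k (e L j) x := by
  unfold volterra proj
  simp_rw [Finset.mul_sum, mul_left_comm (k x _), innerL2_comm L (e L _)]
  rw [intervalIntegral.integral_finsetSum fun j _ => (hk x j).const_mul _]
  simp_rw [intervalIntegral.integral_const_mul]

/-- `Υ_k P_n` on continuous functions, where `b j = Υ_k e_j`. -/
noncomputable def volterraProj (L : ℝ) (b : ℕ → C(ℝ, ℝ)) (n : ℕ) : C(ℝ, ℝ) →ₗ[ℝ] C(ℝ, ℝ) :=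
  ∑ j ∈ Finset.Icc 1 n, (modeFunctional L j).smulRight (b j)

theorem volterra_proj_eq {L : ℝ} {k : ℝ → ℝ → ℝ}
    (hk : ∀ x j, IntervalIntegrable (fun y => k x y * e L j y) volume 0 x)
    {b : ℕ → C(ℝ, ℝ)} (hb : ∀ j, volterra k (e L j) = b j) (n : ℕ) (f : C(ℝ, ℝ)) :
    volterra k (proj L n f) = volterraProj L b n f := by
  ext x
  rw [volterra_proj hk]
  simp [volterraProj, hb, modeFunctional_apply]

/-- Under admissibility `I - Φ_n` inverts `I + Υ_k P_n`. -/
theorem exists_inverse_eq_sub_Phi {L : ℝ} {k : ℝ → ℝ → ℝ}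
    (hk : ∀ x j, IntervalIntegrable (fun y => k x y * e L j y) volume 0 x)
    {b : ℕ → C(ℝ, ℝ)} (hb : ∀ j, volterra k (e L j) = b j) (n : ℕ) (hn : IsAdmissible L k n) :
    ∃ R : C(ℝ, ℝ) →ₗ[ℝ] C(ℝ, ℝ), (∀ f, R f + volterraProj L b n (R f) = f) ∧
      (∀ f, R (f + volterraProj L b n f) = f) ∧
      ∀ f : C(ℝ, ℝ), Phi L k n f = (f - R f : C(ℝ, ℝ)) := by
  induction n with
  | zero => exact ⟨LinearMap.id, by simp [volterraProj], by simp [volterraProj], by simp [Phi]⟩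
  | succ n ih =>
    obtain ⟨R, h1, h2, h3⟩ := ih fun j hj1 hj2 => hn j hj1 (by omega)
    have hsub : ∀ f : C(ℝ, ℝ), (f : ℝ → ℝ) - Phi L k n f = R f := fun f => by
      rw [h3]; ext x; simp
    have hadm := hn (n + 1) (by omega) le_rfl
    rw [Nat.add_sub_cancel, hb, hsub] at hadm
    obtain ⟨R', g1, g2, g3⟩ := exists_inverse_rank_one_update R (volterraProj L b n)
      (modeFunctional L (n + 1)) (b (n + 1)) h1 h2 hadm
    have hK : ∀ f, volterraProj L b (n + 1) f =
        volterraProj L b n f + modeFunctional L (n + 1) f • b (n + 1) := fun f => by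
      simp [volterraProj, Finset.sum_Icc_succ_top]
    refine ⟨R', fun f => by rw [hK, g1], fun f => by rw [hK, g2], fun f => ?_⟩
    -- As R inverts I + K_n with K_n = Υ_k P_n, one has R K_n f = f - R f. This turns the recursion
    -- that defines Φ_{n+1} into the rank-one update formula.
    have e1 : R (volterraProj L b (n + 1) f) =
        f - R f + modeFunctional L (n + 1) f • R (b (n + 1)) := by
      have h4 := h2 f
      rw [map_add] at h4
      rw [hK, map_add, map_smul, eq_sub_of_add_eq' h4]
    have hadm' : 1 + modeFunctional L (n + 1) (R (b (n + 1))) ≠ 0 := fun h => hadm (by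
      change modeFunctional L (n + 1) (R (b (n + 1))) = -1; linarith)
    simp only [Phi]
    rw [volterra_proj_eq hk hb, hb, hsub, hsub, e1, g3]
    change _ - ((modeFunctional L (n + 1) _) / (1 + modeFunctional L (n + 1) _)) • _ = _
    rw [← ContinuousMap.coe_smul, ← ContinuousMap.coe_sub, DFunLike.coe_fn_eq, map_add, map_sub,
      map_smul, smul_eq_mul]
    set l := modeFunctional L (n + 1)
    set B := R (b (n + 1))
    have e2 : (l f - l (R f) + l f * l B) / (1 + l B) = l f - l (R f) / (1 + l B) := by
      field_simp; ring
    rw [e2, sub_smul]; abel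

theorem innerL2_e_proj {L : ℝ} (hL : 0 < L) {N : ℕ} (f : ℝ → ℝ) {i : ℕ} (hi : i < N) :
    innerL2 L (proj L N f) (e L (i + 1)) = innerL2 L (e L (i + 1)) f := by
  have he : ∀ j, MemLp (e L j) 2 (vol L) := fun j => memLp_vol_of_continuous (continuous_e L j) _
  unfold proj
  rw [innerL2_sum_left _ hL (fun j _ => (he j).const_mul _) (he _)]
  simp_rw [innerL2_const_mul_left]
  rw [Finset.sum_eq_single (i + 1)]
  · rw [innerL2_e hL, if_pos rfl, mul_one]
  · intro j hj hji
    obtain ⟨j, rfl⟩ := Nat.exists_eq_add_of_le' (Finset.mem_Icc.1 hj).1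
    rw [innerL2_e hL, if_neg (by omega), mul_zero]
  · intro h
    exact absurd (Finset.mem_Icc.2 ⟨by omega, by omega⟩) h

theorem sum_Icc_eq_sum_fin (N : ℕ) (g : ℕ → ℝ) :
    ∑ j ∈ Finset.Icc 1 N, g j = ∑ j : Fin N, g (j + 1) := by
  rw [Fin.sum_univ_eq_sum_range (fun j => g (j + 1)), Finset.range_eq_Ico,
    Finset.sum_Ico_add' (fun j => g j) 0 N 1]
  rfl

/-- The feedback in terms of the inverse of the matrix of `I + Υ_k P_N` on the first `N` modes. -/
theorem exists_feedback_eq {L : ℝ} (hL : 0 < L) {k : ℝ → ℝ → ℝ}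
    (hk : ∀ x j, IntervalIntegrable (fun y => k x y * e L j y) volume 0 x)
    {b : ℕ → C(ℝ, ℝ)} (hb : ∀ j, volterra k (e L j) = b j) (N : ℕ) (hN : IsAdmissible L k N)
    {M : Matrix (Fin N) (Fin N) ℝ}
    (hM : ∀ i j : Fin N, M i j = innerL2 L (e L (i + 1)) (fun x => e L (j + 1) x + b (j + 1) x)) :
    IsUnit M ∧ ∀ f : ℝ → ℝ, feedback L k N f =
      ∑ j : Fin N, (M⁻¹).mulVec (fun i => innerL2 L (e L (i + 1)) f) j * b (j + 1) L := by
  obtain ⟨R, h1, -, h3⟩ := exists_inverse_eq_sub_Phi hk hb N hN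
  let P : (ℝ → ℝ) → C(ℝ, ℝ) := fun f => ⟨proj L N f, continuous_proj L N f⟩
  have he : ∀ j, MemLp (e L j) 2 (vol L) := fun j => memLp_vol_of_continuous (continuous_e L j) _
  have hbm : ∀ j, MemLp (b j) 2 (vol L) := fun j =>
    memLp_vol_of_continuous (b j).continuous _
  have hM' : ∀ i j : Fin N, M i j =
      (if i = j then 1 else 0) + modeFunctional L (i + 1) (b (j + 1)) := fun i j => by
    rw [hM, innerL2_comm, innerL2_add_left hL (he _) (hbm _) (he _), innerL2_e hL]
    simp only [modeFunctional_apply, Fin.val_inj, eq_comm (a := i)]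
  have hMv : ∀ f : ℝ → ℝ, M.mulVec (fun j => modeFunctional L (j + 1) (R (P f))) =
      fun i : Fin N => innerL2 L (e L (i + 1)) f := fun f => by
    ext i
    -- The first N modes of (I + Υ_k P_N) R P_N f = P_N f form a closed linear system with matrix M.
    have h4 := congrArg (modeFunctional L (i + 1)) (h1 (P f))
    rw [map_add, volterraProj, LinearMap.sum_apply, map_sum] at h4
    simp only [LinearMap.smulRight_apply, map_smul, smul_eq_mul] at h4
    rw [sum_Icc_eq_sum_fin N (fun j => modeFunctional L j (R (P f)) *
      modeFunctional L (i + 1) (b j))] at h4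
    have h5 : modeFunctional L (i + 1) (P f) = innerL2 L (e L (i + 1)) f :=
      innerL2_e_proj hL f i.2
    rw [h5] at h4
    rw [← h4]
    simp only [Matrix.mulVec, dotProduct, hM', add_mul, ite_mul, one_mul, zero_mul,
      Finset.sum_add_distrib, Finset.sum_ite_eq, Finset.mem_univ, if_true]
    simp only [mul_comm]
  have hunit : IsUnit M := by
    -- Every right-hand side v occurs, namely for f = Σ v_j e_{j+1}. So invertibility of M comes
    -- from the operator inverse, without a determinant.
    rw [← Matrix.mulVec_surjective_iff_isUnit]
    intro v
    refine ⟨_, (hMv fun x => ∑ j : Fin N, v j * e L (j + 1) x).trans ?_⟩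
    ext i
    rw [innerL2_comm, innerL2_sum_left _ hL (fun j _ => (he _).const_mul _) (he _)]
    simp_rw [innerL2_const_mul_left, innerL2_e hL, Fin.val_inj]
    simp
  refine ⟨hunit, fun f => ?_⟩
  have hW : (M⁻¹).mulVec (fun i => innerL2 L (e L (i + 1)) f) =
      fun j : Fin N => modeFunctional L (j + 1) (R (P f)) := by
    rw [← hMv, Matrix.mulVec_mulVec,
      Matrix.nonsing_inv_mul _ ((Matrix.isUnit_iff_isUnit_det _).1 hunit),
      Matrix.one_mulVec]
  -- Since Φ_N = I - R and P_N is idempotent, (I - P_N Φ_N) P_N = P_N R P_N.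
  have hRP : ∀ y, proj L N f y - proj L N (Phi L k N (proj L N f)) y = proj L N (R (P f)) y := by
    intro y
    have h6 := h3 (P f)
    change Phi L k N (proj L N f) = _ at h6
    rw [h6]
    have h7 : proj L N f y = proj L N (P f) y := by
      have : ∀ g : ℝ → ℝ, proj L N g y =
          ∑ j : Fin N, innerL2 L (e L (j + 1)) g * e L (j + 1) y := fun g =>
        sum_Icc_eq_sum_fin N (fun j => innerL2 L (e L j) g * e L j y)
      rw [this f, this (P f)]
      refine Finset.sum_congr rfl fun j _ => ?_
      rw [innerL2_comm L _ (P f)]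
      change _ = innerL2 L (proj L N f) _ * _
      rw [innerL2_e_proj hL f j.2]
    rw [h7]
    unfold proj
    rw [← Finset.sum_sub_distrib]
    refine Finset.sum_congr rfl fun j _ => ?_
    rw [← sub_mul]
    congr 1
    have := map_sub (modeFunctional L j) (P f) (P f - R (P f))
    simp only [modeFunctional_apply, sub_sub_cancel] at this
    rw [innerL2_comm L (e L j), innerL2_comm L (e L j), innerL2_comm L (e L j), this]
  unfold feedback
  simp_rw [hRP, hW]
  have h8 := volterra_proj hk N (R (P f)) L
  rw [volterra] at h8
  rw [h8]
  simp_rw [hb]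
  exact sum_Icc_eq_sum_fin N (fun j => innerL2 L (R (P f)) (e L j) * b j L)

/-! ### Eigenfunctions of the closed loop. -/

theorem eigenvalue_eq (L : ℝ) (j : ℕ) : eigenvalue L j = freq L j ^ 2 := rfl

theorem freq_pos {L : ℝ} (hL : 0 < L) (n : ℕ) : 0 < freq L (n + 1) := by
  unfold freq; positivity

theorem eigenvalue_pos {L : ℝ} (hL : 0 < L) (n : ℕ) : 0 < eigenvalue L (n + 1) :=
  pow_pos (freq_pos hL n) 2

theorem sqrt_eigenvalue {L : ℝ} (hL : 0 < L) (n : ℕ) : √(eigenvalue L (n + 1)) = freq L (n + 1) :=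
  Real.sqrt_sq (freq_pos hL n).le

/-- The eigenvalues of the closed loop, `κ = μ / ν`: the first `N` are shifted by `κ`. -/
noncomputable def theta (L κ : ℝ) (N n : ℕ) : ℝ :=
  eigenvalue L (n + 1) + if n < N then κ else 0

/-- The eigenfunctions of the closed loop. -/
noncomputable def loopMode (L κ : ℝ) (N n : ℕ) (x : ℝ) : ℝ :=
  √(2 / L) * (freq L (n + 1) / √(theta L κ N n) * sin (√(theta L κ N n) * x))

/-- The derivatives of the eigenfunctions of the closed loop. -/
noncomputable def loopMode' (L κ : ℝ) (N n : ℕ) (x : ℝ) : ℝ :=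
  √(2 / L) * (freq L (n + 1) * cos (√(theta L κ N n) * x))

theorem theta_of_le {N n : ℕ} (L κ : ℝ) (h : N ≤ n) : theta L κ N n = eigenvalue L (n + 1) := by
  simp [theta, not_lt.2 h]

theorem theta_of_lt {N n : ℕ} (L κ : ℝ) (h : n < N) :
    theta L κ N n = eigenvalue L (n + 1) + κ := by
  simp [theta, h]

theorem eigenvalue_le_theta {κ : ℝ} (hκ : 0 < κ) (L : ℝ) (N n : ℕ) :
    eigenvalue L (n + 1) ≤ theta L κ N n := by
  unfold theta; split_ifs <;> linarith

theorem theta_le {κ : ℝ} (hκ : 0 < κ) (L : ℝ) (N n : ℕ) :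
    theta L κ N n ≤ eigenvalue L (n + 1) + κ := by
  unfold theta; split_ifs <;> linarith

theorem theta_pos {L κ : ℝ} (hL : 0 < L) (hκ : 0 < κ) (N n : ℕ) : 0 < theta L κ N n :=
  (eigenvalue_pos hL n).trans_le (eigenvalue_le_theta hκ L N n)

theorem freq_le_sqrt_theta {L κ : ℝ} (hL : 0 < L) (hκ : 0 < κ) (N n : ℕ) :
    freq L (n + 1) ≤ √(theta L κ N n) := by
  rw [← sqrt_eigenvalue hL]
  exact Real.sqrt_le_sqrt (eigenvalue_le_theta hκ L N n)

theorem hasDerivAt_loopMode {L κ : ℝ} (hL : 0 < L) (hκ : 0 < κ) (N n : ℕ)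
    (x : ℝ) :
    HasDerivAt (loopMode L κ N n) (loopMode' L κ N n x) x := by
  have h1 := Real.sqrt_pos.2 (theta_pos hL hκ N n)
  have h2 := ((((hasDerivAt_id x).const_mul (√(theta L κ N n))).sin).const_mul
    (freq L (n + 1) / √(theta L κ N n))).const_mul √(2 / L)
  refine h2.congr_deriv ?_
  unfold loopMode'
  simp only [id]
  field_simp

theorem hasDerivAt_loopMode' {L κ : ℝ} (hL : 0 < L) (hκ : 0 < κ) (N n : ℕ)
    (x : ℝ) :
    HasDerivAt (loopMode' L κ N n) (-(theta L κ N n * loopMode L κ N n x)) x := by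
  have h1 := Real.sqrt_pos.2 (theta_pos hL hκ N n)
  have h2 := ((((hasDerivAt_id x).const_mul (√(theta L κ N n))).cos).const_mul
    (freq L (n + 1))).const_mul √(2 / L)
  refine h2.congr_deriv ?_
  unfold loopMode
  simp only [id]
  nth_rewrite 3 [← Real.mul_self_sqrt (theta_pos hL hκ N n).le]
  field_simp

theorem abs_loopMode_le {L κ : ℝ} (hL : 0 < L) (hκ : 0 < κ) (N n : ℕ)
    (x : ℝ) : |loopMode L κ N n x| ≤ √(2 / L) := by
  have h1 := Real.sqrt_pos.2 (theta_pos hL hκ N n)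
  have h2 := freq_pos hL n
  rw [loopMode, abs_mul, abs_mul, abs_of_nonneg (Real.sqrt_nonneg _), abs_of_pos (by positivity)]
  have h3 : freq L (n + 1) / √(theta L κ N n) ≤ 1 :=
    (div_le_one h1).2 (freq_le_sqrt_theta hL hκ N n)
  refine mul_le_of_le_one_right (Real.sqrt_nonneg _) ?_
  exact mul_le_one₀ h3 (abs_nonneg _) (abs_sin_le_one _)

theorem abs_loopMode'_le {L : ℝ} (hL : 0 < L) (κ : ℝ) (N n : ℕ) (x : ℝ) :
    |loopMode' L κ N n x| ≤ √(2 / L) * freq L (n + 1) := by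
  have h2 := freq_pos hL n
  rw [loopMode', abs_mul, abs_mul, abs_of_nonneg (Real.sqrt_nonneg _), abs_of_pos h2]
  refine mul_le_mul_of_nonneg_left ?_ (Real.sqrt_nonneg _)
  exact mul_le_of_le_one_right h2.le (abs_cos_le_one _)

theorem loopMode_of_le {L : ℝ} (hL : 0 < L) (κ : ℝ) {N : ℕ} {n : ℕ} (h : N ≤ n) :
    loopMode L κ N n = e L (n + 1) := by
  ext x
  rw [e_eq, loopMode, theta_of_le L κ h, sqrt_eigenvalue hL, div_self (freq_pos hL n).ne', one_mul]

theorem volterra_e_eq {κ : ℝ} (hκ : 0 < κ) (L : ℝ) {ν μ : ℝ} (h : κ = μ / ν) (j : ℕ) (x : ℝ) :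
    volterra (kernel ν μ) (e L j) x = √(2 / L) *
      (freq L j / √(freq L j ^ 2 + κ) * sin (√(freq L j ^ 2 + κ) * x)) - e L j x := by
  have h1 := volterra_kernel_sin ν μ (freq L j) (√(freq L j ^ 2 + κ))
    (Real.sqrt_pos.2 (by positivity)).ne' (by rw [Real.sq_sqrt (by positivity), h]) x
  unfold volterra
  simp_rw [e_eq, mul_left_comm (kernel ν μ x _)]
  rw [intervalIntegral.integral_const_mul, h1]
  ring

theorem e_add_volterra_e {L κ : ℝ} (hκ : 0 < κ) {N : ℕ} {ν μ : ℝ} (h : κ = μ / ν) {n : ℕ}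
    (hn : n < N) (x : ℝ) :
    e L (n + 1) x + volterra (kernel ν μ) (e L (n + 1)) x = loopMode L κ N n x := by
  rw [volterra_e_eq hκ L h, loopMode, theta_of_lt L κ hn, eigenvalue_eq]; ring

theorem loopMode_zero (L κ : ℝ) (N n : ℕ) : loopMode L κ N n 0 = 0 := by simp [loopMode]

theorem continuous_loopMode (L κ : ℝ) (N n : ℕ) : Continuous (loopMode L κ N n) := by
  unfold loopMode; fun_prop

theorem continuous_loopMode' (L κ : ℝ) (N n : ℕ) : Continuous (loopMode' L κ N n) := by
  unfold loopMode'; fun_prop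

theorem hasDerivAt_e (L : ℝ) (j : ℕ) (x : ℝ) :
    HasDerivAt (e L j) (freq L j * cosMode L j x) x := by
  have h2 := (((hasDerivAt_id x).const_mul (freq L j)).sin).const_mul √(2 / L)
  rw [show e L j = fun x => √(2 / L) * sin (freq L j * id x) from funext (e_eq L j)]
  refine h2.congr_deriv ?_
  unfold cosMode
  simp only [id]; ring

theorem hasDerivAt_cosMode (L : ℝ) (j : ℕ) (x : ℝ) :
    HasDerivAt (cosMode L j) (-(freq L j * e L j x)) x := by
  have h2 := (((hasDerivAt_id x).const_mul (freq L j)).cos).const_mul √(2 / L)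
  refine h2.congr_deriv ?_
  rw [e_eq]
  simp only [id]; ring

/-- The restriction to y between 0 and x gives |x² - y²| ≤ x², hence a majorant of the series that
is uniform in y. -/
theorem continuousOn_kernel (ν μ x : ℝ) : ContinuousOn (kernel ν μ x) (uIcc 0 x) := by
  unfold kernel
  refine ContinuousOn.mul (by fun_prop) ?_
  refine continuousOn_tsum (u := fun m : ℕ => (|μ / (4 * ν) * x ^ 2|) ^ m / m !)
    (fun m => Continuous.continuousOn (by fun_prop)) (Real.summable_pow_div_factorial _) ?_
  intro m y hy
  have hyx2 : y ^ 2 ≤ x ^ 2 := sq_le_sq.2 (by simpa using abs_sub_left_of_mem_uIcc hy)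
  have e2 : |x ^ 2 - y ^ 2| ≤ |x ^ 2| := by
    rw [abs_of_nonneg (by linarith), abs_of_nonneg (by positivity)]
    nlinarith [sq_nonneg y]
  have h0 : (0 : ℝ) ≤ (m ! : ℝ) := by positivity
  have h1 : (1 : ℝ) ≤ (m + 1)! := by exact_mod_cast Nat.succ_le_of_lt (Nat.factorial_pos _)
  rw [← mul_pow, norm_div, norm_pow,
    Real.norm_of_nonneg (show (0 : ℝ) ≤ m ! * (m + 1)! by positivity),
    Real.norm_eq_abs, abs_mul, abs_neg, abs_mul]
  gcongr
  nlinarith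

/-- The matrix of `I + Υ_k P_N` on the first `N` modes. -/
noncomputable def gram (L κ : ℝ) (N : ℕ) : Matrix (Fin N) (Fin N) ℝ :=
  Matrix.of fun i j => innerL2 L (e L (i + 1)) (loopMode L κ N j)

/-- The first `N` sine coefficients of the backstepping transform of `f`. -/
noncomputable def lowModes (L κ : ℝ) (N : ℕ) (f : ℝ → ℝ) : Fin N → ℝ :=
  ((gram L κ N)⁻¹).mulVec fun i => innerL2 L (e L (i + 1)) f

/-- At x = L the sine e_{j+1} vanishes, so (Υ_k e_{j+1})(L) is the boundary value of the
eigenfunction. The feedback therefore reproduces the boundary value of every combination of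
eigenfunctions. -/
theorem feedback_kernel {L κ ν μ : ℝ} (hL : 0 < L) (hκ : 0 < κ) (h : κ = μ / ν) {N : ℕ}
    (hN : IsAdmissible L (kernel ν μ) N) :
    IsUnit (gram L κ N) ∧ ∀ f, feedback L (kernel ν μ) N f =
      ∑ j : Fin N, lowModes L κ N f j * loopMode L κ N j L := by
  let b : ℕ → C(ℝ, ℝ) := fun j => ⟨fun x => √(2 / L) *
      (freq L j / √(freq L j ^ 2 + κ) * sin (√(freq L j ^ 2 + κ) * x)) - e L j x, by
    have := continuous_e L j
    fun_prop⟩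
  have hb : ∀ j, volterra (kernel ν μ) (e L j) = b j := fun j =>
    funext fun x => volterra_e_eq hκ L h j x
  have hQ : ∀ j : Fin N, (fun x => e L (j + 1) x + b (j + 1) x) = loopMode L κ N j := fun j => by
    ext x
    rw [← hb, e_add_volterra_e hκ h j.2]
  obtain ⟨h1, h2⟩ := exists_feedback_eq hL (k := kernel ν μ) (fun x j =>
    ((continuousOn_kernel ν μ x).mul (continuous_e L j).continuousOn).intervalIntegrable) hb N hN
    (M := gram L κ N) (fun i j => by rw [hQ]; rfl)
  refine ⟨h1, fun f => ?_⟩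
  rw [h2]
  refine Finset.sum_congr rfl fun j _ => ?_
  rw [← hQ]
  simp only [e_length hL, zero_add]
  rfl

theorem gram_mulVec_lowModes {L κ : ℝ} {N : ℕ} (h : IsUnit (gram L κ N)) (f : ℝ → ℝ) (i : Fin N) :
    ∑ j : Fin N, innerL2 L (e L (i + 1)) (loopMode L κ N j) * lowModes L κ N f j =
      innerL2 L (e L (i + 1)) f := by
  have : (gram L κ N).mulVec (lowModes L κ N f) = fun i : Fin N => innerL2 L (e L (i + 1)) f := by
    rw [lowModes, Matrix.mulVec_mulVec,
      Matrix.mul_nonsing_inv _ ((Matrix.isUnit_iff_isUnit_det _).1 h),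
      Matrix.one_mulVec]
  exact congrFun this i

/-- Green's formula for the eigenfunctions of the open and of the closed loop. -/
theorem loopMode_boundary {L κ : ℝ} (hL : 0 < L) (hκ : 0 < κ) (N n m : ℕ) :
    loopMode L κ N n L * (freq L (m + 1) * cosMode L (m + 1) L) =
      (theta L κ N n - eigenvalue L (m + 1)) * innerL2 L (e L (m + 1)) (loopMode L κ N n) := by
  have c1 := continuous_loopMode L κ N n
  have c2 := continuous_loopMode' L κ N n
  have c3 := continuous_e L (m + 1)
  have c4 := continuous_cosMode L (m + 1)
  have h1 := intervalIntegral.integral_mul_deriv_eq_deriv_mul (a := 0) (b := L)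
    (fun x _ => hasDerivAt_e L (m + 1) x)
    (fun x _ => hasDerivAt_loopMode' hL hκ N n x) (Continuous.intervalIntegrable (by fun_prop) _ _)
    (Continuous.intervalIntegrable (by fun_prop) _ _)
  have h2 := intervalIntegral.integral_mul_deriv_eq_deriv_mul (a := 0) (b := L)
    (fun x _ => (hasDerivAt_cosMode L (m + 1) x).const_mul (freq L (m + 1)))
    (fun x _ => hasDerivAt_loopMode hL hκ N n x) (Continuous.intervalIntegrable (by fun_prop) _ _)
    (Continuous.intervalIntegrable (by fun_prop) _ _)
  rw [h2, e_length hL, e_zero_right, loopMode_zero] at h1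
  have e1 : ∀ x, e L (m + 1) x * -(theta L κ N n * loopMode L κ N n x) =
      (-theta L κ N n) * (e L (m + 1) x * loopMode L κ N n x) := fun x => by ring
  have e2 : ∀ x, freq L (m + 1) * -(freq L (m + 1) * e L (m + 1) x) * loopMode L κ N n x =
      (-eigenvalue L (m + 1)) * (e L (m + 1) x * loopMode L κ N n x) := fun x => by
    rw [eigenvalue_eq]; ring
  simp_rw [e1, e2, intervalIntegral.integral_const_mul] at h1
  unfold innerL2
  linarith

/-! ### Series of eigenfunctions. -/

theorem hasSum_innerL2_tsum {L : ℝ} (hL : 0 < L) {f : ℕ → ℝ → ℝ} {u : ℕ → ℝ}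
    (hf : ∀ n, Continuous (f n)) (hfu : ∀ n x, |f n x| ≤ u n) (hu : Summable u) {g : ℝ → ℝ}
    (hg : Integrable g (vol L)) :
    HasSum (fun n => innerL2 L (f n) g) (innerL2 L (fun x => ∑' n, f n x) g) := by
  simp only [innerL2, intervalIntegral_eq_vol hL]
  refine hasSum_integral_of_dominated_convergence (fun n x => u n * |g x|) ?_ ?_ ?_ ?_ ?_
  · exact fun n => (hf n).aestronglyMeasurable.mul hg.aestronglyMeasurable
  · intro n
    refine Filter.Eventually.of_forall fun x => ?_
    rw [Real.norm_eq_abs, abs_mul]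
    exact mul_le_mul_of_nonneg_right (hfu n x) (abs_nonneg _)
  · exact Filter.Eventually.of_forall fun x => hu.mul_right _
  · simp_rw [tsum_mul_right]
    exact hg.abs.const_mul _
  · refine Filter.Eventually.of_forall fun x => ?_
    have h1 : Summable fun n => f n x := Summable.of_norm_bounded hu (fun n => hfu n x)
    exact h1.hasSum.mul_right (g x)

theorem integral_sq_add_le {L : ℝ} (hL : 0 < L) {f g : ℝ → ℝ} (hf : MemLp f 2 (vol L))
    (hg : MemLp g 2 (vol L)) :
    innerL2 L (fun x => f x + g x) (fun x => f x + g x) ≤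
      2 * innerL2 L f f + 2 * innerL2 L g g := by
  have h1 := integrable_mul_of_memLp hf hf
  have h2 := integrable_mul_of_memLp hg hg
  have h3 := hf.add hg
  simp only [innerL2, intervalIntegral_eq_vol hL]
  rw [← integral_const_mul, ← integral_const_mul, ← integral_add (h1.const_mul _) (h2.const_mul _)]
  refine integral_mono (integrable_mul_of_memLp h3 h3) ((h1.const_mul _).add (h2.const_mul _)) ?_
  intro x
  simp only
  nlinarith [sq_nonneg (f x - g x)]

theorem innerL2_self_le_of_bound {L : ℝ} (hL : 0 < L) {f : ℝ → ℝ} (hf : MemLp f 2 (vol L))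
    {C : ℝ} (h : ∀ x, |f x| ≤ C) : innerL2 L f f ≤ L * C ^ 2 := by
  have h1 := integrable_mul_of_memLp hf hf
  have h2 : ∫ _ in (0 : ℝ)..L, C ^ 2 = L * C ^ 2 := by simp
  rw [← h2]
  refine intervalIntegral.integral_mono_on hL.le ((integrable_vol_iff hL _).1 h1)
    intervalIntegrable_const fun x _ => ?_
  rw [← sq]
  exact sq_le_sq' (by linarith [neg_abs_le (f x), h x]) ((le_abs_self _).trans (h x))

/-- The `L²` norm of a series in an orthonormal system that is perturbed in the first `N` places. -/
theorem innerL2_tsum_le {L : ℝ} (hL : 0 < L) {N : ℕ} {p q : ℕ → ℝ → ℝ} {c : ℕ → ℝ}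
    (hp : ∀ n, Continuous (p n)) (hq : ∀ n, Continuous (q n))
    (hpb : ∀ n x, |p n x| ≤ √(2 / L)) (hqb : ∀ n x, |q n x| ≤ √(2 / L))
    (ho : ∀ i j, innerL2 L (p i) (p j) = if i = j then 1 else 0)
    (hpq : ∀ n, N ≤ n → q n = p n) (hc : Summable fun n => |c n|) :
    innerL2 L (fun x => ∑' n, c n * q n x) (fun x => ∑' n, c n * q n x) ≤
      (2 + 16 * N) * ∑' n, c n ^ 2 := by
  set s := √(2 / L) with hs
  have hs0 : 0 ≤ s := Real.sqrt_nonneg _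
  have hcp : ∀ n x, |c n * p n x| ≤ |c n| * s := fun n x => by
    rw [abs_mul]; exact mul_le_mul_of_nonneg_left (hpb n x) (abs_nonneg _)
  have hcq : ∀ n x, |c n * q n x| ≤ |c n| * s := fun n x => by
    rw [abs_mul]; exact mul_le_mul_of_nonneg_left (hqb n x) (abs_nonneg _)
  have hcs := hc.mul_right s
  have hcpc : ∀ n, Continuous fun x => c n * p n x := fun n => (hp n).const_mul _
  set w : ℝ → ℝ := fun x => ∑' n, c n * p n x with hw
  -- The series splits into an orthonormal one, w, and a finite sum r over the perturbed places.
  set r : ℝ → ℝ := fun x => ∑ n ∈ Finset.range N, c n * (q n x - p n x) with hr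
  have hwc : Continuous w := continuous_tsum hcpc hcs hcp
  have hrc : Continuous r := by fun_prop
  have hwr : (fun x => ∑' n, c n * q n x) = fun x => w x + r x := by
    ext x
    have h1 : HasSum (fun n => c n * (q n x - p n x)) (r x) := by
      refine hasSum_sum_of_ne_finset_zero fun n hn => ?_
      rw [hpq n (by simpa using hn), sub_self, mul_zero]
    have h2 : HasSum (fun n => c n * p n x) (w x) :=
      (Summable.of_norm_bounded hcs (fun n => hcp n x)).hasSum
    have h3 := h2.add h1
    rw [← h3.tsum_eq]
    exact tsum_congr fun n => by ring
  have hc2 : Summable fun n => c n ^ 2 := by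
    have := hc.tendsto_atTop_zero
    refine Summable.of_norm_bounded_eventually_nat hc ?_
    filter_upwards [this.eventually (ge_mem_nhds (show (0 : ℝ) < 1 by norm_num))] with n hn
    rw [Real.norm_eq_abs, abs_pow, sq]
    exact mul_le_of_le_one_right (abs_nonneg _) hn
  have hpi : ∀ n, Integrable (p n) (vol L) := fun n =>
    integrable_of_memLp_two (memLp_vol_of_continuous (hp n) 2)
  have hwp : ∀ m, innerL2 L w (p m) = c m := fun m => by
    have h1 := hasSum_innerL2_tsum hL hcpc hcp hcs (hpi m)
    simp_rw [innerL2_const_mul_left, ho] at h1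
    have h2 : HasSum (fun n => c n * if n = m then 1 else 0) (c m) := by
      convert hasSum_ite_eq m (c m) using 2 with n
      split_ifs with h
      · rw [h, mul_one]
      · rw [mul_zero]
    exact h1.unique h2
  have hww : innerL2 L w w = ∑' n, c n ^ 2 := by
    have h1 := hasSum_innerL2_tsum hL hcpc hcp hcs
      (integrable_of_memLp_two (memLp_vol_of_continuous hwc 2))
    rw [← h1.tsum_eq]
    refine tsum_congr fun n => ?_
    rw [innerL2_const_mul_left, innerL2_comm, hwp]; ring
  -- Cauchy–Schwarz over N indices with |q_n - p_n| ≤ 2s and s² = 2/L. Integration over length L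
  -- gives the factor 8N for r, and (a + b)² ≤ 2a² + 2b² leads to 2 + 16N.
  have hrb : ∀ x, |r x| ≤ 2 * s * √(N * ∑' n, c n ^ 2) := fun x => by
    have h1 : |r x| ≤ ∑ n ∈ Finset.range N, |c n| * (2 * s) := by
      refine (Finset.abs_sum_le_sum_abs _ _).trans (Finset.sum_le_sum fun n _ => ?_)
      rw [abs_mul]
      refine mul_le_mul_of_nonneg_left ?_ (abs_nonneg _)
      refine (abs_sub _ _).trans ?_
      linarith [hqb n x, hpb n x]
    rw [← Finset.sum_mul, mul_comm] at h1
    refine h1.trans (mul_le_mul_of_nonneg_left ?_ (by positivity))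
    refine Real.le_sqrt_of_sq_le ?_
    have h2 := sq_sum_le_card_mul_sum_sq (s := Finset.range N) (f := fun n => |c n|)
    rw [Finset.card_range] at h2
    refine h2.trans (mul_le_mul_of_nonneg_left ?_ (by positivity))
    simp only [sq_abs]
    exact hc2.sum_le_tsum _ fun n _ => sq_nonneg _
  have hrr := innerL2_self_le_of_bound hL (memLp_vol_of_continuous hrc 2) hrb
  have h0 : 0 ≤ ∑' n, c n ^ 2 := tsum_nonneg fun n => sq_nonneg _
  rw [mul_pow, mul_pow, Real.sq_sqrt (by positivity), Real.sq_sqrt (by positivity)] at hrr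
  have e1 : L * (2 ^ 2 * (2 / L) * (N * ∑' n, c n ^ 2)) = 8 * N * ∑' n, c n ^ 2 := by
    field_simp; ring
  rw [hwr]
  refine (integral_sq_add_le hL (memLp_vol_of_continuous hwc 2)
    (memLp_vol_of_continuous hrc 2)).trans ?_
  rw [hww]
  linarith

/-- The series of eigenfunctions of the closed loop with coefficients `c`. -/
noncomputable def loopSeries (L κ : ℝ) (N : ℕ) (c : ℕ → ℝ) (x : ℝ) : ℝ :=
  ∑' n, c n * loopMode L κ N n x

/-- The derivative of `loopSeries`. -/
noncomputable def loopSeries' (L κ : ℝ) (N : ℕ) (c : ℕ → ℝ) (x : ℝ) : ℝ :=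
  ∑' n, c n * loopMode' L κ N n x

theorem summable_abs_mul_freq {L : ℝ} {c : ℕ → ℝ} (h0 : Summable fun n => |c n|)
    (h1 : Summable fun n => |c n| * eigenvalue L (n + 1)) :
    Summable fun n => |c n| * |freq L (n + 1)| := by
  refine Summable.of_nonneg_of_le (fun n => by positivity) (fun n => ?_) (h0.add h1)
  rw [eigenvalue_eq, ← mul_one_add]
  refine mul_le_mul_of_nonneg_left ?_ (abs_nonneg _)
  rw [← sq_abs]
  nlinarith [sq_nonneg (|freq L (n + 1)| - 1), sq_nonneg |freq L (n + 1)|]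

theorem summable_theta_mul {L κ : ℝ} (hL : 0 < L) (hκ : 0 < κ) (N : ℕ) {c : ℕ → ℝ}
    (h0 : Summable fun n => |c n|) (h1 : Summable fun n => |c n| * eigenvalue L (n + 1)) :
    Summable fun n => |c n * theta L κ N n| := by
  refine Summable.of_nonneg_of_le (fun n => abs_nonneg _) (fun n => ?_)
    (h1.add (h0.mul_right κ))
  rw [abs_mul, abs_of_pos (theta_pos hL hκ N n), ← mul_add]
  exact mul_le_mul_of_nonneg_left (theta_le hκ L N n) (abs_nonneg _)

theorem abs_mul_loopMode_le {L κ : ℝ} (hL : 0 < L) (hκ : 0 < κ) (N : ℕ) (c : ℕ → ℝ) (n : ℕ)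
    (x : ℝ) : |c n * loopMode L κ N n x| ≤ |c n| * √(2 / L) := by
  rw [abs_mul]
  exact mul_le_mul_of_nonneg_left (abs_loopMode_le hL hκ N n x) (abs_nonneg _)

theorem abs_mul_loopMode'_le {L : ℝ} (hL : 0 < L) (κ : ℝ) (N : ℕ) (c : ℕ → ℝ) (n : ℕ)
    (x : ℝ) : |c n * loopMode' L κ N n x| ≤ |c n| * |freq L (n + 1)| * √(2 / L) := by
  rw [abs_mul, mul_assoc, abs_of_pos (freq_pos hL n), mul_comm (freq L _)]
  exact mul_le_mul_of_nonneg_left (abs_loopMode'_le hL κ N n x) (abs_nonneg _)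

theorem summable_loopSeries {L κ : ℝ} (hL : 0 < L) (hκ : 0 < κ) (N : ℕ) {c : ℕ → ℝ}
    (h0 : Summable fun n => |c n|) (x : ℝ) : Summable fun n => c n * loopMode L κ N n x :=
  Summable.of_norm_bounded (h0.mul_right _) fun n => abs_mul_loopMode_le hL hκ N c n x

theorem continuous_loopSeries {L κ : ℝ} (hL : 0 < L) (hκ : 0 < κ) (N : ℕ) {c : ℕ → ℝ}
    (h0 : Summable fun n => |c n|) : Continuous (loopSeries L κ N c) :=
  continuous_tsum (fun n => (continuous_loopMode L κ N n).const_mul _)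
    (h0.mul_right _) (abs_mul_loopMode_le hL hκ N c)

theorem continuous_loopSeries' {L : ℝ} (hL : 0 < L) (κ : ℝ) (N : ℕ) {c : ℕ → ℝ}
    (h0 : Summable fun n => |c n|) (h1 : Summable fun n => |c n| * eigenvalue L (n + 1)) :
    Continuous (loopSeries' L κ N c) :=
  continuous_tsum (fun n => (continuous_loopMode' L κ N n).const_mul _)
    ((summable_abs_mul_freq h0 h1).mul_right _) (abs_mul_loopMode'_le hL κ N c)

theorem hasDerivAt_loopSeries {L κ : ℝ} (hL : 0 < L) (hκ : 0 < κ) (N : ℕ) {c : ℕ → ℝ}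
    (h0 : Summable fun n => |c n|) (h1 : Summable fun n => |c n| * eigenvalue L (n + 1)) (x : ℝ) :
    HasDerivAt (loopSeries L κ N c) (loopSeries' L κ N c x) x :=
  hasDerivAt_tsum ((summable_abs_mul_freq h0 h1).mul_right _)
    (fun n x => (hasDerivAt_loopMode hL hκ N n x).const_mul _)
    (abs_mul_loopMode'_le hL κ N c) (summable_loopSeries hL hκ N h0 0) x

theorem hasDerivAt_loopSeries' {L κ : ℝ} (hL : 0 < L) (hκ : 0 < κ) (N : ℕ) {c : ℕ → ℝ}
    (h0 : Summable fun n => |c n|) (h1 : Summable fun n => |c n| * eigenvalue L (n + 1)) (x : ℝ) :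
    HasDerivAt (loopSeries' L κ N c)
      (-loopSeries L κ N (fun n => c n * theta L κ N n) x) x := by
  have h2 := hasDerivAt_tsum ((summable_theta_mul hL hκ N h0 h1).mul_right √(2 / L))
    (g := fun n x => c n * loopMode' L κ N n x)
    (g' := fun n x => c n * -(theta L κ N n * loopMode L κ N n x)) (y₀ := 0)
    (fun n x => (hasDerivAt_loopMode' hL hκ N n x).const_mul _)
    (fun n x => by
      rw [mul_neg, norm_neg, ← mul_assoc]
      exact abs_mul_loopMode_le hL hκ N (fun n => c n * theta L κ N n) n x)
    (Summable.of_norm_bounded ((summable_abs_mul_freq h0 h1).mul_right _)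
      fun n => abs_mul_loopMode'_le hL κ N c n 0) x
  refine h2.congr_deriv ?_
  rw [loopSeries, ← tsum_neg]
  exact tsum_congr fun n => by ring

theorem loopSeries_zero (L κ : ℝ) (N : ℕ) (c : ℕ → ℝ) : loopSeries L κ N c 0 = 0 := by
  simp [loopSeries, loopMode_zero]

theorem loopSeries_length {L : ℝ} (hL : 0 < L) (κ : ℝ) (N : ℕ) (c : ℕ → ℝ) :
    loopSeries L κ N c L = ∑ n : Fin N, c n * loopMode L κ N n L := by
  rw [loopSeries, tsum_eq_sum (s := Finset.range N), Finset.sum_range]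
  intro n hn
  rw [loopMode_of_le hL κ (by simpa using hn), e_length hL, mul_zero]

theorem innerL2_loopSeries_le {L κ : ℝ} (hL : 0 < L) (hκ : 0 < κ) (N : ℕ) {c : ℕ → ℝ}
    (h0 : Summable fun n => |c n|) :
    innerL2 L (loopSeries L κ N c) (loopSeries L κ N c) ≤ (2 + 16 * N) * ∑' n, c n ^ 2 :=
  innerL2_tsum_le hL (fun n => continuous_e L (n + 1)) (fun n => continuous_loopMode L κ N n)
    (fun n x => abs_e_le L (n + 1) x) (fun n x => abs_loopMode_le hL hκ N n x) (innerL2_e hL)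
    (fun _ hn => loopMode_of_le hL κ hn) h0

/-- The normalization of `loopMode` gives its derivative the amplitude of the n-th frequency for all
n. Thus the differentiated series has coefficients c_n times that frequency in a system that differs
from the orthonormal cosines in only N places. -/
theorem innerL2_loopSeries'_le {L : ℝ} (hL : 0 < L) (κ : ℝ) (N : ℕ) {c : ℕ → ℝ}
    (h0 : Summable fun n => |c n|) (h1 : Summable fun n => |c n| * eigenvalue L (n + 1)) :
    innerL2 L (loopSeries' L κ N c) (loopSeries' L κ N c) ≤
      (2 + 16 * N) * ∑' n, eigenvalue L (n + 1) * c n ^ 2 := by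
  have h2 := innerL2_tsum_le hL (N := N) (p := fun n => cosMode L (n + 1))
    (q := fun n x => √(2 / L) * cos (√(theta L κ N n) * x))
    (c := fun n => c n * freq L (n + 1))
    (fun n => continuous_cosMode L (n + 1)) (fun n => by fun_prop)
    (fun n x => abs_cosMode_le L (n + 1) x) (fun n x => by
      rw [abs_mul, abs_of_nonneg (Real.sqrt_nonneg _)]
      exact mul_le_of_le_one_right (Real.sqrt_nonneg _) (abs_cos_le_one _)) (innerL2_cosMode hL)
    (fun n hn => by ext x; rw [theta_of_le L κ hn, sqrt_eigenvalue hL]; rfl)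
    (by simpa only [abs_mul] using summable_abs_mul_freq h0 h1)
  convert h2 using 1
  · have : loopSeries' L κ N c =
        fun x => ∑' n, c n * freq L (n + 1) * (√(2 / L) * cos (√(theta L κ N n) * x)) := by
      ext x
      exact tsum_congr fun n => by unfold loopMode'; ring
    rw [this]
  · congr 1
    exact tsum_congr fun n => by rw [eigenvalue_eq]; ring

/-- The sine coefficients of a series of eigenfunctions of the closed loop. -/
theorem innerL2_e_loopSeries {L κ : ℝ} (hL : 0 < L) (hκ : 0 < κ) (N : ℕ) {c : ℕ → ℝ}
    (h0 : Summable fun n => |c n|) (m : ℕ) :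
    innerL2 L (e L (m + 1)) (loopSeries L κ N c) = c m + ∑ i : Fin N,
      c i * (innerL2 L (e L (m + 1)) (loopMode L κ N i) - if m = i then 1 else 0) := by
  have h1 := hasSum_innerL2_tsum hL (f := fun n x => c n * loopMode L κ N n x)
    (fun n => (continuous_loopMode L κ N n).const_mul _)
    (abs_mul_loopMode_le hL hκ N c) (h0.mul_right _)
    (integrable_of_memLp_two (memLp_vol_of_continuous (continuous_e L (m + 1)) 2))
  simp_rw [innerL2_const_mul_left] at h1
  have h2 : HasSum (fun n => if n = m then c m else 0) (c m) := hasSum_ite_eq m (c m)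
  have h3 : HasSum (fun n => c n * (innerL2 L (e L (m + 1)) (loopMode L κ N n) -
      if m = n then 1 else 0)) (∑ i ∈ Finset.range N,
      c i * (innerL2 L (e L (m + 1)) (loopMode L κ N i) - if m = i then 1 else 0)) := by
    refine hasSum_sum_of_ne_finset_zero fun n hn => ?_
    rw [loopMode_of_le hL κ (by simpa using hn), innerL2_e hL, sub_self, mul_zero]
  rw [Finset.sum_range] at h3
  rw [innerL2_comm]
  refine h1.unique ((h2.add h3).congr_fun fun n => ?_)
  rw [innerL2_comm]
  rcases eq_or_ne n m with rfl | h
  · simp only [if_true]; ring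
  · rw [if_neg h, if_neg h.symm]; ring

/-! ### Coefficients of the initial datum in the eigenfunctions of the closed loop. -/

/-- The coefficients of `f` with respect to the eigenfunctions of the closed loop. -/
noncomputable def loopCoeff (L κ : ℝ) (N : ℕ) (f : ℝ → ℝ) (n : ℕ) : ℝ :=
  innerL2 L (e L (n + 1)) f - ∑ i : Fin N,
    lowModes L κ N f i * (innerL2 L (e L (n + 1)) (loopMode L κ N i) - if n = i then 1 else 0)

/-- For low indices the sum over (e_i, Q_j) cancels the sine coefficient by the linear system, and
only the Kronecker term survives. -/
theorem loopCoeff_fin {L κ : ℝ} {N : ℕ} (hG : IsUnit (gram L κ N)) (f : ℝ → ℝ) (i : Fin N) :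
    loopCoeff L κ N f i = lowModes L κ N f i := by
  have h1 := gram_mulVec_lowModes hG f i
  unfold loopCoeff
  rw [← h1, ← Finset.sum_sub_distrib]
  rw [Finset.sum_congr rfl (g := fun j => if i = j then lowModes L κ N f j else 0) fun j _ => ?_]
  · simp
  · simp only [Fin.val_inj]
    split_ifs <;> ring

/-- The difference between `f` and its backstepping transform, i.e. `Φ_N f`. -/
noncomputable def loopCorrection (L κ : ℝ) (N : ℕ) (f : ℝ → ℝ) (x : ℝ) : ℝ :=
  ∑ i : Fin N, lowModes L κ N f i * (loopMode L κ N i x - e L (i + 1) x)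

/-- The derivative of `loopCorrection`. -/
noncomputable def loopCorrection' (L κ : ℝ) (N : ℕ) (f : ℝ → ℝ) (x : ℝ) : ℝ :=
  ∑ i : Fin N, lowModes L κ N f i *
    (loopMode' L κ N i x - freq L (i + 1) * cosMode L (i + 1) x)

theorem continuous_loopCorrection (L κ : ℝ) (N : ℕ) (f : ℝ → ℝ) :
    Continuous (loopCorrection L κ N f) := by
  have h1 := continuous_e L
  have h2 := continuous_loopMode L κ N
  unfold loopCorrection; fun_prop

theorem continuous_loopCorrection' (L κ : ℝ) (N : ℕ) (f : ℝ → ℝ) :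
    Continuous (loopCorrection' L κ N f) := by
  have h1 := continuous_cosMode L
  have h2 := continuous_loopMode' L κ N
  unfold loopCorrection'; fun_prop

theorem hasDerivAt_loopCorrection {L κ : ℝ} (hL : 0 < L) (hκ : 0 < κ) (N : ℕ) (f : ℝ → ℝ)
    (x : ℝ) : HasDerivAt (loopCorrection L κ N f) (loopCorrection' L κ N f x) x :=
  HasDerivAt.fun_sum fun i _ =>
    ((hasDerivAt_loopMode hL hκ N i x).sub (hasDerivAt_e L (i + 1) x)).const_mul _

/-- Exhibits the coefficients in the non-orthogonal system as plain sine coefficients of a corrected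
function, so that Bessel and Parseval become available. -/
theorem innerL2_e_sub_loopCorrection {L : ℝ} (hL : 0 < L) (κ : ℝ) (N : ℕ) {f : ℝ → ℝ}
    (hf : MemLp f 2 (vol L)) (n : ℕ) :
    innerL2 L (e L (n + 1)) (fun x => f x - loopCorrection L κ N f x) = loopCoeff L κ N f n := by
  have he : ∀ j, MemLp (e L j) 2 (vol L) := fun j => memLp_vol_of_continuous (continuous_e L j) _
  have hQ : ∀ j, MemLp (loopMode L κ N j) 2 (vol L) := fun j =>
    memLp_vol_of_continuous (continuous_loopMode L κ N j) _
  have hc := continuous_loopMode L κ N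
  have hc' := continuous_e L
  rw [innerL2_comm, innerL2_sub_left hL hf
    (memLp_vol_of_continuous (continuous_loopCorrection L κ N f) _) (he _), innerL2_comm, loopCoeff]
  congr 1
  unfold loopCorrection
  rw [innerL2_sum_left _ hL (fun i _ => memLp_vol_of_continuous (by fun_prop) _) (he _)]
  refine Finset.sum_congr rfl fun i _ => ?_
  rw [innerL2_const_mul_left, innerL2_sub_left hL (hQ _) (he _) (he _), innerL2_e hL, innerL2_comm]
  simp only [eq_comm]

/-- By the trace hypothesis, which is the compatibility condition, f and its correction have the
same boundary values. Hence integration by parts against a cosine leaves no boundary term. -/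
theorem innerL2_cosMode_sub {L κ : ℝ} (hL : 0 < L) (hκ : 0 < κ) (N : ℕ) {f g : ℝ → ℝ}
    (hf : MemLp f 2 (vol L)) (hg : MemLp g 2 (vol L)) (h : HasWeakDeriv L 1 f g)
    (ht : HasTraces L f 0 (∑ i : Fin N, lowModes L κ N f i * loopMode L κ N i L)) (n : ℕ) :
    innerL2 L (cosMode L (n + 1)) (fun x => g x - loopCorrection' L κ N f x) =
      freq L (n + 1) * loopCoeff L κ N f n := by
  have hc := continuous_loopCorrection L κ N f
  have hc' := continuous_loopCorrection' L κ N f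
  have hcos := continuous_cosMode L (n + 1)
  have he := continuous_e L (n + 1)
  have hd : deriv (cosMode L (n + 1)) = fun x => -(freq L (n + 1) * e L (n + 1) x) :=
    funext fun x => (hasDerivAt_cosMode L (n + 1) x).deriv
  have h1 := integral_weakDeriv_mul hL (integrable_of_memLp_two hg) h ht
    (η := cosMode L (n + 1)) (by unfold cosMode; fun_prop)
  have h2 := intervalIntegral.integral_deriv_mul_eq_sub (a := 0) (b := L)
    (fun x _ => hasDerivAt_loopCorrection hL hκ N f x)
    (fun x _ => hasDerivAt_cosMode L (n + 1) x)
    (Continuous.intervalIntegrable (by fun_prop) _ _)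
    (Continuous.intervalIntegrable (by fun_prop) _ _)
  rw [intervalIntegral.integral_add (Continuous.intervalIntegrable (by fun_prop) _ _)
    (Continuous.intervalIntegrable (by fun_prop) _ _)] at h2
  have e0 : loopCorrection L κ N f 0 = 0 := by
    simp [loopCorrection, loopMode_zero, e_zero_right]
  have eL : loopCorrection L κ N f L = ∑ i : Fin N, lowModes L κ N f i * loopMode L κ N i L := by
    simp [loopCorrection, e_length hL]
  rw [e0, eL] at h2
  rw [hd] at h1
  have e1 : ∀ (F : ℝ → ℝ) (x : ℝ), F x * -(freq L (n + 1) * e L (n + 1) x) =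
      -freq L (n + 1) * (F x * e L (n + 1) x) := fun F x => by ring
  simp_rw [e1, intervalIntegral.integral_const_mul] at h1 h2
  rw [← innerL2_e_sub_loopCorrection hL κ N hf, innerL2_comm, innerL2_comm L (e L (n + 1)),
    innerL2_sub_left hL hg (memLp_vol_of_continuous hc' _) (memLp_vol_of_continuous hcos _),
    innerL2_sub_left hL hf (memLp_vol_of_continuous hc _) (memLp_vol_of_continuous he _)]
  simp only [innerL2]
  linarith

theorem exists_abs_lowModes_le {L : ℝ} (hL : 0 < L) (κ : ℝ) (N : ℕ) : ∃ A, 0 ≤ A ∧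
    ∀ f, MemLp f 2 (vol L) → ∀ i, |lowModes L κ N f i| ≤ A * √(innerL2 L f f) := by
  refine ⟨∑ i : Fin N, ∑ j : Fin N, |(gram L κ N)⁻¹ i j|,
    by positivity, fun f hf i => ?_⟩
  have h1 : |lowModes L κ N f i| ≤ (∑ j : Fin N, |(gram L κ N)⁻¹ i j|) * √(innerL2 L f f) := by
    have h0 : lowModes L κ N f i =
      ∑ j : Fin N, (gram L κ N)⁻¹ i j * innerL2 L (e L (j + 1)) f := rfl
    rw [h0, Finset.sum_mul]
    refine (Finset.abs_sum_le_sum_abs _ _).trans (Finset.sum_le_sum fun j _ => ?_)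
    rw [abs_mul]
    refine mul_le_mul_of_nonneg_left ?_ (abs_nonneg _)
    have := abs_innerL2_le hL (memLp_vol_of_continuous (continuous_e L (j + 1)) 2) hf
    rwa [innerL2_e hL, if_pos rfl, Real.sqrt_one, one_mul] at this
  refine h1.trans (mul_le_mul_of_nonneg_right ?_ (Real.sqrt_nonneg _))
  exact Finset.single_le_sum (f := fun i => ∑ j : Fin N, |(gram L κ N)⁻¹ i j|)
    (fun i _ => by positivity) (Finset.mem_univ i)

/-- A perturbation of `f` by a function bounded in terms of the norm of `f`. -/
theorem innerL2_sub_le_of_bound {L : ℝ} (hL : 0 < L) {g r : ℝ → ℝ} (hg : MemLp g 2 (vol L))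
    (hr : Continuous r) {D Y : ℝ} (hY : 0 ≤ Y) (h : ∀ x, |r x| ≤ D * √Y) :
    innerL2 L (fun x => g x - r x) (fun x => g x - r x) ≤
      2 * innerL2 L g g + 2 * (L * D ^ 2) * Y := by
  have hrm := memLp_vol_of_continuous (L := L) hr 2
  have h1 := integral_sq_add_le hL hg hrm.neg
  have h2 := innerL2_self_le_of_bound hL hrm h
  rw [mul_pow, Real.sq_sqrt hY] at h2
  have h3 : innerL2 L (-r) (-r) = innerL2 L r r := by simp [innerL2]
  rw [h3] at h1
  simp only [Pi.neg_apply, ← sub_eq_add_neg] at h1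
  linarith

/-- Bessel's inequality for the corrected function, in sines for L² and in cosines for its
derivative. The corrections are bounded pointwise by the L² norm of f because they involve only N
functionals. An inequality is enough, so the constant cosine can be left out. -/
theorem exists_loopCoeff_bound {L κ : ℝ} (hL : 0 < L) (hκ : 0 < κ) (N : ℕ) : ∃ C, 0 ≤ C ∧
    ∀ f, MemLp f 2 (vol L) →
      (Summable (fun n => loopCoeff L κ N f n ^ 2) ∧
        ∑' n, loopCoeff L κ N f n ^ 2 ≤ C * innerL2 L f f) ∧
      ∀ g, MemLp g 2 (vol L) → HasWeakDeriv L 1 f g →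
        HasTraces L f 0 (∑ i : Fin N, lowModes L κ N f i * loopMode L κ N i L) →
        Summable (fun n => eigenvalue L (n + 1) * loopCoeff L κ N f n ^ 2) ∧
          ∑' n, eigenvalue L (n + 1) * loopCoeff L κ N f n ^ 2 ≤
            C * (innerL2 L f f + innerL2 L g g) := by
  obtain ⟨A, hA, hAb⟩ := exists_abs_lowModes_le hL κ N
  set D := ∑ i : Fin N, A * (2 * √(2 / L)) with hD
  set D' := ∑ i : Fin N, A * (2 * √(2 / L) * freq L (i + 1)) with hD'
  have hLD : 0 ≤ L * D ^ 2 := by positivity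
  have hLD' : 0 ≤ L * D' ^ 2 := by positivity
  refine ⟨2 + 2 * (L * D ^ 2) + 2 * (L * D' ^ 2), by positivity,
    fun f hf => ⟨?_, fun g hg h ht => ?_⟩⟩
  · have hY := innerL2_self_nonneg hL f
    have hr : ∀ x, |loopCorrection L κ N f x| ≤ D * √(innerL2 L f f) := fun x => by
      rw [hD, Finset.sum_mul]
      refine (Finset.abs_sum_le_sum_abs _ _).trans (Finset.sum_le_sum fun i _ => ?_)
      rw [abs_mul, mul_right_comm]
      refine mul_le_mul (hAb f hf i) ?_ (abs_nonneg _) (by positivity)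
      refine (abs_sub _ _).trans ?_
      linarith [abs_loopMode_le hL hκ N i x, abs_e_le L (i + 1) x]
    have h1 := innerL2_sub_le_of_bound hL hf (continuous_loopCorrection L κ N f) hY hr
    have h2 := bessel hL (fun n => memLp_vol_of_continuous (continuous_e L (n + 1)) 2)
      (innerL2_e hL) (f := fun x => f x - loopCorrection L κ N f x)
      (hf.sub (memLp_vol_of_continuous (continuous_loopCorrection L κ N f) 2))
    simp only [innerL2_e_sub_loopCorrection hL κ N hf] at h2
    refine ⟨h2.1, h2.2.trans (h1.trans ?_)⟩
    nlinarith [mul_nonneg hLD' hY]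
  · have hY := innerL2_self_nonneg hL f
    have hZ := innerL2_self_nonneg hL g
    have hr : ∀ x, |loopCorrection' L κ N f x| ≤ D' * √(innerL2 L f f) := fun x => by
      rw [hD', Finset.sum_mul]
      refine (Finset.abs_sum_le_sum_abs _ _).trans (Finset.sum_le_sum fun i _ => ?_)
      have hfp := freq_pos hL i
      rw [abs_mul, mul_right_comm]
      refine mul_le_mul (hAb f hf i) ?_ (abs_nonneg _) (by positivity)
      refine (abs_sub _ _).trans ?_
      rw [abs_mul, abs_of_pos hfp]
      have := mul_le_mul_of_nonneg_left (abs_cosMode_le L (i + 1) x) hfp.le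
      linarith [abs_loopMode'_le hL κ N i x]
    have h1 := innerL2_sub_le_of_bound hL hg (continuous_loopCorrection' L κ N f) hY hr
    have h2 := bessel hL (fun n => memLp_vol_of_continuous (continuous_cosMode L (n + 1)) 2)
      (innerL2_cosMode hL) (f := fun x => g x - loopCorrection' L κ N f x)
      (hg.sub (memLp_vol_of_continuous (continuous_loopCorrection' L κ N f) 2))
    simp only [innerL2_cosMode_sub hL hκ N hf hg h ht, mul_pow, ← eigenvalue_eq] at h2
    refine ⟨h2.1, h2.2.trans (h1.trans ?_)⟩
    nlinarith [mul_nonneg hLD hY, mul_nonneg hLD hZ, mul_nonneg hLD' hZ]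

/-! ### Uniqueness: the equations for the modes of a weak solution. -/

/-- Weak solutions of `y' = -s y`, `y(0) = y₀`. -/
theorem ae_eq_exp_of_weak_ode {y : ℝ → ℝ} {s y₀ : ℝ}
    (hy : ∀ T > 0, IntegrableOn y (Ioo 0 T))
    (h : ∀ p : ℝ → ℝ, ContDiff ℝ ∞ p → (∃ T, ∀ t ≥ T, p t = 0) →
      ∫ t in Ioi 0, (-(y t * deriv p t) + s * y t * p t) = p 0 * y₀) :
    ∀ᵐ t ∂volume.restrict (Ioi 0), y t = y₀ * exp (-s * t) := by
  have hE : Continuous fun t => exp (s * t) := by fun_prop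
  have hloc : LocallyIntegrableOn (fun t => exp (s * t) * y t - y₀) (Ioi 0) := by
    intro t ht
    refine ⟨Ioo 0 (t + 1), mem_nhdsWithin_of_mem_nhds (Ioo_mem_nhds ht (by linarith)), ?_⟩
    have h1 := hy (t + 1) (by have : (0 : ℝ) < t := ht; linarith)
    refine Integrable.sub ?_ (integrable_const _)
    have := integrable_mul_continuous (L := t + 1) h1 hE
    exact this.congr (Filter.Eventually.of_forall fun t => mul_comm _ _)
  have key := isOpen_Ioi.ae_eq_zero_of_integral_contDiff_smul_eq_zero hloc fun q hq hqc hqs => by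
    have hqi : ∀ a b, IntervalIntegrable q volume a b := fun a b =>
      hq.continuous.intervalIntegrable _ _
    obtain ⟨R, hR0, hR⟩ : ∃ R > 0, ∀ t ≥ R, q t = 0 := by
      obtain ⟨r, hr⟩ := hqc.isCompact.isBounded.subset_closedBall 0
      refine ⟨max (r + 1) 1, by positivity, fun t ht =>
        image_eq_zero_of_notMem_tsupport fun hm => ?_⟩
      have h1 := hr hm
      rw [Metric.mem_closedBall, dist_zero_right, Real.norm_eq_abs] at h1
      linarith [le_abs_self t, le_max_left (r + 1) 1]
    set I := ∫ t in (0 : ℝ)..R, q t with hI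
    -- For t ≤ R, z(t) is the integral of q from t to R. The test function p = e^{st} z satisfies
    -- -p' + s p = e^{st} q, so the weak equation says that e^{st} y - y₀ annihilates every q.
    set z : ℝ → ℝ := fun t => I - ∫ x in (0 : ℝ)..t, q x with hz
    have hzd : ∀ t, HasDerivAt z (-q t) t := fun t => by
      have := intervalIntegral.integral_hasDerivAt_right (hqi 0 t)
        (hq.continuous.stronglyMeasurableAtFilter _ _) hq.continuous.continuousAt
      exact this.const_sub I
    have hzc : ContDiff ℝ ∞ z := by
      rw [contDiff_infty_iff_deriv, show deriv z = fun t => -q t from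
        funext fun t => (hzd t).deriv]
      exact ⟨fun t => (hzd t).differentiableAt, hq.neg⟩
    have hz0 : ∀ t ≥ R, z t = 0 := fun t ht => by
      simp only [hz, hI]
      rw [intervalIntegral.integral_interval_sub_left (hqi _ _) (hqi _ _)]
      refine intervalIntegral.integral_zero_ae (Filter.Eventually.of_forall fun x hx => hR x ?_)
      rw [uIoc_of_ge ht] at hx
      exact hx.1.le
    have hpd : ∀ t, HasDerivAt (fun t => exp (s * t) * z t)
        (s * exp (s * t) * z t - exp (s * t) * q t) t := fun t => by
      have := (((hasDerivAt_id t).const_mul s).exp).mul (hzd t)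
      refine this.congr_deriv ?_
      simp only [id]; ring
    have h1 := h (fun t => exp (s * t) * z t) (by fun_prop) ⟨R, fun t ht => by
      rw [hz0 t ht, mul_zero]⟩
    have e1 : ∀ t, -(y t * deriv (fun t => exp (s * t) * z t) t) + s * y t * (exp (s * t) * z t) =
        q t * (exp (s * t) * y t) := fun t => by
      rw [(hpd t).deriv]; ring
    simp_rw [e1] at h1
    have e2 : z 0 = I := by simp [hz]
    rw [mul_zero, exp_zero, one_mul, e2] at h1
    have hq0 : ∀ t, t ∉ Ioo 0 R → q t = 0 := fun t ht => by
      by_cases h2 : 0 < t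
      · exact hR t (not_lt.1 fun h3 => ht ⟨h2, h3⟩)
      · exact image_eq_zero_of_notMem_tsupport fun h3 => h2 (hqs h3)
    have e3 : ∀ F : ℝ → ℝ, ∫ t, q t • F t = ∫ t in Ioo 0 R, q t * F t := fun F => by
      refine (setIntegral_eq_integral_of_forall_compl_eq_zero fun t ht => ?_).symm
      rw [hq0 t ht, zero_smul]
    have e4 : ∫ t in Ioi 0, q t * (exp (s * t) * y t) =
        ∫ t in Ioo 0 R, q t * (exp (s * t) * y t) := by
      rw [← setIntegral_eq_of_subset_of_forall_sdiff_eq_zero measurableSet_Ioi Ioo_subset_Ioi_self]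
      intro t ht
      rw [hq0 t ht.2, zero_mul]
    have e5 : I = ∫ t in Ioo 0 R, q t := by
      rw [hI, intervalIntegral.integral_of_le hR0.le, integral_Ioc_eq_integral_Ioo]
    rw [e3]
    simp_rw [mul_sub]
    rw [integral_sub, ← e4, h1, e5, ← integral_mul_const, sub_self]
    · have := integrable_mul_continuous (L := R) (hy R hR0) (hq.continuous.mul hE)
      refine this.congr (Filter.Eventually.of_forall fun t => ?_)
      simp only [Pi.mul_apply]; ring
    · exact (((hqi 0 R).mul_const y₀).1).mono_set Ioo_subset_Ioc_self
  rw [ae_restrict_iff' measurableSet_Ioi]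
  filter_upwards [key] with t ht h0
  have h1 := ht h0
  rw [neg_mul, exp_neg, ← div_eq_mul_inv, eq_div_iff (exp_pos _).ne']
  linarith

/-- The `H¹` norm in terms of the weak derivative. -/
theorem sobolevNorm_one_sq {L : ℝ} (hL : 0 < L) {f : ℝ → ℝ} (hf : MemSobolev 1 L f) :
    sobolevNorm 1 L f ^ 2 = ENNReal.ofReal
      (innerL2 L f f + innerL2 L (weakDeriv L 1 f) (weakDeriv L 1 f)) := by
  rw [sobolevNorm_sq hL hf.1 (g := fun i => weakDeriv L i f) (fun i hi => hf.memLp_weakDeriv hi)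
    (fun i hi => hf.hasWeakDeriv hi), Finset.sum_range_succ, Finset.sum_range_one]
  have := weakDeriv_ae_eq hL hf.1 (hasWeakDeriv_zero L f)
  rw [innerL2_congr hL this this]

section WeakSolution

variable {L ν α : ℝ} {g : (ℝ → ℝ) → ℝ} {u₀ : ℝ → ℝ} {u : ℝ → ℝ → ℝ}

theorem IsWeakSolution.aestronglyMeasurable_coeff (hL : 0 < L)
    (hu : IsWeakSolution L ν α g u₀ u) (m : ℕ) :
    AEStronglyMeasurable (fun t => innerL2 L (e L (m + 1)) (u t)) (volume.restrict (Ioi 0)) := by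
  have h1 := hu.measurable
  rw [Measure.volume_eq_prod, ← Measure.prod_restrict] at h1
  have h2 : AEStronglyMeasurable (fun p : ℝ × ℝ => e L (m + 1) p.2 * u p.1 p.2)
      ((volume.restrict (Ioi (0 : ℝ))).prod (volume.restrict (Ioo 0 L))) :=
    ((continuous_e L (m + 1)).comp continuous_snd).aestronglyMeasurable.mul h1
  have h3 := h2.integral_prod_right'
  simp only [innerL2, intervalIntegral_eq_vol hL]
  exact h3

theorem IsWeakSolution.integrableOn_coeff (hL : 0 < L)
    (hu : IsWeakSolution L ν α g u₀ u) (m : ℕ) {T : ℝ} (hT : 0 < T) :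
    IntegrableOn (fun t => innerL2 L (e L (m + 1)) (u t)) (Ioo 0 T) := by
  refine ⟨(hu.aestronglyMeasurable_coeff hL m).mono_measure
    (Measure.restrict_mono Ioo_subset_Ioi_self le_rfl), ?_⟩
  -- Square integrability in time gives integrability on a bounded interval through √A ≤ 1 + A.
  have h1 : ∫⁻ t in Ioo 0 T, (1 + sobolevNorm 1 L (u t) ^ 2) < ⊤ := by
    rw [lintegral_add_left measurable_const]
    refine ENNReal.add_lt_top.2 ⟨?_, hu.sq_integrable T hT⟩
    simp
  refine lt_of_le_of_lt (lintegral_mono_ae ?_) h1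
  have h2 : ∀ᵐ t ∂volume.restrict (Ioo 0 T), MemSobolev 1 L (u t) :=
    ae_mono (Measure.restrict_mono Ioo_subset_Ioi_self le_rfl) hu.memSobolev
  filter_upwards [h2] with t ht
  rw [sobolevNorm_one_sq hL ht, ← ENNReal.ofReal_one, ← ENNReal.ofReal_add zero_le_one
    (add_nonneg (innerL2_self_nonneg hL _) (innerL2_self_nonneg hL _)), Real.enorm_eq_ofReal_abs]
  refine ENNReal.ofReal_le_ofReal ?_
  have h3 := abs_innerL2_le hL (memLp_vol_of_continuous (continuous_e L (m + 1)) 2) ht.1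
  rw [innerL2_e hL, if_pos rfl, Real.sqrt_one, one_mul] at h3
  have h4 := Real.sq_sqrt (innerL2_self_nonneg hL (u t))
  nlinarith [sq_nonneg (√(innerL2 L (u t) (u t)) - 1), innerL2_self_nonneg hL (weakDeriv L 1 (u t)),
    Real.sqrt_nonneg (innerL2 L (u t) (u t))]

theorem IsWeakSolution.integrableOn_coeff_mul (hL : 0 < L)
    (hu : IsWeakSolution L ν α g u₀ u) (m : ℕ) {q : ℝ → ℝ} (hq : Continuous q) {T : ℝ}
    (hT : ∀ t ≥ T, q t = 0) :
    IntegrableOn (fun t => innerL2 L (e L (m + 1)) (u t) * q t) (Ioi 0) := by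
  set R := max T 1
  have hR : 0 < R := by positivity
  have h1 := integrable_mul_continuous (L := R) (hu.integrableOn_coeff hL m hR) hq
  rw [vol] at h1
  refine IntegrableOn.of_forall_sdiff_eq_zero h1 measurableSet_Ioi fun t ht => ?_
  have : R ≤ t := not_lt.1 fun h => ht.2 ⟨ht.1, h⟩
  rw [hT t ((le_max_left _ _).trans this), mul_zero]

/-- The equation satisfied by a sine coefficient of a weak solution. -/
theorem IsWeakSolution.coeff_equation (hL : 0 < L)
    (hu : IsWeakSolution L ν α g u₀ u) (m : ℕ) {p : ℝ → ℝ} (hp : ContDiff ℝ ∞ p) {T : ℝ}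
    (hT : ∀ t ≥ T, p t = 0) :
    ∫ t in Ioi 0, (-(innerL2 L (e L (m + 1)) (u t) * deriv p t) +
      ((ν * eigenvalue L (m + 1) - α) * innerL2 L (e L (m + 1)) (u t) +
        ν * (g (u t) * (freq L (m + 1) * cosMode L (m + 1) L))) * p t) =
      p 0 * innerL2 L (e L (m + 1)) u₀ := by
  have hec : ContDiff ℝ ∞ (e L (m + 1)) := by unfold e; fun_prop
  have h1 := hu.weak_form (fun t x => p t * e L (m + 1) x) (by fun_prop)
    (fun t => by rw [e_zero_right, mul_zero]) (fun t => by rw [e_length hL, mul_zero])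
    ⟨T, fun t ht x => by rw [hT t ht, zero_mul]⟩
  have hpd : ∀ t, HasDerivAt p (deriv p t) t := fun t =>
    ((hp.differentiable (by simp)) t).hasDerivAt
  have hR : ∫ x in (0 : ℝ)..L, u₀ x * (p 0 * e L (m + 1) x) = p 0 * innerL2 L (e L (m + 1)) u₀ := by
    rw [innerL2, ← intervalIntegral.integral_const_mul]
    congr 1; ext x; ring
  rw [hR] at h1
  rw [← h1]
  refine integral_congr_ae ?_
  filter_upwards [hu.memSobolev, hu.boundary] with t ht hb
  have hi := integrable_of_memLp_two ht.1
  have hwi := integrable_of_memLp_two (ht.memLp_weakDeriv le_rfl)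
  have hcosd : deriv (cosMode L (m + 1)) = fun x => -(freq L (m + 1) * e L (m + 1) x) :=
    funext fun x => (hasDerivAt_cosMode L (m + 1) x).deriv
  -- The test function vanishes at x = L but its space derivative, a cosine, does not. Integrating
  -- by parts in space therefore produces the boundary term with g(u(t)).
  have h2 := integral_weakDeriv_mul hL hwi (ht.hasWeakDeriv le_rfl) hb
    (η := cosMode L (m + 1)) (by unfold cosMode; fun_prop)
  rw [hcosd] at h2
  have i1 : IntervalIntegrable (fun x => u t x * e L (m + 1) x) volume 0 L :=
    (integrable_vol_iff hL _).1 (integrable_mul_continuous hi (continuous_e L (m + 1)))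
  have i2 : IntervalIntegrable (fun x => weakDeriv L 1 (u t) x * cosMode L (m + 1) x) volume 0 L :=
    (integrable_vol_iff hL _).1 (integrable_mul_continuous hwi (continuous_cosMode L (m + 1)))
  have e1 : ∀ x, -(u t x * deriv (fun s => p s * e L (m + 1) x) t) +
      ν * (weakDeriv L 1 (u t) x * deriv (fun x => p t * e L (m + 1) x) x) -
      α * (u t x * (p t * e L (m + 1) x)) =
      (-(deriv p t) - α * p t) * (u t x * e L (m + 1) x) +
      (ν * p t * freq L (m + 1)) * (weakDeriv L 1 (u t) x * cosMode L (m + 1) x) := fun x => by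
    rw [((hpd t).mul_const _).deriv, ((hasDerivAt_e L (m + 1) x).const_mul (p t)).deriv]
    ring
  have e2 : ∀ x, u t x * -(freq L (m + 1) * e L (m + 1) x) =
      -freq L (m + 1) * (u t x * e L (m + 1) x) := fun x => by ring
  simp_rw [e2, intervalIntegral.integral_const_mul] at h2
  simp_rw [e1]
  rw [intervalIntegral.integral_add (i1.const_mul _) (i2.const_mul _),
    intervalIntegral.integral_const_mul, intervalIntegral.integral_const_mul, h2, innerL2_comm,
    eigenvalue_eq]
  simp only [innerL2]
  ring

end WeakSolution

/-- The decay rates of the modes of the closed loop. -/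
noncomputable def rate (L κ : ℝ) (N : ℕ) (ν α : ℝ) (n : ℕ) : ℝ := ν * theta L κ N n - α

/-- The coefficients at time `t` of the solution of the closed loop. -/
noncomputable def decayCoeff (L κ : ℝ) (N : ℕ) (ν α : ℝ) (a : ℕ → ℝ) (t : ℝ) (n : ℕ) : ℝ :=
  a n * exp (-rate L κ N ν α n * t)

theorem exp_neg_le_two_div_sq {x : ℝ} (hx : 0 < x) : exp (-x) ≤ 2 / x ^ 2 := by
  rw [exp_neg, inv_eq_one_div, div_le_div_iff₀ (exp_pos _) (by positivity)]
  nlinarith [Real.quadratic_le_exp_of_nonneg hx.le]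

theorem summable_inv_eigenvalue (L : ℝ) : Summable fun n => (eigenvalue L (n + 1))⁻¹ := by
  have h := ((summable_nat_add_iff 1).2 (Real.summable_nat_pow_inv (p := 2).2
    (by norm_num))).mul_left
    ((L / π) ^ 2)
  refine h.congr fun n => ?_
  rw [eigenvalue_eq, freq]
  rw [div_pow, div_pow, inv_div, mul_pow, div_mul_eq_mul_div, div_eq_mul_inv, div_eq_mul_inv,
    mul_inv]
  ring

/-- Instant smoothing: for t > 0 the factor exp(-νλt) ≤ 2/(νλt)² beats the weight λ and leaves a
multiple of 1/λ, which is summable. Merely square summable data then allow two term-by-term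
derivatives. -/
theorem summable_decayCoeff_mul_eigenvalue {L κ : ℝ} (hL : 0 < L) (hκ : 0 < κ) (N : ℕ) {ν : ℝ}
    (hν : 0 < ν) (α : ℝ) {a : ℕ → ℝ} (ha : Summable fun n => a n ^ 2) {t : ℝ} (ht : 0 < t) :
    Summable fun n => |decayCoeff L κ N ν α a t n| * eigenvalue L (n + 1) := by
  obtain ⟨A, hA⟩ : ∃ A, ∀ n, |a n| ≤ A := by
    refine ⟨∑' n, a n ^ 2 + 1, fun n => ?_⟩
    have := ha.le_tsum n fun m _ => sq_nonneg _
    rw [← sq_abs] at this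
    nlinarith [sq_nonneg (|a n| - 1)]
  refine Summable.of_nonneg_of_le (fun n => mul_nonneg (abs_nonneg _) (eigenvalue_pos hL n).le)
    (fun n => ?_) ((summable_inv_eigenvalue L).mul_left (A * exp (α * t) * (2 / (ν * t) ^ 2)))
  have hl := eigenvalue_pos hL n
  have h1 := exp_neg_le_two_div_sq (x := ν * t * eigenvalue L (n + 1)) (by positivity)
  have h2 : exp (-rate L κ N ν α n * t) ≤ exp (α * t) * exp (-(ν * t * eigenvalue L (n + 1))) := by
    rw [← exp_add, exp_le_exp, rate]
    have := mul_le_mul_of_nonneg_left (eigenvalue_le_theta hκ L N n) (mul_pos hν ht).le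
    linarith
  rw [decayCoeff, abs_mul, abs_of_pos (exp_pos _)]
  calc |a n| * exp (-rate L κ N ν α n * t) * eigenvalue L (n + 1)
      ≤ A * (exp (α * t) * (2 / (ν * t * eigenvalue L (n + 1)) ^ 2)) * eigenvalue L (n + 1) := by
        refine mul_le_mul_of_nonneg_right ?_ hl.le
        refine mul_le_mul (hA n) (h2.trans ?_) (exp_pos _).le ((abs_nonneg _).trans (hA n))
        exact mul_le_mul_of_nonneg_left h1 (exp_pos _).le
    _ = A * exp (α * t) * (2 / (ν * t) ^ 2) * (eigenvalue L (n + 1))⁻¹ := by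
        field_simp

theorem eigenvalue_le_eigenvalue {L : ℝ} (hL : 0 < L) {m n : ℕ} (h : m ≤ n) :
    eigenvalue L m ≤ eigenvalue L n := by
  unfold eigenvalue; gcongr

theorem summable_abs_decayCoeff {L κ : ℝ} (hL : 0 < L) (hκ : 0 < κ) (N : ℕ) {ν : ℝ}
    (hν : 0 < ν) (α : ℝ) {a : ℕ → ℝ} (ha : Summable fun n => a n ^ 2) {t : ℝ} (ht : 0 < t) :
    Summable fun n => |decayCoeff L κ N ν α a t n| := by
  refine Summable.of_nonneg_of_le (fun n => abs_nonneg _) (fun n => ?_)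
    ((summable_decayCoeff_mul_eigenvalue hL hκ N hν α ha ht).mul_right (eigenvalue L (0 + 1))⁻¹)
  rw [mul_assoc]
  refine le_mul_of_one_le_right (abs_nonneg _) ?_
  rw [← div_eq_mul_inv, one_le_div (eigenvalue_pos hL 0)]
  exact eigenvalue_le_eigenvalue hL (by omega)

section

variable {L κ ν α : ℝ} {N : ℕ} {g : (ℝ → ℝ) → ℝ} {u₀ : ℝ → ℝ} {u : ℝ → ℝ → ℝ}

/-- Green's formula turns the boundary forcing into the differences θ_j - λ_{m+1}. The part with
λ_{m+1} joins the residual in the first bracket, and the part with θ_j gives the closed-loop rates.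
The residual vanishes for m < N. -/
theorem mode_forcing_eq (hL : 0 < L) (hκ : 0 < κ)
    (hg : ∀ f, g f = ∑ j : Fin N, lowModes L κ N f j * loopMode L κ N j L) (f : ℝ → ℝ) (m : ℕ) :
    (ν * eigenvalue L (m + 1) - α) * innerL2 L (e L (m + 1)) f +
        ν * (g f * (freq L (m + 1) * cosMode L (m + 1) L)) =
      (ν * eigenvalue L (m + 1) - α) * (innerL2 L (e L (m + 1)) f - ∑ j : Fin N,
        innerL2 L (e L (m + 1)) (loopMode L κ N j) * lowModes L κ N f j) +
      ∑ j : Fin N, innerL2 L (e L (m + 1)) (loopMode L κ N j) *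
        (rate L κ N ν α j * lowModes L κ N f j) := by
  have h1 : g f * (freq L (m + 1) * cosMode L (m + 1) L) = ∑ j : Fin N,
      (theta L κ N j - eigenvalue L (m + 1)) *
        (innerL2 L (e L (m + 1)) (loopMode L κ N j) * lowModes L κ N f j) := by
    rw [hg, Finset.sum_mul]
    refine Finset.sum_congr rfl fun j _ => ?_
    rw [mul_assoc, loopMode_boundary hL hκ]; ring
  have h2 : ∑ j : Fin N, innerL2 L (e L (m + 1)) (loopMode L κ N j) *
        (rate L κ N ν α j * lowModes L κ N f j) =
      ν * ∑ j : Fin N, (theta L κ N j - eigenvalue L (m + 1)) *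
        (innerL2 L (e L (m + 1)) (loopMode L κ N j) * lowModes L κ N f j) +
      (ν * eigenvalue L (m + 1) - α) * ∑ j : Fin N,
        innerL2 L (e L (m + 1)) (loopMode L κ N j) * lowModes L κ N f j := by
    rw [Finset.mul_sum, Finset.mul_sum, ← Finset.sum_add_distrib]
    exact Finset.sum_congr rfl fun j _ => by rw [rate]; ring
  rw [h1, h2]; ring

theorem IsWeakSolution.integrableOn_lowModes_mul (hL : 0 < L)
    (hu : IsWeakSolution L ν α g u₀ u) (i : Fin N) {q : ℝ → ℝ} (hq : Continuous q) {T : ℝ}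
    (hT : ∀ t ≥ T, q t = 0) :
    IntegrableOn (fun t => lowModes L κ N (u t) i * q t) (Ioi 0) := by
  simp only [lowModes, Matrix.mulVec, dotProduct, Finset.sum_mul, mul_assoc]
  exact integrable_finsetSum _ fun j _ => (hu.integrableOn_coeff_mul hL j hq hT).const_mul _

/-- The shift by 1 ensures that p vanishes in a full neighbourhood of t. -/
theorem deriv_eq_zero_of_eventually_zero {p : ℝ → ℝ} {T : ℝ} (hT : ∀ t ≥ T, p t = 0) :
    ∀ t ≥ T + 1, deriv p t = 0 := fun t ht => by
  have : p =ᶠ[nhds t] fun _ => 0 := by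
    filter_upwards [Ioi_mem_nhds (show T < t by linarith)] with s hs
    exact hT s (le_of_lt hs)
  rw [this.deriv_eq, deriv_const]

/-- The first `N` modes of the backstepping transform of a weak solution. -/
theorem IsWeakSolution.lowModes_equation (hL : 0 < L) (hκ : 0 < κ) (hG : IsUnit (gram L κ N))
    (hg : ∀ f, g f = ∑ j : Fin N, lowModes L κ N f j * loopMode L κ N j L)
    (hu : IsWeakSolution L ν α g u₀ u) (i : Fin N) {p : ℝ → ℝ} (hp : ContDiff ℝ ∞ p) {T : ℝ}
    (hT : ∀ t ≥ T, p t = 0) :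
    ∫ t in Ioi 0, (-(lowModes L κ N (u t) i * deriv p t) +
      rate L κ N ν α i * lowModes L κ N (u t) i * p t) = p 0 * lowModes L κ N u₀ i := by
  have hpc : Continuous (deriv p) := hp.continuous_deriv (by simp)
  have hT' := deriv_eq_zero_of_eventually_zero hT
  have h1 := fun k : Fin N => hu.coeff_equation hL k hp hT
  -- With the residuals gone, the first N equations read as `gram` applied to a diagonal system;
  -- combining them with the rows of the inverse matrix decouples it.
  simp_rw [mode_forcing_eq hL hκ hg, gram_mulVec_lowModes hG, sub_self, mul_zero, zero_add] at h1
  have hi : ∀ k : Fin N, IntegrableOn (fun t => -(innerL2 L (e L (k + 1)) (u t) * deriv p t) +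
      (∑ j : Fin N, innerL2 L (e L (k + 1)) (loopMode L κ N j) *
        (rate L κ N ν α j * lowModes L κ N (u t) j)) * p t) (Ioi 0) := fun k => by
    refine (hu.integrableOn_coeff_mul hL k hpc hT').neg.add ?_
    simp only [Finset.sum_mul, mul_assoc]
    exact integrable_finsetSum _ fun j _ =>
      ((hu.integrableOn_lowModes_mul hL j hp.continuous hT).const_mul _).const_mul _
  have h2 : ∑ k : Fin N, (gram L κ N)⁻¹ i k * (p 0 * innerL2 L (e L (k + 1)) u₀) =
      p 0 * lowModes L κ N u₀ i := by
    rw [lowModes, Matrix.mulVec, dotProduct, Finset.mul_sum]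
    exact Finset.sum_congr rfl fun k _ => by ring
  rw [← h2]
  simp_rw [← h1, ← integral_const_mul]
  rw [← integral_finsetSum _ fun k _ => (hi k).const_mul _]
  congr 1; ext t
  have hinv : (gram L κ N)⁻¹ * gram L κ N = 1 :=
    Matrix.nonsing_inv_mul _ ((Matrix.isUnit_iff_isUnit_det _).1 hG)
  have h3 : ∑ k : Fin N, (gram L κ N)⁻¹ i k * ∑ j : Fin N,
      innerL2 L (e L (k + 1)) (loopMode L κ N j) * (rate L κ N ν α j * lowModes L κ N (u t) j) =
      rate L κ N ν α i * lowModes L κ N (u t) i := by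
    have : (gram L κ N)⁻¹.mulVec ((gram L κ N).mulVec
        fun j : Fin N => rate L κ N ν α j * lowModes L κ N (u t) j) =
        fun j : Fin N => rate L κ N ν α j * lowModes L κ N (u t) j := by
      rw [Matrix.mulVec_mulVec, hinv, Matrix.one_mulVec]
    exact congrFun this i
  have h4 : ∑ k : Fin N, (gram L κ N)⁻¹ i k * innerL2 L (e L (k + 1)) (u t) =
      lowModes L κ N (u t) i := rfl
  rw [← h3, ← h4, Finset.sum_mul, Finset.sum_mul, ← Finset.sum_neg_distrib,
    ← Finset.sum_add_distrib]
  exact Finset.sum_congr rfl fun k _ => by ring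

theorem IsWeakSolution.lowModes_ae_eq (hL : 0 < L) (hκ : 0 < κ) (hG : IsUnit (gram L κ N))
    (hg : ∀ f, g f = ∑ j : Fin N, lowModes L κ N f j * loopMode L κ N j L)
    (hu : IsWeakSolution L ν α g u₀ u) (i : Fin N) :
    ∀ᵐ t ∂volume.restrict (Ioi 0), lowModes L κ N (u t) i =
      decayCoeff L κ N ν α (loopCoeff L κ N u₀) t i := by
  simp only [decayCoeff, loopCoeff_fin hG]
  refine ae_eq_exp_of_weak_ode (fun T hT => ?_) fun p hp ⟨T, hT⟩ =>
    hu.lowModes_equation hL hκ hG hg i hp hT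
  simp only [lowModes, Matrix.mulVec, dotProduct]
  exact integrable_finsetSum _ fun j _ => (hu.integrableOn_coeff hL j hT).const_mul _

/-- Subtracting from the m-th equation the low-mode equations with weights (e_{m+1}, Q_j) removes
all forcing, so the residual solves a scalar equation of its own. -/
theorem IsWeakSolution.highModes_ae_eq (hL : 0 < L) (hκ : 0 < κ) (hG : IsUnit (gram L κ N))
    (hg : ∀ f, g f = ∑ j : Fin N, lowModes L κ N f j * loopMode L κ N j L)
    (hu : IsWeakSolution L ν α g u₀ u) {m : ℕ} (hm : N ≤ m) :
    ∀ᵐ t ∂volume.restrict (Ioi 0), innerL2 L (e L (m + 1)) (u t) - ∑ j : Fin N,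
      innerL2 L (e L (m + 1)) (loopMode L κ N j) * lowModes L κ N (u t) j =
      decayCoeff L κ N ν α (loopCoeff L κ N u₀) t m := by
  have hrate : rate L κ N ν α m = ν * eigenvalue L (m + 1) - α := by
    rw [rate, theta_of_le L κ hm]
  have ha : loopCoeff L κ N u₀ m = innerL2 L (e L (m + 1)) u₀ - ∑ j : Fin N,
      innerL2 L (e L (m + 1)) (loopMode L κ N j) * lowModes L κ N u₀ j := by
    rw [loopCoeff]
    congr 1
    refine Finset.sum_congr rfl fun j _ => ?_
    rw [if_neg (by have := j.2; omega), sub_zero, mul_comm]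
  refine ae_eq_exp_of_weak_ode (fun T hT => ?_) fun p hp ⟨T, hT⟩ => ?_
  · refine (hu.integrableOn_coeff hL m hT).sub (integrable_finsetSum _ fun j _ => ?_)
    refine Integrable.const_mul ?_ _
    simp only [lowModes, Matrix.mulVec, dotProduct]
    exact integrable_finsetSum _ fun j _ => (hu.integrableOn_coeff hL j hT).const_mul _
  have hpc : Continuous (deriv p) := hp.continuous_deriv (by simp)
  have hT' := deriv_eq_zero_of_eventually_zero hT
  have h1 := hu.coeff_equation hL m hp hT
  have h2 := fun i => hu.lowModes_equation hL hκ hG hg i hp hT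
  simp_rw [mode_forcing_eq hL hκ hg] at h1
  have il : ∀ j : Fin N, IntegrableOn (fun t => -(lowModes L κ N (u t) j * deriv p t) +
      rate L κ N ν α j * lowModes L κ N (u t) j * p t) (Ioi 0) := fun j => by
    refine (hu.integrableOn_lowModes_mul hL j hpc hT').neg.add ?_
    simp only [mul_assoc]
    exact (hu.integrableOn_lowModes_mul hL j hp.continuous hT).const_mul _
  have iu : IntegrableOn (fun t => -(innerL2 L (e L (m + 1)) (u t) * deriv p t) +
      ((ν * eigenvalue L (m + 1) - α) * (innerL2 L (e L (m + 1)) (u t) - ∑ j : Fin N,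
        innerL2 L (e L (m + 1)) (loopMode L κ N j) * lowModes L κ N (u t) j) +
      ∑ j : Fin N, innerL2 L (e L (m + 1)) (loopMode L κ N j) *
        (rate L κ N ν α j * lowModes L κ N (u t) j)) * p t) (Ioi 0) := by
    refine (hu.integrableOn_coeff_mul hL m hpc hT').neg.add ?_
    generalize ν * eigenvalue L (m + 1) - α = s
    simp only [add_mul, mul_assoc, sub_mul, Finset.sum_mul]
    refine Integrable.add (Integrable.const_mul (Integrable.sub ?_ ?_) _) ?_
    · exact hu.integrableOn_coeff_mul hL m hp.continuous hT
    · exact integrable_finsetSum _ fun j _ =>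
        (hu.integrableOn_lowModes_mul hL j hp.continuous hT).const_mul _
    · exact integrable_finsetSum _ fun j _ =>
        ((hu.integrableOn_lowModes_mul hL j hp.continuous hT).const_mul _).const_mul _
  rw [ha, mul_sub, ← h1, Finset.mul_sum]
  simp_rw [mul_left_comm (p 0), ← h2, ← integral_const_mul]
  rw [← integral_finsetSum _ fun j _ => (il j).const_mul _,
    ← integral_sub iu (integrable_finsetSum _ fun j _ => (il j).const_mul _)]
  congr 1; ext t
  rw [hrate]
  simp only [mul_add, Finset.sum_add_distrib, mul_neg, Finset.sum_neg_distrib, ← mul_assoc,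
    ← Finset.sum_mul]
  ring

/-- A weak solution is the series of eigenfunctions of the closed loop. -/
theorem IsWeakSolution.ae_eq_loopSeries (hL : 0 < L) (hκ : 0 < κ) (hν : 0 < ν)
    (hG : IsUnit (gram L κ N))
    (hg : ∀ f, g f = ∑ j : Fin N, lowModes L κ N f j * loopMode L κ N j L)
    (ha : Summable fun n => loopCoeff L κ N u₀ n ^ 2) (hu : IsWeakSolution L ν α g u₀ u) :
    ∀ᵐ t ∂volume.restrict (Ioi 0), u t =ᵐ[vol L]
      loopSeries L κ N (decayCoeff L κ N ν α (loopCoeff L κ N u₀) t) := by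
  have h1 : ∀ᵐ t ∂volume.restrict (Ioi 0), ∀ i : Fin N, lowModes L κ N (u t) i =
      decayCoeff L κ N ν α (loopCoeff L κ N u₀) t i :=
    ae_all_iff.2 fun i => hu.lowModes_ae_eq hL hκ hG hg i
  have h2 : ∀ᵐ t ∂volume.restrict (Ioi 0), ∀ m : ℕ, N ≤ m → innerL2 L (e L (m + 1)) (u t) -
      ∑ j : Fin N, innerL2 L (e L (m + 1)) (loopMode L κ N j) * lowModes L κ N (u t) j =
      decayCoeff L κ N ν α (loopCoeff L κ N u₀) t m :=
    ae_all_iff.2 fun m => by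
      by_cases hm : N ≤ m
      · filter_upwards [hu.highModes_ae_eq hL hκ hG hg hm] with t ht _ using ht
      · exact Filter.Eventually.of_forall fun t h => absurd h hm
  filter_upwards [h1, h2, hu.memSobolev, ae_restrict_mem measurableSet_Ioi] with t h1 h2 hm ht
  set c := decayCoeff L κ N ν α (loopCoeff L κ N u₀) t with hc
  have hcs : Summable fun n => |c n| := summable_abs_decayCoeff hL hκ N hν α ha ht
  have hS := memLp_vol_of_continuous (L := L) (continuous_loopSeries hL hκ N hcs) 2
  -- All sine coefficients of u(t) and of the series agree: by the matrix system for m < N, by the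
  -- residual formula for m ≥ N. Completeness of the sines concludes.
  have h3 := ae_eq_zero_of_innerL2_e hL (integrable_of_memLp_two (hm.1.sub hS)) fun m => by
    have he := memLp_vol_of_continuous (L := L) (continuous_e L (m + 1)) 2
    have h4 := innerL2_sub_left hL hm.1 hS he
    refine h4.trans ?_
    rw [sub_eq_zero, innerL2_comm, innerL2_comm L _ (e L _), innerL2_e_loopSeries hL hκ N hcs]
    simp_rw [mul_sub, Finset.sum_sub_distrib]
    rcases lt_or_ge m N with hmN | hmN
    · have h5 := gram_mulVec_lowModes hG (u t) ⟨m, hmN⟩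
      have h6 : ∑ i : Fin N, c i * (if m = i then 1 else 0) = c m := by
        rw [Finset.sum_eq_single ⟨m, hmN⟩]
        · simp
        · intro j _ hj
          rw [if_neg (fun h => hj (Fin.ext h.symm)), mul_zero]
        · simp
      rw [h6, ← h5]
      simp only [h1, mul_comm]
      ring
    · have h5 := h2 m hmN
      have h6 : ∑ i : Fin N, c i * (if m = i then 1 else 0) = 0 :=
        Finset.sum_eq_zero fun j _ => by
          rw [if_neg (by have := j.2; omega), mul_zero]
      rw [h6, ← h5]
      simp only [h1, mul_comm]
      ring
  filter_upwards [h3] with x hx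
  simpa [sub_eq_zero] using hx

end

/-! ### Regularity of the series in space and its integrability in time. -/

/-- The solution of the closed loop with coefficients `a` at time zero. -/
noncomputable def loopSolution (L κ : ℝ) (N : ℕ) (ν α : ℝ) (a : ℕ → ℝ) (t : ℝ) : ℝ → ℝ :=
  loopSeries L κ N (decayCoeff L κ N ν α a t)

section Spatial

variable {L κ : ℝ} {N : ℕ} {c : ℕ → ℝ}

theorem hasWeakDeriv_one_loopSeries (hL : 0 < L) (hκ : 0 < κ) (h0 : Summable fun n => |c n|)
    (h1 : Summable fun n => |c n| * eigenvalue L (n + 1)) :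
    HasWeakDeriv L 1 (loopSeries L κ N c) (loopSeries' L κ N c) :=
  hasWeakDeriv_one (hasDerivAt_loopSeries hL hκ N h0 h1) (continuous_loopSeries' hL κ N h0 h1)

theorem hasWeakDeriv_two_loopSeries (hL : 0 < L) (hκ : 0 < κ) (h0 : Summable fun n => |c n|)
    (h1 : Summable fun n => |c n| * eigenvalue L (n + 1)) :
    HasWeakDeriv L 2 (loopSeries L κ N c)
      (fun x => -loopSeries L κ N (fun n => c n * theta L κ N n) x) :=
  (hasWeakDeriv_one_loopSeries hL hκ h0 h1).succ
    (hasWeakDeriv_one (hasDerivAt_loopSeries' hL hκ N h0 h1)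
      (continuous_loopSeries hL hκ N (summable_theta_mul hL hκ N h0 h1)).neg)

/-- The derivatives of orders `0`, `1`, `2` of `loopSeries`. -/
noncomputable def loopSeriesDeriv (L κ : ℝ) (N : ℕ) (c : ℕ → ℝ) : ℕ → ℝ → ℝ
  | 0 => loopSeries L κ N c
  | 1 => loopSeries' L κ N c
  | _ + 2 => fun x => -loopSeries L κ N (fun n => c n * theta L κ N n) x

/-- The weights of the `L²` norms of the derivatives. -/
noncomputable def loopWeight (L κ : ℝ) (N : ℕ) : ℕ → ℕ → ℝ
  | 0, _ => 1
  | 1, n => eigenvalue L (n + 1)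
  | _ + 2, n => theta L κ N n ^ 2

theorem loopWeight_nonneg (hL : 0 < L) (i n : ℕ) : 0 ≤ loopWeight L κ N i n := by
  match i with
  | 0 => exact zero_le_one
  | 1 => exact (eigenvalue_pos hL n).le
  | _ + 2 => exact sq_nonneg _

theorem continuous_loopSeriesDeriv (hL : 0 < L) (hκ : 0 < κ) (h0 : Summable fun n => |c n|)
    (h1 : Summable fun n => |c n| * eigenvalue L (n + 1)) (i : ℕ) :
    Continuous (loopSeriesDeriv L κ N c i) := by
  match i with
  | 0 => exact continuous_loopSeries hL hκ N h0
  | 1 => exact continuous_loopSeries' hL κ N h0 h1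
  | _ + 2 => exact (continuous_loopSeries hL hκ N (summable_theta_mul hL hκ N h0 h1)).neg

theorem hasWeakDeriv_loopSeriesDeriv (hL : 0 < L) (hκ : 0 < κ) (h0 : Summable fun n => |c n|)
    (h1 : Summable fun n => |c n| * eigenvalue L (n + 1)) {i : ℕ} (hi : i ≤ 2) :
    HasWeakDeriv L i (loopSeries L κ N c) (loopSeriesDeriv L κ N c i) := by
  interval_cases i
  · exact hasWeakDeriv_zero L _
  · exact hasWeakDeriv_one_loopSeries hL hκ h0 h1
  · exact hasWeakDeriv_two_loopSeries hL hκ h0 h1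

theorem innerL2_loopSeriesDeriv_le (hL : 0 < L) (hκ : 0 < κ) (h0 : Summable fun n => |c n|)
    (h1 : Summable fun n => |c n| * eigenvalue L (n + 1)) (i : ℕ) :
    innerL2 L (loopSeriesDeriv L κ N c i) (loopSeriesDeriv L κ N c i) ≤
      (2 + 16 * N) * ∑' n, loopWeight L κ N i n * c n ^ 2 := by
  match i with
  | 0 =>
    simp only [loopWeight, one_mul]
    exact innerL2_loopSeries_le hL hκ N h0
  | 1 => exact innerL2_loopSeries'_le hL κ N h0 h1
  | _ + 2 =>
    have h2 := innerL2_loopSeries_le hL hκ N (summable_theta_mul hL hκ N h0 h1)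
    simp only [mul_pow] at h2
    simp only [innerL2, loopSeriesDeriv, neg_mul_neg, loopWeight, mul_comm (theta L κ N _ ^ 2)]
    exact h2

theorem memSobolev_loopSeries (hL : 0 < L) (hκ : 0 < κ) (h0 : Summable fun n => |c n|)
    (h1 : Summable fun n => |c n| * eigenvalue L (n + 1)) {m : ℕ} (hm : m ≤ 2) :
    MemSobolev m L (loopSeries L κ N c) :=
  ⟨memLp_vol_of_continuous (continuous_loopSeries hL hκ N h0) _, fun i hi =>
    ⟨_, memLp_vol_of_continuous (continuous_loopSeriesDeriv hL hκ h0 h1 i) _,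
      hasWeakDeriv_loopSeriesDeriv hL hκ h0 h1 (hi.trans hm)⟩⟩

theorem sobolevNorm_loopSeries_sq_le (hL : 0 < L) (hκ : 0 < κ) (h0 : Summable fun n => |c n|)
    (h1 : Summable fun n => |c n| * eigenvalue L (n + 1)) {m : ℕ} (hm : m ≤ 2) :
    sobolevNorm m L (loopSeries L κ N c) ^ 2 ≤ ENNReal.ofReal
      ((2 + 16 * N) * ∑ i ∈ Finset.range (m + 1), ∑' n, loopWeight L κ N i n * c n ^ 2) := by
  rw [sobolevNorm_sq hL (memLp_vol_of_continuous (continuous_loopSeries hL hκ N h0) _)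
    (fun i _ => memLp_vol_of_continuous (continuous_loopSeriesDeriv hL hκ h0 h1 i) _)
    (fun i hi => hasWeakDeriv_loopSeriesDeriv hL hκ h0 h1 (hi.trans hm)), Finset.mul_sum]
  exact ENNReal.ofReal_le_ofReal (Finset.sum_le_sum fun i _ =>
    innerL2_loopSeriesDeriv_le hL hκ h0 h1 i)

/-- High modes are orthogonal to the first N sines, so `lowModes` reads off exactly the first N
coefficients. This is what makes the series meet the feedback boundary condition. -/
theorem lowModes_loopSeries (hL : 0 < L) (hκ : 0 < κ) (hG : IsUnit (gram L κ N))
    (h0 : Summable fun n => |c n|) (i : Fin N) :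
    lowModes L κ N (loopSeries L κ N c) i = c i := by
  have h1 : (fun m : Fin N => innerL2 L (e L (m + 1)) (loopSeries L κ N c)) =
      (gram L κ N).mulVec fun j : Fin N => c j := by
    ext m
    rw [innerL2_e_loopSeries hL hκ N h0]
    simp only [mul_sub, Finset.sum_sub_distrib, Fin.val_inj, mul_ite, mul_one, mul_zero,
      Finset.sum_ite_eq, Finset.mem_univ, if_true, Matrix.mulVec, dotProduct, gram, Matrix.of_apply]
    rw [add_sub_cancel]
    exact Finset.sum_congr rfl fun j _ => mul_comm _ _
  rw [lowModes, h1, Matrix.mulVec_mulVec,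
    Matrix.nonsing_inv_mul _ ((Matrix.isUnit_iff_isUnit_det _).1 hG), Matrix.one_mulVec]

theorem hasTraces_loopSeries (hL : 0 < L) (hκ : 0 < κ) (hG : IsUnit (gram L κ N))
    (h0 : Summable fun n => |c n|) :
    HasTraces L (loopSeries L κ N c) 0
      (∑ j : Fin N, lowModes L κ N (loopSeries L κ N c) j * loopMode L κ N j L) :=
  ⟨_, (continuous_loopSeries hL hκ N h0).continuousOn, Filter.EventuallyEq.rfl,
    loopSeries_zero L κ N c, by
      rw [loopSeries_length hL]
      exact Finset.sum_congr rfl fun j _ => by rw [lowModes_loopSeries hL hκ hG h0]⟩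

end Spatial

section Time

variable {L κ ν α r : ℝ} {N : ℕ} {a : ℕ → ℝ}

theorem decayCoeff_sq (L κ : ℝ) (N : ℕ) (ν α : ℝ) (a : ℕ → ℝ) (t : ℝ) (n : ℕ) :
    decayCoeff L κ N ν α a t n ^ 2 = a n ^ 2 * exp (-(2 * rate L κ N ν α n) * t) := by
  rw [decayCoeff, mul_pow, ← exp_nat_mul]
  congr 2; push_cast; ring

theorem tsum_mul_decayCoeff_sq_le {w : ℕ → ℝ} (hw : ∀ n, 0 ≤ w n)
    (hr : ∀ n, r ≤ rate L κ N ν α n) (ha : Summable fun n => w n * a n ^ 2) {t : ℝ} (ht : 0 < t) :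
    ∑' n, w n * decayCoeff L κ N ν α a t n ^ 2 ≤ exp (-(2 * r) * t) * ∑' n, w n * a n ^ 2 := by
  have h : ∀ n, w n * decayCoeff L κ N ν α a t n ^ 2 ≤ exp (-(2 * r) * t) * (w n * a n ^ 2) := by
    intro n
    rw [decayCoeff_sq, ← mul_assoc, mul_comm]
    refine mul_le_mul_of_nonneg_right ?_ (mul_nonneg (hw n) (sq_nonneg _))
    rw [exp_le_exp]
    nlinarith [hr n]
  rw [← tsum_mul_left]
  exact Summable.tsum_le_tsum h (Summable.of_nonneg_of_le
    (fun n => mul_nonneg (hw n) (sq_nonneg _)) h (ha.mul_left _)) (ha.mul_left _)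

theorem measurable_ofReal_decayCoeff_sq (w : ℕ → ℝ) (n : ℕ) :
    Measurable fun t => ENNReal.ofReal (w n * decayCoeff L κ N ν α a t n ^ 2) := by
  have : Continuous fun t => w n * decayCoeff L κ N ν α a t n ^ 2 := by
    unfold decayCoeff; fun_prop
  exact this.measurable.ennreal_ofReal

/-- Without summability the real `tsum` has the default value 0, and the inequality still holds. -/
theorem ofReal_tsum_le_tsum_ofReal {w : ℕ → ℝ} (hw : ∀ n, 0 ≤ w n) :
    ENNReal.ofReal (∑' n, w n) ≤ ∑' n, ENNReal.ofReal (w n) := by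
  by_cases hs : Summable w
  · rw [ENNReal.ofReal_tsum_of_nonneg hw hs]
  · rw [tsum_eq_zero_of_not_summable hs]; simp

/-- Time integration of exp(-2st) contributes 1/(2s) to the term of rate s; sum and integral are
interchanged by nonnegativity. -/
theorem lintegral_tsum_decayCoeff_sq_lt_top {w : ℕ → ℝ} (hw : ∀ n, 0 ≤ w n)
    (hr : ∀ n, 0 < rate L κ N ν α n)
    (ha : Summable fun n => w n * a n ^ 2 / rate L κ N ν α n) :
    ∫⁻ t in Ioi 0, ∑' n, ENNReal.ofReal (w n * decayCoeff L κ N ν α a t n ^ 2) < ⊤ := by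
  rw [lintegral_tsum fun n => ?_]
  · have h2 : ∀ n, ∫⁻ t in Ioi 0, ENNReal.ofReal (w n * decayCoeff L κ N ν α a t n ^ 2) =
        ENNReal.ofReal (w n * a n ^ 2 / rate L κ N ν α n * (1 / 2)) := by
      intro n
      have h3 : -(2 * rate L κ N ν α n) < 0 := by linarith [hr n]
      simp_rw [decayCoeff_sq, ← mul_assoc]
      rw [← ofReal_integral_eq_lintegral_ofReal ((integrableOn_exp_mul_Ioi h3 0).const_mul _),
        integral_const_mul, integral_exp_mul_Ioi h3]
      · congr 1
        have := (hr n).ne'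
        simp only [mul_zero, exp_zero]
        field_simp
      · exact Filter.Eventually.of_forall fun t =>
          mul_nonneg (mul_nonneg (hw n) (sq_nonneg _)) (exp_pos _).le
    simp_rw [h2]
    rw [← ENNReal.ofReal_tsum_of_nonneg (fun n => ?_) (ha.mul_right _)]
    · exact ENNReal.ofReal_lt_top
    · have := hr n
      have := hw n
      positivity
  · exact (measurable_ofReal_decayCoeff_sq w n).aemeasurable

/-- From νθ = rate + α and α ≤ (α/r) rate. -/
theorem theta_div_rate_le (hν : 0 < ν) (hα : 0 < α) (hr0 : 0 < r)
    (hr : ∀ n, r ≤ rate L κ N ν α n) (n : ℕ) :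
    theta L κ N n / rate L κ N ν α n ≤ (1 + α / r) / ν := by
  have h1 : α ≤ α / r * rate L κ N ν α n := by
    rw [div_mul_eq_mul_div, le_div_iff₀ hr0]
    exact mul_le_mul_of_nonneg_left (hr n) hα.le
  rw [div_le_iff₀ (hr0.trans_le (hr n)), div_mul_eq_mul_div, le_div_iff₀ hν]
  have h2 : rate L κ N ν α n = ν * theta L κ N n - α := rfl
  linarith

/-- Division by the rate absorbs one factor θ. This is the parabolic gain: data in H^ℓ control
H^{ℓ+1} in L² of time. -/
theorem summable_loopWeight_div_rate (hL : 0 < L) (hκ : 0 < κ) (hν : 0 < ν) (hα : 0 < α)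
    (hr0 : 0 < r) (hr : ∀ n, r ≤ rate L κ N ν α n) (ha : Summable fun n => a n ^ 2) {ℓ : ℕ}
    (hℓ : ℓ ≤ 1) (ha' : ℓ = 1 → Summable fun n => eigenvalue L (n + 1) * a n ^ 2) {i : ℕ}
    (hi : i ≤ ℓ + 1) : Summable fun n => loopWeight L κ N i n * a n ^ 2 / rate L κ N ν α n := by
  have hrp : ∀ n, 0 < rate L κ N ν α n := fun n => hr0.trans_le (hr n)
  have hθ' := theta_div_rate_le (L := L) (κ := κ) hν hα hr0 hr
  match i, hi with
  | 0, _ =>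
    refine Summable.of_nonneg_of_le (fun n => ?_) (fun n => ?_) (ha.mul_right r⁻¹)
    · exact div_nonneg (mul_nonneg zero_le_one (sq_nonneg _)) (hrp n).le
    · rw [loopWeight, one_mul, div_eq_mul_inv]
      exact mul_le_mul_of_nonneg_left (inv_anti₀ hr0 (hr n)) (sq_nonneg _)
  | 1, _ =>
    refine Summable.of_nonneg_of_le (fun n => ?_) (fun n => ?_) (ha.mul_left ((1 + α / r) / ν))
    · exact div_nonneg (mul_nonneg (eigenvalue_pos hL n).le (sq_nonneg _)) (hrp n).le
    · rw [loopWeight, mul_div_right_comm]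
      refine mul_le_mul_of_nonneg_right (le_trans ?_ (hθ' n)) (sq_nonneg _)
      exact div_le_div_of_nonneg_right (eigenvalue_le_theta hκ L N n) (hrp n).le
  | 2, hi =>
    obtain rfl : ℓ = 1 := by omega
    refine Summable.of_nonneg_of_le (fun n => ?_) (fun n => ?_)
      (((ha' rfl).add (ha.mul_left κ)).mul_left ((1 + α / r) / ν))
    · exact div_nonneg (mul_nonneg (sq_nonneg _) (sq_nonneg _)) (hrp n).le
    · have e1 : loopWeight L κ N 2 n * a n ^ 2 / rate L κ N ν α n =
          theta L κ N n / rate L κ N ν α n * (theta L κ N n * a n ^ 2) := by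
        rw [loopWeight]; ring
      rw [e1, ← add_mul]
      refine mul_le_mul (hθ' n) (mul_le_mul_of_nonneg_right (theta_le hκ L N n) (sq_nonneg _))
        (mul_nonneg (theta_pos hL hκ N n).le (sq_nonneg _)) (by positivity)
  | i + 3, hi => omega

theorem lintegral_sobolevNorm_loopSolution_lt_top (hL : 0 < L) (hκ : 0 < κ) (hν : 0 < ν)
    (hα : 0 < α) (hr0 : 0 < r) (hr : ∀ n, r ≤ rate L κ N ν α n) (ha : Summable fun n => a n ^ 2)
    {ℓ : ℕ} (hℓ : ℓ ≤ 1) (ha' : ℓ = 1 → Summable fun n => eigenvalue L (n + 1) * a n ^ 2) :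
    ∫⁻ t in Ioi 0, sobolevNorm (ℓ + 1) L (loopSolution L κ N ν α a t) ^ 2 < ⊤ := by
  have h1 : ∀ᵐ t ∂volume.restrict (Ioi 0),
      sobolevNorm (ℓ + 1) L (loopSolution L κ N ν α a t) ^ 2 ≤
      ∑ i ∈ Finset.range (ℓ + 2), ENNReal.ofReal (2 + 16 * N) *
        ∑' n, ENNReal.ofReal (loopWeight L κ N i n * decayCoeff L κ N ν α a t n ^ 2) := by
    filter_upwards [ae_restrict_mem measurableSet_Ioi] with t ht
    refine (sobolevNorm_loopSeries_sq_le hL hκ (summable_abs_decayCoeff hL hκ N hν α ha ht)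
      (summable_decayCoeff_mul_eigenvalue hL hκ N hν α ha ht) (by omega)).trans ?_
    rw [ENNReal.ofReal_mul (by positivity), ENNReal.ofReal_sum_of_nonneg, Finset.mul_sum]
    · exact Finset.sum_le_sum fun i _ => mul_le_mul_right (ofReal_tsum_le_tsum_ofReal
        fun n => mul_nonneg (loopWeight_nonneg hL i n) (sq_nonneg _)) _
    · exact fun i _ => tsum_nonneg fun n => mul_nonneg (loopWeight_nonneg hL i n) (sq_nonneg _)
  refine (lintegral_mono_ae h1).trans_lt ?_
  rw [lintegral_finsetSum']
  · refine ENNReal.sum_lt_top.2 fun i hi => ?_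
    rw [lintegral_const_mul' _ _ ENNReal.ofReal_ne_top]
    refine ENNReal.mul_lt_top ENNReal.ofReal_lt_top ?_
    refine lintegral_tsum_decayCoeff_sq_lt_top (loopWeight_nonneg hL i)
      (fun n => hr0.trans_le (hr n)) ?_
    exact summable_loopWeight_div_rate hL hκ hν hα hr0 hr ha hℓ ha'
      (by have := Finset.mem_range.1 hi; omega)
  · exact fun i _ => ((Measurable.tsum fun n =>
      measurable_ofReal_decayCoeff_sq _ n).const_mul _).aemeasurable

end Time

/-! ### Existence: the weak form of the series. -/

section TestFunction

variable {η : ℝ → ℝ → ℝ} {L T : ℝ}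

theorem hasDerivAt_time (h : ContDiff ℝ ∞ fun p : ℝ × ℝ => η p.1 p.2) (t x : ℝ) :
    HasDerivAt (fun s => η s x) (fderiv ℝ (fun p : ℝ × ℝ => η p.1 p.2) (t, x) (1, 0)) t := by
  have h1 := (h.differentiable (by simp) (t, x)).hasFDerivAt
  exact h1.comp_hasDerivAt t ((hasDerivAt_id t).prodMk (hasDerivAt_const t x))

theorem hasDerivAt_space (h : ContDiff ℝ ∞ fun p : ℝ × ℝ => η p.1 p.2) (t x : ℝ) :
    HasDerivAt (η t) (fderiv ℝ (fun p : ℝ × ℝ => η p.1 p.2) (t, x) (0, 1)) x := by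
  have h1 := (h.differentiable (by simp) (t, x)).hasFDerivAt
  exact h1.comp_hasDerivAt x ((hasDerivAt_const x t).prodMk (hasDerivAt_id x))

theorem continuous_deriv_time (h : ContDiff ℝ ∞ fun p : ℝ × ℝ => η p.1 p.2) :
    Continuous fun p : ℝ × ℝ => deriv (fun s => η s p.2) p.1 := by
  simp_rw [(hasDerivAt_time h _ _).deriv]
  exact (h.continuous_fderiv (by simp)).clm_apply continuous_const

theorem continuous_deriv_space (h : ContDiff ℝ ∞ fun p : ℝ × ℝ => η p.1 p.2) :
    Continuous fun p : ℝ × ℝ => deriv (η p.1) p.2 := by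
  simp_rw [(hasDerivAt_space h _ _).deriv]
  exact (h.continuous_fderiv (by simp)).clm_apply continuous_const

/-- Times down to -1 are included so that t = 0 is interior when integrals over x are differentiated
in t. -/
theorem exists_bound_of_eventually_zero {G : ℝ → ℝ → ℝ}
    (hG : Continuous fun p : ℝ × ℝ => G p.1 p.2) (hT : ∀ t ≥ T, ∀ x, G t x = 0) (L : ℝ) :
    ∃ M, 0 ≤ M ∧ ∀ t, -1 < t → ∀ x ∈ Icc 0 L, |G t x| ≤ M := by
  obtain ⟨C, hC⟩ := ((isCompact_Icc (a := (-1 : ℝ)) (b := T)).prod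
    (isCompact_Icc (a := (0 : ℝ)) (b := L))).exists_bound_of_continuousOn hG.continuousOn
  refine ⟨max C 0, le_max_right _ _, fun t ht x hx => ?_⟩
  by_cases h : t ≤ T
  · exact (hC (t, x) ⟨⟨ht.le, h⟩, hx⟩).trans (le_max_left _ _)
  · rw [hT t (le_of_not_ge h), abs_zero]
    exact le_max_right _ _

theorem abs_innerL2_le_of_bound (hL : 0 < L) {f g : ℝ → ℝ} {A M : ℝ} (hA : ∀ x, |f x| ≤ A)
    (hM : ∀ x ∈ Icc 0 L, |g x| ≤ M) : |innerL2 L f g| ≤ A * M * L := by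
  have h := intervalIntegral.norm_integral_le_of_norm_le_const (a := 0) (b := L)
    (f := fun x => f x * g x) (C := A * M) fun x hx => by
      rw [uIoc_of_le hL.le] at hx
      rw [norm_mul]
      exact mul_le_mul (hA x) (hM x (Ioc_subset_Icc_self hx)) (abs_nonneg _)
        ((abs_nonneg _).trans (hA x))
  rwa [sub_zero, abs_of_pos hL] at h

theorem hasDerivAt_innerL2_time (hL : 0 < L) {q : ℝ → ℝ} (hq : Continuous q)
    (h : ContDiff ℝ ∞ fun p : ℝ × ℝ => η p.1 p.2) (hT : ∀ t ≥ T, ∀ x, η t x = 0) {t : ℝ}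
    (ht : 0 ≤ t) :
    HasDerivAt (fun t => innerL2 L q (η t))
      (innerL2 L q fun x => deriv (fun s => η s x) t) t := by
  obtain ⟨M, hM, hb⟩ := exists_bound_of_eventually_zero (continuous_deriv_time h) (T := T + 1)
    (fun t ht x => deriv_eq_zero_of_eventually_zero (fun s hs => hT s hs x) t ht) L
  have hc : ∀ t, Continuous (η t) := fun t => h.continuous.comp (Continuous.prodMk_right t)
  have hc' : Continuous fun x => deriv (fun s => η s x) t :=
    (continuous_deriv_time h).comp (Continuous.prodMk_right t)
  refine (intervalIntegral.hasDerivAt_integral_of_dominated_loc_of_deriv_le (s := Ioi (-1 : ℝ))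
    (F := fun t x => q x * η t x) (F' := fun t x => q x * deriv (fun s => η s x) t)
    (bound := fun x => |q x| * M) (Ioi_mem_nhds (by linarith)) ?_ ?_ ?_ ?_ ?_ ?_).2
  · exact Filter.Eventually.of_forall fun s => (hq.mul (hc s)).aestronglyMeasurable
  · exact (hq.mul (hc t)).intervalIntegrable _ _
  · exact (hq.mul hc').aestronglyMeasurable
  · refine Filter.Eventually.of_forall fun x hx s hs => ?_
    rw [uIoc_of_le hL.le] at hx
    rw [norm_mul]
    exact mul_le_mul_of_nonneg_left (hb s hs x (Ioc_subset_Icc_self hx)) (abs_nonneg _)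
  · exact (hq.abs.mul_const M).intervalIntegrable _ _
  · exact Filter.Eventually.of_forall fun x _ s _ =>
      (hasDerivAt_time h s x).differentiableAt.hasDerivAt.const_mul _

end TestFunction

section ModeForm

variable {L κ ν α : ℝ} {N : ℕ} {η : ℝ → ℝ → ℝ} {T : ℝ}

/-- The weak form of the plant at time `t` for the eigenfunction of index `n`. -/
noncomputable def modeForm (L κ : ℝ) (N : ℕ) (ν α : ℝ) (η : ℝ → ℝ → ℝ) (n : ℕ) (t : ℝ) : ℝ :=
  innerL2 L (loopMode L κ N n) (fun x => -deriv (fun s => η s x) t - α * η t x) +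
    ν * innerL2 L (loopMode' L κ N n) (deriv (η t))

/-- One integration by parts moves the space derivative off η, which vanishes at both ends.
Multiplied by exp(-st), with s the rate, the form becomes minus the time derivative of exp(-st)(Q_n,
η(t)). -/
theorem modeForm_eq (hL : 0 < L) (hκ : 0 < κ) (h : ContDiff ℝ ∞ fun p : ℝ × ℝ => η p.1 p.2)
    (h0 : ∀ t, η t 0 = 0) (h1 : ∀ t, η t L = 0) (n : ℕ) (t : ℝ) :
    modeForm L κ N ν α η n t = rate L κ N ν α n * innerL2 L (loopMode L κ N n) (η t) -
      innerL2 L (loopMode L κ N n) (fun x => deriv (fun s => η s x) t) := by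
  have hc : Continuous (η t) := h.continuous.comp (Continuous.prodMk_right t)
  have hc' : Continuous fun x => deriv (fun s => η s x) t :=
    (continuous_deriv_time h).comp (Continuous.prodMk_right t)
  have hcx : Continuous (deriv (η t)) :=
    (continuous_deriv_space h).comp (Continuous.prodMk_right t)
  have hQ := continuous_loopMode L κ N n
  have e1 : innerL2 L (loopMode' L κ N n) (deriv (η t)) =
      theta L κ N n * innerL2 L (loopMode L κ N n) (η t) := by
    rw [innerL2, intervalIntegral.integral_mul_deriv_eq_deriv_mul
      (fun x _ => hasDerivAt_loopMode' hL hκ N n x)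
      (fun x _ => (hasDerivAt_space h t x).differentiableAt.hasDerivAt)
      ((hQ.const_mul _).neg.intervalIntegrable _ _) (hcx.intervalIntegrable _ _), h0, h1, innerL2,
      ← intervalIntegral.integral_const_mul, mul_zero, mul_zero, sub_zero, zero_sub,
      ← intervalIntegral.integral_neg]
    congr 1; ext x; ring
  have e2 : innerL2 L (loopMode L κ N n) (fun x => -deriv (fun s => η s x) t - α * η t x) =
      -innerL2 L (loopMode L κ N n) (fun x => deriv (fun s => η s x) t) -
        α * innerL2 L (loopMode L κ N n) (η t) := by
    simp only [innerL2]
    rw [← intervalIntegral.integral_neg, ← intervalIntegral.integral_const_mul,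
      ← intervalIntegral.integral_sub (by apply Continuous.intervalIntegrable; fun_prop)
      (by apply Continuous.intervalIntegrable; fun_prop)]
    congr 1; ext x; ring
  rw [modeForm, e1, e2, rate]; ring

theorem exists_abs_modeForm_le (hL : 0 < L) (hκ : 0 < κ) (hν : 0 < ν)
    (h : ContDiff ℝ ∞ fun p : ℝ × ℝ => η p.1 p.2) (hT : ∀ t ≥ T, ∀ x, η t x = 0) :
    ∃ K, 0 ≤ K ∧ ∀ n, ∀ t, 0 < t → |modeForm L κ N ν α η n t| ≤ K * freq L (n + 1) := by
  obtain ⟨M, hM, hb⟩ := exists_bound_of_eventually_zero (L := L) (T := T + 1)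
    (G := fun t x => -deriv (fun s => η s x) t - α * η t x)
    ((continuous_deriv_time h).neg.sub (h.continuous.const_mul α)) (fun t ht x => by
      rw [deriv_eq_zero_of_eventually_zero (fun s hs => hT s hs x) t ht, hT t (by linarith)]
      simp)
  obtain ⟨M', hM', hb'⟩ := exists_bound_of_eventually_zero (L := L) (T := T)
    (G := fun t x => deriv (η t) x) (continuous_deriv_space h) (fun t ht x => by
      rw [show η t = fun _ => 0 from funext (hT t ht)]; simp)
  have hf := freq_pos hL 0
  refine ⟨√(2 / L) * M * L / freq L (0 + 1) + ν * (√(2 / L) * M' * L), by positivity,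
    fun n t ht => ?_⟩
  have h1 := abs_innerL2_le_of_bound hL (abs_loopMode_le hL hκ N n) (hb t (by linarith))
  have h2 := abs_innerL2_le_of_bound hL (abs_loopMode'_le hL κ N n) (hb' t (by linarith))
  have h3 : freq L (0 + 1) ≤ freq L (n + 1) := by
    rw [← sqrt_eigenvalue hL, ← sqrt_eigenvalue hL]
    exact Real.sqrt_le_sqrt (eigenvalue_le_eigenvalue hL (by omega))
  have h4 : √(2 / L) * M * L ≤ √(2 / L) * M * L / freq L (0 + 1) * freq L (n + 1) := by
    rw [div_mul_eq_mul_div, le_div_iff₀ hf]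
    exact mul_le_mul_of_nonneg_left h3 (by positivity)
  refine (abs_add_le _ _).trans ?_
  rw [abs_mul, abs_of_pos hν, add_mul]
  refine add_le_add (h1.trans h4) ?_
  rw [mul_assoc]
  exact mul_le_mul_of_nonneg_left (h2.trans (le_of_eq (by ring))) hν.le

theorem continuous_modeForm (h : ContDiff ℝ ∞ fun p : ℝ × ℝ => η p.1 p.2) (n : ℕ) :
    Continuous (modeForm L κ N ν α η n) := by
  have hQ := continuous_loopMode L κ N n
  have hQ' := continuous_loopMode' L κ N n
  refine Continuous.add ?_ (Continuous.const_mul ?_ _)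
  · refine intervalIntegral.continuous_parametric_intervalIntegral_of_continuous' ?_ _ _
    exact (hQ.comp continuous_snd).mul
      ((continuous_deriv_time h).neg.sub (h.continuous.const_mul α))
  · refine intervalIntegral.continuous_parametric_intervalIntegral_of_continuous' ?_ _ _
    exact (hQ'.comp continuous_snd).mul (continuous_deriv_space h)

theorem integrableOn_exp_mul_of_bound {D : ℝ → ℝ} (hD : Continuous D) {s K : ℝ} (hs : 0 < s)
    (hK : ∀ t, 0 < t → |D t| ≤ K) (a : ℝ) :
    IntegrableOn (fun t => a * exp (-s * t) * D t) (Ioi 0) ∧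
      ∫ t in Ioi 0, ‖a * exp (-s * t) * D t‖ ≤ |a| * K / s := by
  have h1 : IntegrableOn (fun t => |a| * K * exp (-s * t)) (Ioi 0) :=
    (integrableOn_exp_mul_Ioi (by linarith) 0).const_mul _
  have h2 : ∀ t, 0 < t → ‖a * exp (-s * t) * D t‖ ≤ |a| * K * exp (-s * t) := fun t ht => by
    rw [norm_mul, norm_mul, Real.norm_eq_abs, Real.norm_eq_abs, Real.norm_eq_abs, abs_exp,
      mul_right_comm]
    exact mul_le_mul_of_nonneg_right (mul_le_mul_of_nonneg_left (hK t ht) (abs_nonneg _))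
      (exp_pos _).le
  have h3 : IntegrableOn (fun t => a * exp (-s * t) * D t) (Ioi 0) := by
    refine Integrable.mono' h1 (by fun_prop) ?_
    filter_upwards [ae_restrict_mem measurableSet_Ioi] with t ht using h2 t ht
  refine ⟨h3, (setIntegral_mono_on h3.norm h1 measurableSet_Ioi fun t ht => h2 t ht).trans ?_⟩
  rw [integral_const_mul, integral_exp_mul_Ioi (by linarith)]
  simp only [mul_zero, exp_zero]
  rw [neg_div_neg_eq, mul_one_div]

/-- The integrand is an exact time derivative and η vanishes for large t, so only the value at time
zero remains. -/
theorem integral_exp_mul_modeForm (hL : 0 < L) (hκ : 0 < κ)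
    (h : ContDiff ℝ ∞ fun p : ℝ × ℝ => η p.1 p.2) (h0 : ∀ t, η t 0 = 0) (h1 : ∀ t, η t L = 0)
    (hT : ∀ t ≥ T, ∀ x, η t x = 0) {n : ℕ} (a : ℝ)
    (hi : IntegrableOn (fun t => a * exp (-rate L κ N ν α n * t) * modeForm L κ N ν α η n t)
      (Ioi 0)) :
    ∫ t in Ioi 0, a * exp (-rate L κ N ν α n * t) * modeForm L κ N ν α η n t =
      a * innerL2 L (loopMode L κ N n) (η 0) := by
  set s := rate L κ N ν α n with hs
  have hd : ∀ t ∈ Ici (0 : ℝ), HasDerivAt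
      (fun t => -(a * exp (-s * t)) * innerL2 L (loopMode L κ N n) (η t))
      (a * exp (-s * t) * modeForm L κ N ν α η n t) t := fun t ht => by
    have d1 := hasDerivAt_innerL2_time hL (continuous_loopMode L κ N n) h hT ht
    have d2 : HasDerivAt (fun t => -(a * exp (-s * t))) (s * (a * exp (-s * t))) t := by
      have := ((((hasDerivAt_id t).const_mul (-s)).exp).const_mul a).neg
      refine this.congr_deriv ?_
      simp only [id]; ring
    refine (d2.mul d1).congr_deriv ?_
    rw [modeForm_eq hL hκ h h0 h1, ← hs]; ring
  rw [integral_Ioi_of_hasDerivAt_of_tendsto' hd hi (m := 0)]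
  · simp
  · refine tendsto_const_nhds.congr' ?_
    filter_upwards [Filter.eventually_ge_atTop T] with t ht
    rw [show η t = fun _ => 0 from funext (hT t ht)]
    simp [innerL2]

end ModeForm

section Existence

variable {L κ ν α r : ℝ} {N : ℕ} {a : ℕ → ℝ} {η : ℝ → ℝ → ℝ} {T : ℝ} {u₀ : ℝ → ℝ}

/-- The rate grows like the squared frequency, so the term is at most a multiple of |a_n| over the
frequency, hence of a_n² + 1/λ. This justifies exchanging sum and time integral in the weak form. -/
theorem summable_abs_mul_freq_div_rate (hL : 0 < L) (hκ : 0 < κ) (hν : 0 < ν) (hα : 0 < α)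
    (hr0 : 0 < r) (hr : ∀ n, r ≤ rate L κ N ν α n) (ha : Summable fun n => a n ^ 2) :
    Summable fun n => |a n| * freq L (n + 1) / rate L κ N ν α n := by
  refine Summable.of_nonneg_of_le (fun n => ?_) (fun n => ?_)
    ((ha.add (summable_inv_eigenvalue L)).mul_left ((1 + α / r) / ν))
  · exact div_nonneg (mul_nonneg (abs_nonneg _) (freq_pos hL n).le) (hr0.trans_le (hr n)).le
  · have hf := freq_pos hL n
    have h1 : freq L (n + 1) ^ 2 / rate L κ N ν α n ≤ (1 + α / r) / ν := by
      refine le_trans ?_ (theta_div_rate_le hν hα hr0 hr n)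
      rw [← eigenvalue_eq]
      exact div_le_div_of_nonneg_right (eigenvalue_le_theta hκ L N n) (hr0.trans_le (hr n)).le
    have h2 : |a n| * freq L (n + 1) / rate L κ N ν α n =
        freq L (n + 1) ^ 2 / rate L κ N ν α n * (|a n| * (freq L (n + 1))⁻¹) := by
      field_simp
    have h3 : |a n| * (freq L (n + 1))⁻¹ ≤ a n ^ 2 + (eigenvalue L (n + 1))⁻¹ := by
      rw [eigenvalue_eq, ← inv_pow, ← sq_abs (a n)]
      nlinarith [sq_nonneg (|a n| - (freq L (n + 1))⁻¹), sq_nonneg (|a n|),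
        sq_nonneg (freq L (n + 1))⁻¹]
    rw [h2]
    exact mul_le_mul h1 h3 (by positivity) (by positivity)

theorem hasSum_modeForm (hL : 0 < L) (hκ : 0 < κ) (hν : 0 < ν)
    (ha : Summable fun n => a n ^ 2) (h : ContDiff ℝ ∞ fun p : ℝ × ℝ => η p.1 p.2) {t : ℝ}
    (ht : 0 < t) :
    HasSum (fun n => a n * exp (-rate L κ N ν α n * t) * modeForm L κ N ν α η n t)
      (∫ x in (0 : ℝ)..L, (-(loopSolution L κ N ν α a t x * deriv (fun s => η s x) t) +
        ν * (weakDeriv L 1 (loopSolution L κ N ν α a t) x * deriv (η t) x) -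
        α * (loopSolution L κ N ν α a t x * η t x))) := by
  have h0 := summable_abs_decayCoeff hL hκ N hν α ha ht
  have h1 := summable_decayCoeff_mul_eigenvalue hL hκ N hν α ha ht
  have hc : Continuous (η t) := h.continuous.comp (Continuous.prodMk_right t)
  have hc' : Continuous fun x => deriv (fun s => η s x) t :=
    (continuous_deriv_time h).comp (Continuous.prodMk_right t)
  have hcx : Continuous (deriv (η t)) :=
    (continuous_deriv_space h).comp (Continuous.prodMk_right t)
  have hU := continuous_loopSeries hL hκ N h0
  have hU' := continuous_loopSeries' hL κ N h0 h1
  have s1 := hasSum_innerL2_tsum hL (g := fun x => -deriv (fun s => η s x) t - α * η t x)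
    (fun n => (continuous_loopMode L κ N n).const_mul _)
    (abs_mul_loopMode_le hL hκ N _) (h0.mul_right _) (integrable_of_memLp_two
      (memLp_vol_of_continuous (hc'.neg.sub (hc.const_mul α)) 2))
  have s2 := hasSum_innerL2_tsum hL (fun n => (continuous_loopMode' L κ N n).const_mul _)
    (abs_mul_loopMode'_le hL κ N _) ((summable_abs_mul_freq h0 h1).mul_right _)
    (integrable_of_memLp_two (memLp_vol_of_continuous hcx 2))
  have s3 := s1.add (s2.mul_left ν)
  simp only [innerL2_const_mul_left] at s3
  have e1 : ∫ x in (0 : ℝ)..L, (-(loopSolution L κ N ν α a t x * deriv (fun s => η s x) t) +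
        ν * (weakDeriv L 1 (loopSolution L κ N ν α a t) x * deriv (η t) x) -
        α * (loopSolution L κ N ν α a t x * η t x)) =
      innerL2 L (loopSeries L κ N (decayCoeff L κ N ν α a t))
        (fun x => -deriv (fun s => η s x) t - α * η t x) +
      ν * innerL2 L (loopSeries' L κ N (decayCoeff L κ N ν α a t)) (deriv (η t)) := by
    have hw := weakDeriv_ae_eq hL (memLp_vol_of_continuous hU' 2)
      (hasWeakDeriv_one_loopSeries hL hκ h0 h1)
    simp only [innerL2]
    rw [← intervalIntegral.integral_const_mul, ← intervalIntegral.integral_add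
      (by apply Continuous.intervalIntegrable; fun_prop)
      (by apply Continuous.intervalIntegrable; fun_prop)]
    refine intervalIntegral_congr_vol hL ?_
    filter_upwards [hw] with x hx
    rw [loopSolution, hx]; ring
  rw [e1]
  refine s3.congr_fun ?_
  intro n
  rw [modeForm, decayCoeff]; ring

/-- Parseval for the corrected datum plus the finite sum for the correction. It shows that the
series takes the initial value u₀ in the sense of the weak form. -/
theorem hasSum_loopCoeff_mul (hL : 0 < L) (hG : IsUnit (gram L κ N))
    (hu₀ : MemLp u₀ 2 (vol L)) {f : ℝ → ℝ} (hf : Continuous f) :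
    HasSum (fun n => loopCoeff L κ N u₀ n * innerL2 L (loopMode L κ N n) f) (innerL2 L u₀ f) := by
  have hfm := memLp_vol_of_continuous (L := L) hf 2
  have hcm := memLp_vol_of_continuous (L := L) (continuous_loopCorrection L κ N u₀) 2
  have s1 := hasSum_innerL2_e_mul hL (hu₀.sub hcm) hfm
  have s2 : HasSum (fun n => loopCoeff L κ N u₀ n *
      innerL2 L (fun x => loopMode L κ N n x - e L (n + 1) x) f)
      (∑ n ∈ Finset.range N, loopCoeff L κ N u₀ n *
        innerL2 L (fun x => loopMode L κ N n x - e L (n + 1) x) f) := by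
    refine hasSum_sum_of_ne_finset_zero fun n hn => ?_
    rw [loopMode_of_le hL κ (by simpa using hn)]
    simp [innerL2]
  have e2 : ∑ n ∈ Finset.range N, loopCoeff L κ N u₀ n *
      innerL2 L (fun x => loopMode L κ N n x - e L (n + 1) x) f =
      innerL2 L (loopCorrection L κ N u₀) f := by
    rw [← Fin.sum_univ_eq_sum_range (fun n => loopCoeff L κ N u₀ n *
      innerL2 L (fun x => loopMode L κ N n x - e L (n + 1) x) f)]
    unfold loopCorrection
    have hc := continuous_loopMode L κ N
    have hc' := continuous_e L
    rw [innerL2_sum_left _ hL (fun i _ => memLp_vol_of_continuous (by fun_prop) _) hfm]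
    refine Finset.sum_congr rfl fun i _ => ?_
    rw [innerL2_const_mul_left, loopCoeff_fin hG]
  rw [e2] at s2
  have s3 := s1.add s2
  have e3 : innerL2 L (u₀ - loopCorrection L κ N u₀) f = innerL2 L u₀ f -
      innerL2 L (loopCorrection L κ N u₀) f := innerL2_sub_left hL hu₀ hcm hfm
  rw [e3, sub_add_cancel] at s3
  refine s3.congr_fun fun n => ?_
  have e4 : innerL2 L (e L (n + 1)) (u₀ - loopCorrection L κ N u₀) = loopCoeff L κ N u₀ n :=
    innerL2_e_sub_loopCorrection hL κ N hu₀ n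
  have e5 := innerL2_sub_left hL (memLp_vol_of_continuous (continuous_loopMode L κ N n) 2)
    (memLp_vol_of_continuous (continuous_e L (n + 1)) 2) hfm
  rw [e4, e5]; ring

theorem weak_form_loopSolution (hL : 0 < L) (hκ : 0 < κ) (hν : 0 < ν) (hα : 0 < α)
    (hr0 : 0 < r) (hr : ∀ n, r ≤ rate L κ N ν α n) (hG : IsUnit (gram L κ N))
    (hu₀ : MemLp u₀ 2 (vol L)) (ha : Summable fun n => loopCoeff L κ N u₀ n ^ 2)
    (h : ContDiff ℝ ∞ fun p : ℝ × ℝ => η p.1 p.2)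
    (h0 : ∀ t, η t 0 = 0) (h1 : ∀ t, η t L = 0) (hT : ∀ t ≥ T, ∀ x, η t x = 0) :
    ∫ t in Ioi 0, (∫ x in (0 : ℝ)..L,
        (-(loopSolution L κ N ν α (loopCoeff L κ N u₀) t x * deriv (fun s => η s x) t) +
        ν * (weakDeriv L 1 (loopSolution L κ N ν α (loopCoeff L κ N u₀) t) x * deriv (η t) x) -
        α * (loopSolution L κ N ν α (loopCoeff L κ N u₀) t x * η t x))) =
      ∫ x in (0 : ℝ)..L, u₀ x * η 0 x := by
  set a := loopCoeff L κ N u₀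
  obtain ⟨K, hK, hb⟩ := exists_abs_modeForm_le (κ := κ) (N := N) (α := α) hL hκ hν h hT
  have hi := fun n => integrableOn_exp_mul_of_bound
    (continuous_modeForm (L := L) (κ := κ) (N := N) (ν := ν) (α := α) h n)
    (hr0.trans_le (hr n)) (hb n) (a n)
  have hs : Summable fun n => ∫ t in Ioi 0,
      ‖a n * exp (-rate L κ N ν α n * t) * modeForm L κ N ν α η n t‖ := by
    refine Summable.of_nonneg_of_le (fun n => integral_nonneg fun _ => norm_nonneg _)
      (fun n => (hi n).2)
      (((summable_abs_mul_freq_div_rate hL hκ hν hα hr0 hr ha).mul_left K).congr fun n => ?_)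
    ring
  have s1 := hasSum_integral_of_summable_integral_norm (fun n => (hi n).1) hs
  have s2 := hasSum_loopCoeff_mul hL hG hu₀ (h.continuous.comp (Continuous.prodMk_right 0))
  simp_rw [integral_exp_mul_modeForm hL hκ h h0 h1 hT _ (hi _).1] at s1
  refine Eq.trans ?_ (s1.unique s2)
  refine setIntegral_congr_fun measurableSet_Ioi fun t ht => ?_
  exact (hasSum_modeForm hL hκ hν ha h ht).tsum_eq.symm

theorem measurable_loopSolution (L κ : ℝ) (N : ℕ) (ν α : ℝ) (a : ℕ → ℝ) :
    Measurable fun p : ℝ × ℝ => loopSolution L κ N ν α a p.1 p.2 := by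
  refine Measurable.tsum fun n => ?_
  have h1 := continuous_loopMode L κ N n
  have : Continuous fun p : ℝ × ℝ => decayCoeff L κ N ν α a p.1 n * loopMode L κ N n p.2 := by
    unfold decayCoeff; fun_prop
  exact this.measurable

theorem isWeakSolution_loopSolution {g : (ℝ → ℝ) → ℝ} (hL : 0 < L) (hκ : 0 < κ) (hν : 0 < ν)
    (hα : 0 < α) (hr0 : 0 < r) (hr : ∀ n, r ≤ rate L κ N ν α n) (hG : IsUnit (gram L κ N))
    (hg : ∀ f, g f = ∑ j : Fin N, lowModes L κ N f j * loopMode L κ N j L)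
    (hu₀ : MemLp u₀ 2 (vol L)) (ha : Summable fun n => loopCoeff L κ N u₀ n ^ 2) :
    IsWeakSolution L ν α g u₀ (loopSolution L κ N ν α (loopCoeff L κ N u₀)) where
  measurable := (measurable_loopSolution L κ N ν α _).aestronglyMeasurable
  memSobolev := by
    filter_upwards [ae_restrict_mem measurableSet_Ioi] with t ht
    exact memSobolev_loopSeries hL hκ (summable_abs_decayCoeff hL hκ N hν α ha ht)
      (summable_decayCoeff_mul_eigenvalue hL hκ N hν α ha ht) one_le_two
  sq_integrable T _ := (lintegral_mono_set Ioo_subset_Ioi_self).trans_lt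
    (lintegral_sobolevNorm_loopSolution_lt_top hL hκ hν hα hr0 hr ha zero_le_one (by simp))
  boundary := by
    filter_upwards [ae_restrict_mem measurableSet_Ioi] with t ht
    rw [hg]
    exact hasTraces_loopSeries hL hκ hG (summable_abs_decayCoeff hL hκ N hν α ha ht)
  weak_form η h h0 h1 := fun ⟨_, hT⟩ =>
    weak_form_loopSolution hL hκ hν hα hr0 hr hG hu₀ ha h h0 h1 hT

end Existence

/-! ### The decay estimate and the conclusion. -/

section Decay

variable {L κ ν α μ r : ℝ} {N : ℕ}

theorem MemSobolev.sobolevNorm_lt_top {m : ℕ} {f : ℝ → ℝ} (hL : 0 < L) (hf : MemSobolev m L f) :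
    sobolevNorm m L f < ⊤ := by
  have h := sobolevNorm_sq hL (g := fun i => weakDeriv L i f) hf.1
    (fun i hi => hf.memLp_weakDeriv hi) (fun i hi => hf.hasWeakDeriv hi)
  refine lt_top_iff_ne_top.2 fun h' => ?_
  rw [h'] at h
  simp at h

/-- The constant is fixed before ν, α and r, so the system parameters enter it only through κ. This
is what later allows it to be a function of the kernel. -/
theorem exists_loopSolution_bound (hL : 0 < L) (hκ : 0 < κ) (N : ℕ) {ℓ : ℕ} (hℓ : ℓ ≤ 1) :
    ∃ C, 0 ≤ C ∧ ∀ u₀, MemSobolev ℓ L u₀ →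
      (ℓ = 1 → HasTraces L u₀ 0 (∑ i : Fin N, lowModes L κ N u₀ i * loopMode L κ N i L)) →
      Summable (fun n => loopCoeff L κ N u₀ n ^ 2) ∧
      (ℓ = 1 → Summable fun n => eigenvalue L (n + 1) * loopCoeff L κ N u₀ n ^ 2) ∧
      ∀ ν α r, 0 < ν → (∀ n, r ≤ rate L κ N ν α n) → ∀ t, 0 < t →
        sobolevNorm ℓ L (loopSolution L κ N ν α (loopCoeff L κ N u₀) t) ≤
          ENNReal.ofReal (C * exp (-r * t)) * sobolevNorm ℓ L u₀ := by
  obtain ⟨C, hC, h⟩ := exists_loopCoeff_bound hL hκ N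
  refine ⟨√((2 + 16 * N) * (2 * C)), Real.sqrt_nonneg _, fun u₀ hu₀ ht => ?_⟩
  obtain ⟨⟨h1, h2⟩, h3⟩ := h u₀ hu₀.1
  have h3 := fun hℓ1 : ℓ = 1 => h3 _ (hu₀.memLp_weakDeriv hℓ1.ge) (hu₀.hasWeakDeriv hℓ1.ge) (ht hℓ1)
  refine ⟨h1, fun hℓ1 => (h3 hℓ1).1, fun ν α r hν hr t ht => ?_⟩
  set a := loopCoeff L κ N u₀
  set G : ℕ → ℝ → ℝ := fun i => if i = 0 then u₀ else weakDeriv L i u₀ with hG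
  set S := ∑ i ∈ Finset.range (ℓ + 1), innerL2 L (G i) (G i) with hS
  have hS0 : sobolevNorm ℓ L u₀ ^ 2 = ENNReal.ofReal S := by
    refine sobolevNorm_sq hL hu₀.1 (fun i hi => ?_) (fun i hi => ?_)
    · rw [hG]; dsimp only; split_ifs
      exacts [hu₀.1, hu₀.memLp_weakDeriv hi]
    · rw [hG]; dsimp only; split_ifs with h0
      · rw [h0]; exact hasWeakDeriv_zero L u₀
      · exact hu₀.hasWeakDeriv hi
  have hw : ∀ i ∈ Finset.range (ℓ + 1), Summable fun n => loopWeight L κ N i n * a n ^ 2 := by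
    intro i hi
    have hi' := Finset.mem_range.1 hi
    obtain rfl | rfl : i = 0 ∨ i = 1 := by omega
    · simpa only [loopWeight, one_mul] using h1
    · exact (h3 (by omega)).1
  -- For ℓ = 1 the bounds for the two orders add up to C(2‖u₀‖² + ‖u₀'‖²), whence the factor 2.
  have hB : ∑ i ∈ Finset.range (ℓ + 1), ∑' n, loopWeight L κ N i n * a n ^ 2 ≤ 2 * C * S := by
    have hn := mul_nonneg hC (innerL2_self_nonneg hL u₀)
    obtain rfl | rfl : ℓ = 0 ∨ ℓ = 1 := by omega
    · simp only [hS, hG, zero_add, Finset.sum_range_one, loopWeight, one_mul, if_true]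
      linarith
    · have h4 := (h3 rfl).2
      have hn' := mul_nonneg hC (innerL2_self_nonneg hL (weakDeriv L 1 u₀))
      simp only [hS, hG, Finset.sum_range_succ, Finset.sum_range_zero, zero_add, loopWeight,
        one_mul, if_true, one_ne_zero, if_false]
      linarith
  have hE : (√((2 + 16 * N) * (2 * C)) * exp (-r * t)) ^ 2 =
      (2 + 16 * N) * (2 * C) * exp (-(2 * r) * t) := by
    rw [mul_pow, Real.sq_sqrt (by positivity), ← exp_nat_mul]
    congr 2; push_cast; ring
  rw [← ENNReal.pow_le_pow_left_iff two_ne_zero, mul_pow, hS0, ← ENNReal.ofReal_pow (by positivity),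
    ← ENNReal.ofReal_mul (by positivity), hE]
  refine (sobolevNorm_loopSeries_sq_le hL hκ (summable_abs_decayCoeff hL hκ N hν α h1 ht)
    (summable_decayCoeff_mul_eigenvalue hL hκ N hν α h1 ht) (by omega)).trans
    (ENNReal.ofReal_le_ofReal ?_)
  rw [mul_assoc, mul_assoc]
  refine mul_le_mul_of_nonneg_left ?_ (by positivity)
  calc _ ≤ ∑ i ∈ Finset.range (ℓ + 1),
          exp (-(2 * r) * t) * ∑' n, loopWeight L κ N i n * a n ^ 2 :=
        Finset.sum_le_sum fun i hi =>
          tsum_mul_decayCoeff_sq_le (loopWeight_nonneg hL i) hr (hw i hi) ht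
    _ ≤ exp (-(2 * r) * t) * (2 * C * S) := by
        rw [← Finset.mul_sum]
        exact mul_le_mul_of_nonneg_left hB (exp_pos _).le
    _ = _ := by ring

theorem memX_of_bound {ℓ : ℕ} {g : (ℝ → ℝ) → ℝ} {u₀ : ℝ → ℝ} {u : ℝ → ℝ → ℝ} {T : ℝ} {B : ℝ≥0∞}
    (hu : IsWeakSolution L ν α g u₀ u) (hB : B < ⊤)
    (h1 : ∀ᵐ t ∂volume.restrict (Ioi 0), sobolevNorm ℓ L (u t) ≤ B)
    (h2 : ∫⁻ t in Ioi 0, sobolevNorm (ℓ + 1) L (u t) ^ 2 < ⊤) : MemX ℓ L T u := by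
  refine ⟨hu.measurable.mono_set (prod_mono Ioo_subset_Ioi_self le_rfl), ENNReal.add_lt_top.2
    ⟨lt_of_le_of_lt (essSup_le_of_ae_le (B ^ 2) ?_) (ENNReal.pow_lt_top hB),
      (lintegral_mono_set Ioo_subset_Ioi_self).trans_lt h2⟩⟩
  filter_upwards [ae_restrict_of_ae_restrict_of_subset Ioo_subset_Ioi_self h1] with t ht
  exact pow_le_pow_left' ht 2

theorem kernel_one_one (ν μ : ℝ) : kernel ν μ 1 1 = -(μ / (2 * ν)) := by
  rw [kernel, tsum_eq_single 0 (fun m hm => by simp [hm])]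
  simp

theorem eigenvalue_eq_sq_mul (L : ℝ) (j : ℕ) : eigenvalue L j = (j : ℝ) ^ 2 * eigenvalue L 1 := by
  simp only [eigenvalue, Nat.cast_one]; ring

/-- A shifted mode has rate at least νλ_1 + μ - α. For the others μ/2 < νλ_{N+1}, and λ_{N+1}(1 -
1/(N+1)²) = λ_{N+1} - λ_1 because eigenvalues grow like squares. -/
theorem le_rate_of_lt (hL : 0 < L) (hν : 0 < ν) (hμ : 0 < μ)
    (hμ' : μ < 2 * ν * eigenvalue L (N + 1)) (n : ℕ) :
    ν * eigenvalue L 1 - α + μ / 2 * (1 - 1 / ((N : ℝ) + 1) ^ 2) ≤ rate L (μ / ν) N ν α n := by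
  have hq : 0 ≤ 1 / ((N : ℝ) + 1) ^ 2 := by positivity
  have hq' : 1 / ((N : ℝ) + 1) ^ 2 ≤ 1 := by
    rw [div_le_one (by positivity)]; nlinarith [(Nat.cast_nonneg N : (0 : ℝ) ≤ N)]
  rw [rate]
  rcases lt_or_ge n N with h | h
  · have h1 := mul_le_mul_of_nonneg_left
      (eigenvalue_le_eigenvalue hL (show 1 ≤ n + 1 by omega)) hν.le
    rw [theta_of_lt _ _ h, mul_add, mul_div_cancel₀ _ hν.ne']
    nlinarith [mul_nonneg hμ.le hq]
  · have h1 := mul_le_mul_of_nonneg_left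
      (eigenvalue_le_eigenvalue hL (show N + 1 ≤ n + 1 by omega)) hν.le
    rw [theta_of_le _ _ h]
    have h2 : eigenvalue L (N + 1) * (1 - 1 / ((N : ℝ) + 1) ^ 2) =
        eigenvalue L (N + 1) - eigenvalue L 1 := by
      rw [eigenvalue_eq_sq_mul L (N + 1)]
      push_cast
      field_simp
    have h3 : μ / 2 * (1 - 1 / ((N : ℝ) + 1) ^ 2) ≤
        ν * (eigenvalue L (N + 1) * (1 - 1 / ((N : ℝ) + 1) ^ 2)) := by
      rw [← mul_assoc]
      exact mul_le_mul_of_nonneg_right (by linarith) (by linarith)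
    rw [h2] at h3
    linarith

end Decay

end Backstepping

theorem mainTheorem3 (L : ℝ) (hL : 0 < L) (N : ℕ) (hN : 1 ≤ N) (ℓ : ℕ) (hℓ : ℓ = 0 ∨ ℓ = 1) :
    ∃ c : (ℝ → ℝ → ℝ) → ℝ, (∀ k, 0 ≤ c k) ∧
      ∀ ν α μ ρ : ℝ, 0 < ν → 0 < α →
        eigenvalue L N < α / ν → α / ν < eigenvalue L (N + 1) →
        2 * (α - ν * eigenvalue L 1) * (1 - 1 / ((N : ℝ) + 1) ^ 2)⁻¹ < μ →
        μ < 2 * ν * eigenvalue L (N + 1) →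
        IsAdmissible L (kernel ν μ) N →
        ρ = ν * eigenvalue L 1 - α + μ / 2 * (1 - 1 / ((N : ℝ) + 1) ^ 2) →
        0 < ρ ∧
        ∀ u₀ : ℝ → ℝ, MemSobolev ℓ L u₀ →
          (ℓ = 1 → HasTraces L u₀ 0 (feedback L (kernel ν μ) N u₀)) →
          (∃ u, IsWeakSolution L ν α (feedback L (kernel ν μ) N) u₀ u) ∧
          (∀ u v, IsWeakSolution L ν α (feedback L (kernel ν μ) N) u₀ u →
            IsWeakSolution L ν α (feedback L (kernel ν μ) N) u₀ v →
            ∀ᵐ t ∂volume.restrict (Ioi 0), u t =ᵐ[vol L] v t) ∧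
          ∀ u, IsWeakSolution L ν α (feedback L (kernel ν μ) N) u₀ u →
            (∀ T > 0, MemX ℓ L T u) ∧
            ∀ᵐ t ∂volume.restrict (Ioi 0),
              sobolevNorm ℓ L (u t) ≤
                ENNReal.ofReal (c (kernel ν μ) * exp (-ρ * t)) * sobolevNorm ℓ L u₀ := by
  have hℓ' : ℓ ≤ 1 := by omega
  -- The kernel determines κ through its value k(1, 1) = -μ/(2ν), so the constant for κ = -2k(1, 1)
  -- depends on k alone. The value 0 serves functions k with -2k(1, 1) ≤ 0, which do not occur
  -- below.
  refine ⟨fun k => if h : 0 < -2 * k 1 1 then (exists_loopSolution_bound hL h N hℓ').choose else 0,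
    fun k => ?_, fun ν α μ ρ hν hα h1 _ h3 h4 hN' hρ => ?_⟩
  · dsimp only
    split_ifs with h
    exacts [(exists_loopSolution_bound hL h N hℓ').choose_spec.1, le_rfl]
  have hq : 0 < 1 - 1 / ((N : ℝ) + 1) ^ 2 := by
    have hN1 : (1 : ℝ) ≤ N := by exact_mod_cast hN
    rw [sub_pos, div_lt_one (by positivity)]
    nlinarith
  -- The first mode is unstable because λ_1 ≤ λ_N < α/ν; this makes the lower bound for μ, and hence
  -- μ, positive.
  have hα1 : 0 < α - ν * eigenvalue L 1 := by
    have := (eigenvalue_le_eigenvalue hL hN).trans_lt h1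
    rw [lt_div_iff₀ hν] at this
    linarith
  have hμ : 0 < μ := lt_of_le_of_lt (by positivity) h3
  have hρ0 : 0 < ρ := by
    rw [← div_eq_mul_inv, div_lt_iff₀ hq] at h3
    linarith
  have hr : ∀ n, ρ ≤ rate L (μ / ν) N ν α n := fun n => hρ ▸ le_rate_of_lt hL hν hμ h4 n
  have hκ : 0 < μ / ν := div_pos hμ hν
  obtain ⟨hG, hg⟩ := feedback_kernel hL hκ rfl hN'
  have hk : -2 * kernel ν μ 1 1 = μ / ν := by rw [kernel_one_one]; field_simp
  refine ⟨hρ0, fun u₀ hu₀ ht => ?_⟩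
  have hk0 : 0 < -2 * kernel ν μ 1 1 := hk ▸ hκ
  beta_reduce
  rw [dif_pos hk0]
  have hC := (exists_loopSolution_bound hL hk0 N hℓ').choose_spec.2 u₀ hu₀
  have hC0 := (exists_loopSolution_bound hL hk0 N hℓ').choose_spec.1
  generalize (exists_loopSolution_bound hL hk0 N hℓ').choose = C at hC hC0
  rw [hk] at hC
  obtain ⟨ha, ha', hb⟩ := hC fun hℓ1 => hg u₀ ▸ ht hℓ1
  have hU : ∀ u, IsWeakSolution L ν α (feedback L (kernel ν μ) N) u₀ u →
      ∀ᵐ t ∂volume.restrict (Ioi 0), u t =ᵐ[vol L]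
        loopSolution L (μ / ν) N ν α (loopCoeff L (μ / ν) N u₀) t := fun u hu =>
    hu.ae_eq_loopSeries hL hκ hν hG hg ha
  refine ⟨⟨_, isWeakSolution_loopSolution hL hκ hν hα hρ0 hr hG hg hu₀.1 ha⟩,
    fun u v hu hv => ?_, fun u hu => ?_⟩
  · filter_upwards [hU u hu, hU v hv] with t h h' using h.trans h'.symm
  have hd : ∀ᵐ t ∂volume.restrict (Ioi 0), sobolevNorm ℓ L (u t) ≤
      ENNReal.ofReal (C * exp (-ρ * t)) * sobolevNorm ℓ L u₀ := by
    filter_upwards [hU u hu, ae_restrict_mem measurableSet_Ioi] with t h ht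
    rw [sobolevNorm_congr hL h]
    exact hb ν α ρ hν hr t ht
  refine ⟨fun T _ => memX_of_bound (B := ENNReal.ofReal C * sobolevNorm ℓ L u₀) hu
    (ENNReal.mul_lt_top ENNReal.ofReal_lt_top (hu₀.sobolevNorm_lt_top hL)) ?_ ?_, hd⟩
  · filter_upwards [hd, ae_restrict_mem measurableSet_Ioi] with t h ht
    refine h.trans (mul_le_mul_left (ENNReal.ofReal_le_ofReal ?_) _)
    refine mul_le_of_le_one_right hC0 (exp_le_one_iff.2 ?_)
    rw [neg_mul, neg_nonpos]
    exact mul_nonneg hρ0.le (le_of_lt ht)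
  · rw [lintegral_congr_ae (g := fun t => sobolevNorm (ℓ + 1) L
      (loopSolution L (μ / ν) N ν α (loopCoeff L (μ / ν) N u₀) t) ^ 2)]
    · exact lintegral_sobolevNorm_loopSolution_lt_top hL hκ hν hα hρ0 hr ha hℓ' ha'
    · filter_upwards [hU u hu] with t h
      rw [sobolevNorm_congr hL h]
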